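/- **Conventions.** All C*-algebras are over $\mathbb{C}$, and $\otimes$ is the minimal (spatial) tensor product; $[\,\cdot\,]$ denotes closed linear span. A *compact quantum group* $G$ is a pair $(\mathrm{C}(G),\Delta_G)$ of a nonzero unital C*-algebra $\mathrm{C}(G)$ and a unital $*$-homomorphism $\Delta_G:\mathrm{C}(G)\to \mathrm{C}(G)\otimes \mathrm{C}(G)$ with $(\Delta_G\otimes \mathrm{id})\Delta_G=(\mathrm{id}\otimes\Delta_G)\Delta_G$ and $[\Delta_G(\mathrm{C}(G))(1\otimes \mathrm{C}(G))]=\mathrm{C}(G)\otimes \mathrm{C}(G)=[\Delta_G(\mathrm{C}(G))(\mathrm{C}(G)\otimes 1)]$. A *Hopf $*$-homomorphism* $f:\mathrm{C}(G_2)\to \mathrm{C}(G_1)$ is a unital $*$-homomorphism with $(f\otimes f)\Delta_{G_2}=\Delta_{G_1}f$; $G_1$ and $G_2$ are *isomorphic* if there is a bijective one. A linear map $T:B\to B\otimes \mathrm{C}(G)$ is *coassociative* if $(T\otimes\mathrm{id})T=(\mathrm{id}\otimes\Delta_G)T$, and satisfies the *Podleś condition* if $[T(B)(1\otimes \mathrm{C}(G))]=B\otimes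 \mathrm{C}(G)$. A unital C*-algebra $B$ with a unital $*$-homomorphism $T$ of this kind that satisfies both is a *$G$-C*-algebra*; the action $T$ is *faithful* if the $*$-algebra generated by $\{(\omega\otimes\mathrm{id})T(b): b\in B,\ \omega\in B^*\}$ is dense in $\mathrm{C}(G)$. **The category.** Let $\mathcal{G}=(\mathcal{G}^0,\mathcal{G}^1,r,s)$ be a finite directed graph, possibly with loops and multiple edges, with range and source maps $r,s:\mathcal{G}^1\to\mathcal{G}^0$. Its graph correspondence is $\mathrm{C}(\mathcal{G}^1)$ with, for $\xi,\eta\in \mathrm{C}(\mathcal{G}^1)$ and $f\in \mathrm{C}(\mathcal{G}^0)$, $$(\xi\cdot f)(e)=\xi(e)f(r(e)),\qquad \langle\xi,\eta\rangle(v)=\sum_{r(e)=v}\overline{\xi(e)}\,\eta(e),\qquad (\phi(f)\xi)(e)=f(s(e))\xi(e).$$ The same formulas define the right action, the inner product and the left action for functions with values in $\mathrm{C}(G)$, that is, for $\mathrm{C}(\mathcal{G}^i)\otimes \mathrm{C}(G)$. The category $\mathcal{C}_{\mathrm{Bic}}^{\mathrm{mult}}(\mathcal{G})$ has as objects the triples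 $(G,\alpha,\lambda)$ of a compact quantum group $G$, a unital $*$-homomorphism $\alpha:\mathrm{C}(\mathcal{G}^0)\to \mathrm{C}(\mathcal{G}^0)\otimes \mathrm{C}(G)$ and a linear map $\lambda:\mathrm{C}(\mathcal{G}^1)\to \mathrm{C}(\mathcal{G}^1)\otimes \mathrm{C}(G)$ such that - $(\mathrm{C}(\mathcal{G}^0),\alpha)$ is a $G$-C*-algebra; - $(\mathrm{C}(\mathcal{G}^1),\phi,\lambda)$ is a $G$-equivariant C*-correspondence over it: $\lambda(\xi\cdot f)=\lambda(\xi)\cdot\alpha(f)$, $\langle\lambda(\xi),\lambda(\eta)\rangle=\alpha(\langle\xi,\eta\rangle)$, $\lambda(\phi(f)\xi)=\alpha(f)\cdot\lambda(\xi)$ (left action), and $\lambda$ is coassociative and satisfies the Podleś condition; - $(\mathrm{C}(\mathcal{G}^1),\lambda)$ is a $G$-C*-algebra and the action $\lambda$ is faithful. A morphism $(G_1,\alpha_1,\lambda_1)\to(G_2,\alpha_2,\lambda_2)$ is a Hopf $*$-homomorphism $f:\mathrm{C}(G_2)\to \mathrm{C}(G_1)$ with $(\mathrm{id}\otimes f)\alpha_2=\alpha_1$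 and $(\mathrm{id}\otimes f)\lambda_2=\lambda_1$. A *universal object* is an object to which every object has exactly one morphism. **The quantum groups.** $\mathrm{C}(S_n^+)$ is the universal unital C*-algebra generated by projections $u_{ij}$ ($1\le i,j\le n$) with $\sum_k u_{ik}=1=\sum_k u_{kj}$ for all $i,j$, and $\Delta(u_{ij})=\sum_k u_{ik}\otimes u_{kj}$. The algebra $\mathrm{C}(S_n^+\wr_* S_m^+)$ of the free wreath product is the quotient of the unital free product $\mathrm{C}(S_n^+)^{*m}*\mathrm{C}(S_m^+)$ by the relations $\nu_k(a)v_{kl}=v_{kl}\nu_k(a)$, where $\nu_k:\mathrm{C}(S_n^+)\to\mathrm{C}(S_n^+)^{*m}$ is the $k$-th copy and $v_{kl}$ are the generators of $\mathrm{C}(S_m^+)$; its comultiplication is $$\Delta(v_{kl})=\sum_p v_{kp}\otimes v_{pl},\qquad \Delta(\nu_l(a))=\sum_k(\nu_l\otimes\nu_k)(\Delta(a))\,(v_{lk}\otimes1).$$ **Theorem.** Let $n,m\ge1$, let $\mathcal{G}$ be the graph with one vertex and $n$ loops, and let $\mathcal{G}^{\oplus m}$ be the disjoint union of $m$ copies of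 $\mathcal{G}$. For $1\le k\le m$ and $1\le i\le n$, let $\delta_k\in \mathrm{C}((\mathcal{G}^{\oplus m})^0)$ and $\xi_i^{(k)}\in \mathrm{C}((\mathcal{G}^{\oplus m})^1)$ be the indicator functions of the vertex of the $k$-th copy and of its $i$-th loop. Then $S_n^+\wr_*S_m^+$, together with the linear maps given by $$\alpha_{\mathrm{Bic}}(\delta_k)=\sum_{l}\delta_l\otimes v_{lk},\qquad \lambda_{\mathrm{Bic}}(\xi_i^{(k)})=\sum_{j,l}\xi_j^{(l)}\otimes\nu_l(u_{ji})v_{lk},$$ is a universal object of $\mathcal{C}_{\mathrm{Bic}}^{\mathrm{mult}}(\mathcal{G}^{\oplus m})$. Moreover, for every universal object $(G_{\mathrm{univ}},\alpha_{\mathrm{univ}},\lambda_{\mathrm{univ}})$ of this category, $G_{\mathrm{univ}}$ is isomorphic, as a compact quantum group, to $S_n^+\wr_*S_m^+$. -/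

import Mathlib

open scoped TensorProduct

universe u

set_option linter.unusedSectionVars false

noncomputable section

/-- A C*-seminorm on a unital `*`-algebra over `ℂ`. -/
structure CStarSeminorm (R : Type u) [Ring R] [StarRing R] [Algebra ℂ R] where
  toFun : R → ℝ
  nonneg : ∀ x, 0 ≤ toFun x
  add_le : ∀ x y, toFun (x + y) ≤ toFun x + toFun y
  smul : ∀ (c : ℂ) x, toFun (c • x) = ‖c‖ * toFun x
  mul_le : ∀ x y, toFun (x * y) ≤ toFun x * toFun y
  star_mul_self : ∀ x, toFun (star x * x) = toFun x ^ 2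

namespace CStarSeminorm

section Basic

variable {R : Type u} [Ring R] [StarRing R] [Algebra ℂ R]

/-- The pointwise supremum of a pointwise bounded set of C*-seminorms. -/
def sup (S : Set (CStarSeminorm R)) (hS : ∀ x, ∃ C, ∀ p ∈ S, p.toFun x ≤ C) :
    CStarSeminorm R where
  toFun x := ⨆ p : S, p.1.toFun x
  nonneg x := Real.iSup_nonneg fun p => p.1.nonneg x
  add_le x y := by
    have hb : ∀ x, BddAbove (Set.range fun p : S => p.1.toFun x) := fun x => by
      obtain ⟨C, hC⟩ := hS x
      exact ⟨C, by rintro _ ⟨p, rfl⟩; exact hC _ p.2⟩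
    exact Real.iSup_le (fun p => (p.1.add_le x y).trans
      (add_le_add (le_ciSup (hb x) p) (le_ciSup (hb y) p)))
      (add_nonneg (Real.iSup_nonneg fun p => p.1.nonneg x)
        (Real.iSup_nonneg fun p => p.1.nonneg y))
  smul c x := by
    simp only [CStarSeminorm.smul]
    exact (Real.mul_iSup_of_nonneg (norm_nonneg c) _).symm
  mul_le x y := by
    have hb : ∀ x, BddAbove (Set.range fun p : S => p.1.toFun x) := fun x => by
      obtain ⟨C, hC⟩ := hS x
      exact ⟨C, by rintro _ ⟨p, rfl⟩; exact hC _ p.2⟩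
    exact Real.iSup_le (fun p => (p.1.mul_le x y).trans
      (mul_le_mul (le_ciSup (hb x) p) (le_ciSup (hb y) p) (p.1.nonneg y)
        (Real.iSup_nonneg fun p => p.1.nonneg x)))
      (mul_nonneg (Real.iSup_nonneg fun p => p.1.nonneg x)
        (Real.iSup_nonneg fun p => p.1.nonneg y))
  star_mul_self x := by
    have hb : ∀ x, BddAbove (Set.range fun p : S => p.1.toFun x) := fun x => by
      obtain ⟨C, hC⟩ := hS x
      exact ⟨C, by rintro _ ⟨p, rfl⟩; exact hC _ p.2⟩
    have h0 : ∀ x, 0 ≤ ⨆ p : S, p.1.toFun x := fun x => Real.iSup_nonneg fun p => p.1.nonneg x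
    apply le_antisymm
    · refine Real.iSup_le (fun p => ?_) (sq_nonneg _)
      rw [p.1.star_mul_self]
      exact pow_le_pow_left₀ (p.1.nonneg x) (le_ciSup (hb x) p) 2
    · have : (⨆ p : S, p.1.toFun x) ≤ √(⨆ p : S, p.1.toFun (star x * x)) := by
        refine Real.iSup_le (fun p => ?_) (Real.sqrt_nonneg _)
        apply Real.le_sqrt_of_sq_le
        rw [← p.1.star_mul_self]
        exact le_ciSup (hb _) p
      calc (⨆ p : S, p.1.toFun x) ^ 2
          ≤ √(⨆ p : S, p.1.toFun (star x * x)) ^ 2 := pow_le_pow_left₀ (h0 x) this 2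
        _ = _ := Real.sq_sqrt (h0 _)

theorem le_sup {S : Set (CStarSeminorm R)} (hS : ∀ x, ∃ C, ∀ p ∈ S, p.toFun x ≤ C)
    {p : CStarSeminorm R} (hp : p ∈ S) (x : R) : p.toFun x ≤ (sup S hS).toFun x := by
  obtain ⟨C, hC⟩ := hS x
  exact le_ciSup (f := fun p : S => p.1.toFun x)
    ⟨C, by rintro _ ⟨p, rfl⟩; exact hC _ p.2⟩ ⟨p, hp⟩

theorem sup_le {S : Set (CStarSeminorm R)} (hS : ∀ x, ∃ C, ∀ p ∈ S, p.toFun x ≤ C)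
    (x : R) {C : ℝ} (hC : 0 ≤ C) (h : ∀ p ∈ S, p.toFun x ≤ C) : (sup S hS).toFun x ≤ C :=
  Real.iSup_le (fun p => h p.1 p.2) hC

/-- The C*-seminorm `x ↦ ‖f x‖` of a `*`-homomorphism into a C*-algebra. -/
def ofStarHom {B : Type u} [CStarAlgebra B] (f : R →⋆ₐ[ℂ] B) : CStarSeminorm R where
  toFun x := ‖f x‖
  nonneg _ := norm_nonneg _
  add_le x y := by rw [map_add]; exact norm_add_le _ _
  smul c x := by rw [map_smul, norm_smul]
  mul_le x y := by rw [map_mul]; exact norm_mul_le _ _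
  star_mul_self x := by rw [map_mul, map_star, CStarRing.norm_star_mul_self, sq]

/-- The C*-seminorm `x ↦ ‖T x‖` of a representation `T` by bounded operators on a (not necessarily
complete) inner product space, where `T (star x)` is a formal adjoint of `T x`. -/
def ofRep {E : Type u} [NormedAddCommGroup E] [InnerProductSpace ℂ E] (T : R →ₐ[ℂ] (E →L[ℂ] E))
    (hT : ∀ x v w, inner ℂ (T (star x) v) w = inner ℂ v (T x w)) : CStarSeminorm R where
  toFun x := ‖T x‖
  nonneg _ := norm_nonneg _
  add_le x y := by rw [map_add]; exact norm_add_le _ _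
  smul c x := by rw [map_smul, norm_smul]
  mul_le x y := by rw [map_mul]; exact norm_mul_le _ _
  star_mul_self x := by
    have key : ∀ y, ‖T y‖ ^ 2 ≤ ‖T (star y * y)‖ := fun y => by
      have : ‖T y‖ ≤ √‖T (star y * y)‖ := by
        refine ContinuousLinearMap.opNorm_le_bound _ (Real.sqrt_nonneg _) fun v => ?_
        have h1 : ‖T y v‖ ^ 2 ≤ ‖T (star y * y)‖ * ‖v‖ ^ 2 := by
          have h2 : inner ℂ (T (star y * y) v) v = inner ℂ (T y v) (T y v) := by
            rw [map_mul]
            exact hT y (T y v) v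
          have h3 : ‖T y v‖ ^ 2 = ‖inner ℂ (T (star y * y) v) v‖ := by
            rw [h2, inner_self_eq_norm_sq_to_K]
            simp
          rw [h3]
          calc _ ≤ ‖T (star y * y) v‖ * ‖v‖ := norm_inner_le_norm _ _
            _ ≤ (‖T (star y * y)‖ * ‖v‖) * ‖v‖ := by
              gcongr; exact ContinuousLinearMap.le_opNorm _ _
            _ = _ := by ring
        rw [← Real.sqrt_sq (norm_nonneg v), ← Real.sqrt_mul (norm_nonneg _)]
        exact Real.le_sqrt_of_sq_le h1
      calc ‖T y‖ ^ 2 ≤ √‖T (star y * y)‖ ^ 2 := pow_le_pow_left₀ (norm_nonneg _) this 2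
        _ = _ := Real.sq_sqrt (norm_nonneg _)
    have hle : ∀ y, ‖T y‖ ≤ ‖T (star y)‖ := fun y => by
      have h1 := key y
      rw [map_mul] at h1
      have h2 := norm_mul_le (T (star y)) (T y)
      by_contra hlt
      push Not at hlt
      have := norm_nonneg (T (star y))
      nlinarith
    apply le_antisymm _ (key x)
    rw [map_mul]
    have h1 := norm_mul_le (T (star x)) (T x)
    have h2 := hle (star x)
    rw [star_star] at h2
    nlinarith [norm_nonneg (T x)]

theorem star_le (p : CStarSeminorm R) (x : R) : p.toFun (star x) ≤ p.toFun x := by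
  have h1 := p.star_mul_self (star x)
  rw [star_star] at h1
  have h2 := p.mul_le x (star x)
  by_contra hlt
  push Not at hlt
  have := p.nonneg x
  nlinarith

theorem map_zero (p : CStarSeminorm R) : p.toFun 0 = 0 := by
  simpa using p.smul 0 0

theorem map_neg (p : CStarSeminorm R) (x : R) : p.toFun (-x) = p.toFun x := by
  simpa using p.smul (-1) x

end Basic

/-- The `*`-algebra `R`, equipped with the C*-seminorm `p`. -/
def Carrier {R : Type u} [Ring R] [StarRing R] [Algebra ℂ R] (_ : CStarSeminorm R) : Type u := R

section Completion

variable {R : Type u} [Ring R] [StarRing R] [Algebra ℂ R] (p : CStarSeminorm R)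

instance : Ring p.Carrier := inferInstanceAs (Ring R)
instance : StarRing p.Carrier := inferInstanceAs (StarRing R)
instance : Algebra ℂ p.Carrier := inferInstanceAs (Algebra ℂ R)
instance [StarModule ℂ R] : StarModule ℂ p.Carrier := inferInstanceAs (StarModule ℂ R)

instance : SeminormedRing p.Carrier where
  toRing := inferInstance
  __ := SeminormedAddGroup.toPseudoMetricSpace (E := p.Carrier) (self :=
    AddGroupSeminorm.toSeminormedAddGroup
      { toFun := p.toFun
        map_zero' := p.map_zero
        add_le' := p.add_le
        neg' := p.map_neg })
  norm := p.toFun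
  dist_eq _ _ := rfl
  norm_mul_le := p.mul_le

instance : NormedAlgebra ℂ p.Carrier where
  norm_smul_le c x := (p.smul c x).le

/-- The identity map from `R` to `p.Carrier`. -/
def toCarrier : R →⋆ₐ[ℂ] p.Carrier := StarAlgHom.id ℂ R

/-- The identity map from `p.Carrier` to `R`. -/
def ofCarrier : p.Carrier →⋆ₐ[ℂ] R := StarAlgHom.id ℂ R

theorem norm_toCarrier (x : R) : ‖p.toCarrier x‖ = p.toFun x := rfl

theorem norm_eq (x : p.Carrier) : ‖x‖ = p.toFun (p.ofCarrier x) := rfl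

theorem uniformContinuous_star : UniformContinuous (star : p.Carrier → p.Carrier) := by
  refine LipschitzWith.uniformContinuous (K := 1) (LipschitzWith.of_dist_le_mul fun x y => ?_)
  rw [dist_eq_norm, dist_eq_norm, ← star_sub, NNReal.coe_one, one_mul]
  exact p.star_le (x - y)

/-- The C*-algebra obtained from `R` by separation and completion with respect to `p`. -/
def Completion : Type u := UniformSpace.Completion p.Carrier

instance : NormedRing p.Completion :=
  inferInstanceAs (NormedRing (UniformSpace.Completion p.Carrier))
instance : CompleteSpace p.Completion :=
  inferInstanceAs (CompleteSpace (UniformSpace.Completion p.Carrier))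
instance : Algebra ℂ p.Completion :=
  inferInstanceAs (Algebra ℂ (UniformSpace.Completion p.Carrier))

instance : NormedAlgebra ℂ p.Completion where
  norm_smul_le := norm_smul_le (α := ℂ) (β := UniformSpace.Completion p.Carrier)

/-- The canonical map from `R` to its completion. -/
def toCompletion (x : R) : p.Completion :=
  UniformSpace.Completion.coe' (p.toCarrier x)

theorem norm_toCompletion (x : R) : ‖p.toCompletion x‖ = p.toFun x :=
  UniformSpace.Completion.norm_coe (p.toCarrier x)

theorem induction {P : p.Completion → Prop} (x : p.Completion) (hc : IsClosed {x | P x})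
    (h : ∀ r : R, P (p.toCompletion r)) : P x :=
  UniformSpace.Completion.induction_on (α := p.Carrier) x hc h

theorem denseRange_toCompletion : DenseRange p.toCompletion :=
  UniformSpace.Completion.denseRange_coe (α := p.Carrier)

instance : Star p.Completion where
  star := UniformSpace.Completion.map (α := p.Carrier) (β := p.Carrier) star

instance : ContinuousStar p.Completion where
  continuous_star := UniformSpace.Completion.continuous_map (α := p.Carrier) (β := p.Carrier)

theorem toCompletion_star (x : R) : p.toCompletion (star x) = star (p.toCompletion x) :=
  (UniformSpace.Completion.map_coe p.uniformContinuous_star (p.toCarrier x)).symm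

theorem toCompletion_mul (x y : R) :
    p.toCompletion (x * y) = p.toCompletion x * p.toCompletion y :=
  UniformSpace.Completion.coe_mul (p.toCarrier x) (p.toCarrier y)

theorem toCompletion_add (x y : R) :
    p.toCompletion (x + y) = p.toCompletion x + p.toCompletion y :=
  UniformSpace.Completion.coe_add (p.toCarrier x) (p.toCarrier y)

theorem toCompletion_smul (c : ℂ) (x : R) :
    p.toCompletion (c • x) = c • p.toCompletion x :=
  UniformSpace.Completion.coe_smul c (p.toCarrier x)

theorem toCompletion_one : p.toCompletion 1 = 1 := rfl

theorem toCompletion_zero : p.toCompletion 0 = 0 := rfl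

instance : StarRing p.Completion where
  star_involutive x := by
    induction x using p.induction
    case hc => exact isClosed_eq (by fun_prop) (by fun_prop)
    case' h r => skip
    rw [← p.toCompletion_star, ← p.toCompletion_star, star_star]
  star_mul x y := by
    induction x using p.induction
    case hc => exact isClosed_eq (by fun_prop) (by fun_prop)
    case' h r => skip
    induction y using p.induction
    case hc => exact isClosed_eq (by fun_prop) (by fun_prop)
    case' h s => skip
    rw [← p.toCompletion_star, ← p.toCompletion_star, ← p.toCompletion_mul, ← p.toCompletion_mul,
      ← p.toCompletion_star, star_mul]
  star_add x y := by
    induction x using p.induction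
    case hc => exact isClosed_eq (by fun_prop) (by fun_prop)
    case' h r => skip
    induction y using p.induction
    case hc => exact isClosed_eq (by fun_prop) (by fun_prop)
    case' h s => skip
    rw [← p.toCompletion_star, ← p.toCompletion_star, ← p.toCompletion_add, ← p.toCompletion_add,
      ← p.toCompletion_star, star_add]

variable [StarModule ℂ R]

instance : StarModule ℂ p.Completion where
  star_smul c x := by
    induction x using p.induction
    case hc =>
      exact isClosed_eq (continuous_star.comp (continuous_const_smul c))
        ((continuous_const_smul (star c)).comp continuous_star)
    case' h r => skip
    rw [← p.toCompletion_smul, ← p.toCompletion_star, ← p.toCompletion_star,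
      ← p.toCompletion_smul, star_smul]

instance : CStarRing p.Completion where
  norm_mul_self_le x := by
    induction x using p.induction
    case hc => exact isClosed_le (by fun_prop) (by fun_prop)
    case' h r => skip
    rw [← p.toCompletion_star, ← p.toCompletion_mul, norm_toCompletion, norm_toCompletion,
      p.star_mul_self, sq]

instance : CStarAlgebra p.Completion where

/-- The canonical `*`-homomorphism from `R` to its completion. -/
def of : R →⋆ₐ[ℂ] p.Completion where
  toFun := p.toCompletion
  map_one' := p.toCompletion_one
  map_mul' := p.toCompletion_mul
  map_zero' := p.toCompletion_zero
  map_add' := p.toCompletion_add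
  commutes' c := by
    rw [Algebra.algebraMap_eq_smul_one, Algebra.algebraMap_eq_smul_one, p.toCompletion_smul,
      p.toCompletion_one]
  map_star' := p.toCompletion_star

theorem norm_of (x : R) : ‖p.of x‖ = p.toFun x := p.norm_toCompletion x

theorem denseRange_of : DenseRange p.of := p.denseRange_toCompletion

theorem of_induction {P : p.Completion → Prop} (x : p.Completion) (hc : IsClosed {x | P x})
    (h : ∀ r : R, P (p.of r)) : P x := p.induction x hc h

section Lift

variable {p} {B : Type u} [CStarAlgebra B] (f : R →⋆ₐ[ℂ] B)

/-- The continuous extension of `f` to the completion. -/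
def liftFun : p.Completion → B :=
  UniformSpace.Completion.extension (f.comp p.ofCarrier)

theorem continuous_liftFun : Continuous (liftFun (p := p) f) :=
  UniformSpace.Completion.continuous_extension

theorem liftFun_of (hf : ∀ x, ‖f x‖ ≤ p.toFun x) (x : R) : liftFun f (p.of x) = f x := by
  refine UniformSpace.Completion.extension_coe (f := f.comp p.ofCarrier) ?_ (p.toCarrier x)
  refine LipschitzWith.uniformContinuous (K := 1) (LipschitzWith.of_dist_le_mul fun x y => ?_)
  rw [dist_eq_norm, dist_eq_norm, ← _root_.map_sub, NNReal.coe_one, one_mul]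
  exact hf (p.ofCarrier (x - y))

/-- Extension of a `p`-contractive `*`-homomorphism to the completion. -/
def lift (hf : ∀ x, ‖f x‖ ≤ p.toFun x) : p.Completion →⋆ₐ[ℂ] B where
  toFun := liftFun f
  map_one' := by rw [← _root_.map_one p.of, liftFun_of f hf, _root_.map_one]
  map_zero' := by rw [← _root_.map_zero p.of, liftFun_of f hf, _root_.map_zero]
  map_mul' x y := by
    have := continuous_liftFun (p := p) f
    induction x using p.of_induction
    case hc => exact isClosed_eq (by fun_prop) (by fun_prop)
    case' h r => skip
    induction y using p.of_induction
    case hc => exact isClosed_eq (by fun_prop) (by fun_prop)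
    case' h s => skip
    rw [← _root_.map_mul, liftFun_of f hf, liftFun_of f hf, liftFun_of f hf, _root_.map_mul]
  map_add' x y := by
    have := continuous_liftFun (p := p) f
    induction x using p.of_induction
    case hc => exact isClosed_eq (by fun_prop) (by fun_prop)
    case' h r => skip
    induction y using p.of_induction
    case hc => exact isClosed_eq (by fun_prop) (by fun_prop)
    case' h s => skip
    rw [← _root_.map_add, liftFun_of f hf, liftFun_of f hf, liftFun_of f hf, _root_.map_add]
  commutes' c := by
    rw [← AlgHomClass.commutes p.of, liftFun_of f hf, AlgHomClass.commutes]
  map_star' x := by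
    have := continuous_liftFun (p := p) f
    induction x using p.of_induction
    case hc => exact isClosed_eq (by fun_prop) (by fun_prop)
    case' h r => skip
    rw [← StarHomClass.map_star, liftFun_of f hf, liftFun_of f hf, StarHomClass.map_star]

theorem lift_of (hf : ∀ x, ‖f x‖ ≤ p.toFun x) (x : R) : lift f hf (p.of x) = f x := liftFun_of f hf x

end Lift

end Completion

end CStarSeminorm


/-! ### The minimal (spatial) tensor product of unital C*-algebras -/

namespace MinTensor

section Seminorm

variable {A B : Type u} [CStarAlgebra A] [CStarAlgebra B]

section Rep

variable {H K : Type u} [NormedAddCommGroup H] [InnerProductSpace ℂ H] [CompleteSpace H]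
  [NormedAddCommGroup K] [InnerProductSpace ℂ K] [CompleteSpace K]

/-- The representation `a ↦ π a ⊗ 1` on `H ⊗ K`. -/
def repLeft (π : A →⋆ₐ[ℂ] (H →L[ℂ] H)) : A →ₐ[ℂ] (H ⊗[ℂ] K →L[ℂ] H ⊗[ℂ] K) :=
  AlgHom.ofLinearMap
    { toFun := fun a => TensorProduct.mapL (π a) (1 : K →L[ℂ] K)
      map_add' := fun a b => by rw [map_add, TensorProduct.mapL_add_left]
      map_smul' := fun c a => by rw [map_smul, TensorProduct.mapL_smul_left]; rfl }
    (by
      change TensorProduct.mapL _ _ = _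
      rw [map_one]
      exact TensorProduct.mapL_id_id)
    (fun a b => by
      have := TensorProduct.mapL_mul (π a) (π b) (1 : K →L[ℂ] K) 1
      simpa using this)

/-- The representation `b ↦ 1 ⊗ σ b` on `H ⊗ K`. -/
def repRight (σ : B →⋆ₐ[ℂ] (K →L[ℂ] K)) : B →ₐ[ℂ] (H ⊗[ℂ] K →L[ℂ] H ⊗[ℂ] K) :=
  AlgHom.ofLinearMap
    { toFun := fun b => TensorProduct.mapL (1 : H →L[ℂ] H) (σ b)
      map_add' := fun a b => by rw [map_add, TensorProduct.mapL_add_right]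
      map_smul' := fun c a => by rw [map_smul, TensorProduct.mapL_smul_right]; rfl }
    (by
      change TensorProduct.mapL _ _ = _
      rw [map_one]
      exact TensorProduct.mapL_id_id)
    (fun a b => by
      have := TensorProduct.mapL_mul (1 : H →L[ℂ] H) 1 (σ a) (σ b)
      simpa using this)

theorem repLeft_mul_repRight (π : A →⋆ₐ[ℂ] (H →L[ℂ] H)) (σ : B →⋆ₐ[ℂ] (K →L[ℂ] K))
    (a : A) (b : B) : repLeft π a * repRight σ b = TensorProduct.mapL (π a) (σ b) := by
  have := TensorProduct.mapL_mul (π a) (1 : H →L[ℂ] H) (1 : K →L[ℂ] K) (σ b)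
  rw [mul_one, one_mul] at this
  exact this.symm

theorem repRight_mul_repLeft (π : A →⋆ₐ[ℂ] (H →L[ℂ] H)) (σ : B →⋆ₐ[ℂ] (K →L[ℂ] K))
    (a : A) (b : B) : repRight σ b * repLeft π a = TensorProduct.mapL (π a) (σ b) := by
  have := TensorProduct.mapL_mul (1 : H →L[ℂ] H) (π a) (σ b) (1 : K →L[ℂ] K)
  rw [mul_one, one_mul] at this
  exact this.symm

/-- For representations `π` of `A` on `H` and `σ` of `B` on `K`, the representation `π ⊗ σ` of the
algebraic tensor product `A ⊗ B` on `H ⊗ K` with `(π ⊗ σ)(a ⊗ b) = π a ⊗ σ b`. The bounded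
operators `(π ⊗ σ)(x)` have the same norm on the inner product space `H ⊗ K` as on its Hilbert
space completion. -/
def rep (π : A →⋆ₐ[ℂ] (H →L[ℂ] H)) (σ : B →⋆ₐ[ℂ] (K →L[ℂ] K)) :
    A ⊗[ℂ] B →ₐ[ℂ] (H ⊗[ℂ] K →L[ℂ] H ⊗[ℂ] K) :=
  Algebra.TensorProduct.lift (repLeft π) (repRight σ) fun a b => by
    rw [commute_iff_eq, repLeft_mul_repRight, repRight_mul_repLeft]

theorem rep_tmul (π : A →⋆ₐ[ℂ] (H →L[ℂ] H)) (σ : B →⋆ₐ[ℂ] (K →L[ℂ] K)) (a : A) (b : B) :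
    rep π σ (a ⊗ₜ b) = TensorProduct.mapL (π a) (σ b) := by
  rw [rep, Algebra.TensorProduct.lift_tmul, repLeft_mul_repRight]

theorem inner_rep_star (π : A →⋆ₐ[ℂ] (H →L[ℂ] H)) (σ : B →⋆ₐ[ℂ] (K →L[ℂ] K)) (x : A ⊗[ℂ] B)
    (v w : H ⊗[ℂ] K) : inner ℂ (rep π σ (star x) v) w = inner ℂ v (rep π σ x w) := by
  induction x with
  | zero => simp
  | add x y hx hy => simp [star_add, inner_add_left, inner_add_right, hx, hy]
  | tmul a b =>
    rw [TensorProduct.star_tmul, rep_tmul, rep_tmul]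
    induction v with
    | zero => simp
    | add x y hx hy => rw [map_add, inner_add_left, inner_add_left, hx, hy]
    | tmul h k =>
      induction w with
      | zero => simp
      | add x y hx hy => rw [map_add, inner_add_right, inner_add_right, hx, hy]
      | tmul h' k' =>
        rw [TensorProduct.mapL_tmul, TensorProduct.mapL_tmul, TensorProduct.inner_tmul,
          TensorProduct.inner_tmul, map_star, map_star, ContinuousLinearMap.star_eq_adjoint,
          ContinuousLinearMap.star_eq_adjoint, ContinuousLinearMap.adjoint_inner_left,
          ContinuousLinearMap.adjoint_inner_left]

theorem norm_rep_tmul_le (π : A →⋆ₐ[ℂ] (H →L[ℂ] H)) (σ : B →⋆ₐ[ℂ] (K →L[ℂ] K)) (a : A) (b : B) :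
    ‖rep π σ (a ⊗ₜ b)‖ ≤ ‖a‖ * ‖b‖ := by
  rw [rep_tmul]
  refine (TensorProduct.norm_mapL_le _ _).trans ?_
  exact mul_le_mul (NonUnitalStarAlgHom.norm_apply_le π a) (NonUnitalStarAlgHom.norm_apply_le σ b)
    (norm_nonneg _) (norm_nonneg _)

end Rep

variable (A B) in
/-- The C*-seminorms `x ↦ ‖(π ⊗ σ)(x)‖` on `A ⊗ B` given by all pairs of representations. -/
def repSeminorms : Set (CStarSeminorm (A ⊗[ℂ] B)) :=
  {p | ∃ (H K : Type u) (_ : NormedAddCommGroup H) (_ : InnerProductSpace ℂ H)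
      (_ : CompleteSpace H) (_ : NormedAddCommGroup K) (_ : InnerProductSpace ℂ K)
      (_ : CompleteSpace K) (π : A →⋆ₐ[ℂ] (H →L[ℂ] H)) (σ : B →⋆ₐ[ℂ] (K →L[ℂ] K)),
      p = CStarSeminorm.ofRep (rep π σ) (inner_rep_star π σ)}

theorem repSeminorms_bounded (x : A ⊗[ℂ] B) : ∃ C, ∀ p ∈ repSeminorms A B, p.toFun x ≤ C := by
  induction x with
  | zero => exact ⟨0, fun p _ => p.map_zero.le⟩
  | add x y hx hy =>
    obtain ⟨C, hC⟩ := hx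
    obtain ⟨D, hD⟩ := hy
    exact ⟨C + D, fun p hp => (p.add_le x y).trans (add_le_add (hC p hp) (hD p hp))⟩
  | tmul a b =>
    refine ⟨‖a‖ * ‖b‖, ?_⟩
    rintro p ⟨H, K, _, _, _, _, _, _, π, σ, rfl⟩
    exact norm_rep_tmul_le π σ a b

variable (A B) in
/-- The minimal C*-norm `‖x‖ = sup ‖(π ⊗ σ)(x)‖` on `A ⊗ B`, the supremum being over all
representations `π` of `A` and `σ` of `B` on Hilbert spaces. -/
def seminorm : CStarSeminorm (A ⊗[ℂ] B) :=
  CStarSeminorm.sup (repSeminorms A B) repSeminorms_bounded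

end Seminorm

end MinTensor

/-- The minimal (spatial) tensor product of two unital C*-algebras. -/
def MinTensor (A B : Type u) [CStarAlgebra A] [CStarAlgebra B] : Type u :=
  (MinTensor.seminorm A B).Completion

namespace MinTensor

variable {A B A' B' C : Type u} [CStarAlgebra A] [CStarAlgebra B] [CStarAlgebra A']
  [CStarAlgebra B'] [CStarAlgebra C]

instance : CStarAlgebra (MinTensor A B) :=
  inferInstanceAs (CStarAlgebra (MinTensor.seminorm A B).Completion)

variable (A B) in
/-- The canonical map of the algebraic tensor product into the minimal tensor product. -/
def ofTensor : A ⊗[ℂ] B →⋆ₐ[ℂ] MinTensor A B := (MinTensor.seminorm A B).of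

/-- The elementary tensor `a ⊗ b` in the minimal tensor product. -/
def tmul (a : A) (b : B) : MinTensor A B := ofTensor A B (a ⊗ₜ b)

theorem tmul_mul_tmul (a a' : A) (b b' : B) :
    tmul a b * tmul a' b' = tmul (a * a') (b * b') := by
  rw [tmul, tmul, tmul, ← map_mul, Algebra.TensorProduct.tmul_mul_tmul]

theorem star_tmul (a : A) (b : B) : star (tmul a b) = tmul (star a) (star b) := by
  rw [tmul, tmul, ← map_star, TensorProduct.star_tmul]

theorem one_tmul_one : tmul (1 : A) (1 : B) = 1 := by
  rw [tmul, ← Algebra.TensorProduct.one_def, map_one]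

theorem sum_tmul {ι : Type*} (s : Finset ι) (a : ι → A) (b : B) :
    tmul (∑ i ∈ s, a i) b = ∑ i ∈ s, tmul (a i) b := by
  simp only [tmul, TensorProduct.sum_tmul, map_sum]

theorem tmul_sum {ι : Type*} (s : Finset ι) (a : A) (b : ι → B) :
    tmul a (∑ i ∈ s, b i) = ∑ i ∈ s, tmul a (b i) := by
  simp only [tmul, TensorProduct.tmul_sum, map_sum]

theorem tmul_zero (a : A) : tmul a (0 : B) = 0 := by
  rw [tmul, TensorProduct.tmul_zero, map_zero]

theorem zero_tmul (b : B) : tmul (0 : A) b = 0 := by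
  rw [tmul, TensorProduct.zero_tmul, map_zero]

theorem induction {P : MinTensor A B → Prop} (x : MinTensor A B) (hc : IsClosed {x | P x})
    (add : ∀ x y, P x → P y → P (x + y)) (h : ∀ a b, P (tmul a b)) : P x := by
  refine (MinTensor.seminorm A B).of_induction x hc fun r => ?_
  change P (ofTensor A B r)
  induction r with
  | zero =>
    have := h 0 0
    rwa [tmul_zero, ← map_zero (ofTensor A B)] at this
  | add x y hx hy => rw [map_add]; exact add _ _ hx hy
  | tmul a b => exact h a b

/-- The tensor product `f ⊗ g` of `*`-homomorphisms, on the algebraic tensor product. -/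
def mapAlg (f : A →⋆ₐ[ℂ] A') (g : B →⋆ₐ[ℂ] B') : A ⊗[ℂ] B →⋆ₐ[ℂ] A' ⊗[ℂ] B' where
  toAlgHom := Algebra.TensorProduct.map (f : A →ₐ[ℂ] A') (g : B →ₐ[ℂ] B')
  map_star' x := by
    induction x with
    | zero => simp
    | add x y hx hy => simp_all [star_add]
    | tmul a b => simp [TensorProduct.star_tmul, map_star]

theorem seminorm_mapAlg_le (f : A →⋆ₐ[ℂ] A') (g : B →⋆ₐ[ℂ] B') (x : A ⊗[ℂ] B) :
    (seminorm A' B').toFun (mapAlg f g x) ≤ (seminorm A B).toFun x := by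
  refine CStarSeminorm.sup_le _ _ (CStarSeminorm.nonneg _ _) ?_
  rintro p ⟨H, K, _, _, _, _, _, _, π, σ, rfl⟩
  refine le_trans (le_of_eq ?_) (CStarSeminorm.le_sup (S := repSeminorms A B)
    repSeminorms_bounded ⟨H, K, _, _, _, _, _, _, π.comp f, σ.comp g, rfl⟩ x)
  have : rep π σ (mapAlg f g x) = rep (π.comp f) (σ.comp g) x := by
    induction x with
    | zero => simp
    | add x y hx hy => simp [map_add, hx, hy]
    | tmul a b =>
      rw [rep_tmul]
      exact rep_tmul π σ (f a) (g b)
  exact congrArg norm this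

/-- The tensor product `f ⊗ g : A ⊗ B → A' ⊗ B'` of unital `*`-homomorphisms, on minimal tensor
products. -/
def map (f : A →⋆ₐ[ℂ] A') (g : B →⋆ₐ[ℂ] B') : MinTensor A B →⋆ₐ[ℂ] MinTensor A' B' :=
  CStarSeminorm.lift (p := MinTensor.seminorm A B) ((ofTensor A' B').comp (mapAlg f g)) fun x =>
    ((MinTensor.seminorm A' B').norm_of _).trans_le (seminorm_mapAlg_le f g x)

theorem map_tmul (f : A →⋆ₐ[ℂ] A') (g : B →⋆ₐ[ℂ] B') (a : A) (b : B) :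
    map f g (tmul a b) = tmul (f a) (g b) :=
  CStarSeminorm.lift_of (p := MinTensor.seminorm A B) _ _ _

variable (A B C) in
/-- The canonical map of the algebraic tensor product into `(A ⊗ B) ⊗ C`. -/
def ofTensorLeft : (A ⊗[ℂ] B) ⊗[ℂ] C →ₗ[ℂ] MinTensor (MinTensor A B) C :=
  (ofTensor (MinTensor A B) C).toAlgHom.toLinearMap ∘ₗ
    TensorProduct.map (ofTensor A B).toAlgHom.toLinearMap LinearMap.id

variable (A B C) in
/-- The canonical map of the algebraic tensor product into `A ⊗ (B ⊗ C)`. -/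
def ofTensorRight : A ⊗[ℂ] (B ⊗[ℂ] C) →ₗ[ℂ] MinTensor A (MinTensor B C) :=
  (ofTensor A (MinTensor B C)).toAlgHom.toLinearMap ∘ₗ
    TensorProduct.map LinearMap.id (ofTensor B C).toAlgHom.toLinearMap

variable (A B C) in
/-- The graph of the canonical isomorphism `(A ⊗ B) ⊗ C ≃ A ⊗ (B ⊗ C)` of minimal tensor products,
the closure of the graph of `(a ⊗ b) ⊗ c ↦ a ⊗ (b ⊗ c)` on the algebraic tensor product. -/
def assocGraph : Set (MinTensor (MinTensor A B) C × MinTensor A (MinTensor B C)) :=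
  closure (Set.range fun x : (A ⊗[ℂ] B) ⊗[ℂ] C =>
    (ofTensorLeft A B C x, ofTensorRight A B C (TensorProduct.assoc ℂ A B C x)))

end MinTensor

/-- Two elements of `(A ⊗ B) ⊗ C` and `A ⊗ (B ⊗ C)` correspond under the canonical isomorphism. -/
def AssocEq {A B C : Type u} [CStarAlgebra A] [CStarAlgebra B] [CStarAlgebra C]
    (x : MinTensor (MinTensor A B) C) (y : MinTensor A (MinTensor B C)) : Prop :=
  (x, y) ∈ MinTensor.assocGraph A B C

/-! ### Universal C*-algebras given by generators and relations -/

/-- The free unital complex `*`-algebra on a set `Y` of generators that is closed under `star`. -/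
def FreeStarAlgebra (Y : Type u) : Type u := MonoidAlgebra ℂ (FreeMonoid Y)

namespace FreeStarAlgebra

variable {Y : Type u}

instance : Ring (FreeStarAlgebra Y) := inferInstanceAs (Ring (MonoidAlgebra ℂ (FreeMonoid Y)))
instance : Algebra ℂ (FreeStarAlgebra Y) :=
  inferInstanceAs (Algebra ℂ (MonoidAlgebra ℂ (FreeMonoid Y)))

/-- The word `w`, multiplied by the scalar `c`. -/
def single (w : FreeMonoid Y) (c : ℂ) : FreeStarAlgebra Y := MonoidAlgebra.single w c

theorem single_mul (v w : FreeMonoid Y) (c d : ℂ) :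
    single v c * single w d = single (v * w) (c * d) := MonoidAlgebra.single_mul_single ..

theorem smul_single (w : FreeMonoid Y) (c d : ℂ) : c • single w d = single w (c * d) :=
  MonoidAlgebra.smul_single ..

theorem one_eq : (1 : FreeStarAlgebra Y) = single 1 1 := rfl

theorem induction {P : FreeStarAlgebra Y → Prop} (x : FreeStarAlgebra Y) (zero : P 0)
    (add : ∀ x y, P x → P y → P (x + y)) (single : ∀ w c, P (single w c)) : P x :=
  MonoidAlgebra.induction_linear (R := ℂ) (M := FreeMonoid Y) x zero add single

/-- The generator `y`. -/
def gen (y : Y) : FreeStarAlgebra Y := single (FreeMonoid.of y) 1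

variable [InvolutiveStar Y]

/-- The adjoint `(y₁ ⋯ yₙ)* = yₙ* ⋯ y₁*` of a word. -/
def wordStar (w : FreeMonoid Y) : FreeMonoid Y := star (FreeMonoid.map star w)

theorem wordStar_mul (v w : FreeMonoid Y) : wordStar (v * w) = wordStar w * wordStar v := by
  rw [wordStar, map_mul, star_mul, wordStar, wordStar]

theorem wordStar_of (y : Y) : wordStar (FreeMonoid.of y) = FreeMonoid.of (star y) := by
  rw [wordStar, FreeMonoid.map_of, FreeMonoid.star_of]

theorem wordStar_one : wordStar (1 : FreeMonoid Y) = 1 := by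
  rw [wordStar, map_one, star_one]

theorem wordStar_wordStar (w : FreeMonoid Y) : wordStar (wordStar w) = w := by
  induction w using FreeMonoid.inductionOn with
  | one => rw [wordStar_one, wordStar_one]
  | of y => rw [wordStar_of, wordStar_of, star_star]
  | mul v w hv hw => rw [wordStar_mul, wordStar_mul, hv, hw]

instance : Star (FreeStarAlgebra Y) where
  star x := MonoidAlgebra.mapDomain wordStar
    (MonoidAlgebra.mapRingHom (FreeMonoid Y) (starRingEnd ℂ) x)

theorem star_single (w : FreeMonoid Y) (c : ℂ) :
    star (single w c) = single (wordStar w) (star c) := by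
  change MonoidAlgebra.mapDomain wordStar
    (MonoidAlgebra.mapRingHom (FreeMonoid Y) (starRingEnd ℂ) (MonoidAlgebra.single w c)) = _
  rw [MonoidAlgebra.mapRingHom_single, MonoidAlgebra.mapDomain_single]
  rfl

theorem star_add' (x y : FreeStarAlgebra Y) : star (x + y) = star x + star y := by
  change MonoidAlgebra.mapDomain wordStar
    (MonoidAlgebra.mapRingHom (FreeMonoid Y) (starRingEnd ℂ) (x + y)) = _
  erw [map_add, MonoidAlgebra.mapDomain_add]
  rfl

theorem star_zero' : star (0 : FreeStarAlgebra Y) = 0 := by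
  have := star_add' (0 : FreeStarAlgebra Y) 0
  simpa using this

instance : StarRing (FreeStarAlgebra Y) where
  star_involutive x := by
    induction x using FreeStarAlgebra.induction with
    | zero => rw [star_zero', star_zero']
    | add x y hx hy => rw [star_add', star_add', hx, hy]
    | single w c => rw [star_single, star_single, wordStar_wordStar, star_star]
  star_add := star_add'
  star_mul x y := by
    induction x using FreeStarAlgebra.induction with
    | zero => rw [zero_mul, star_zero', mul_zero]
    | add x x' hx hx' => rw [add_mul, star_add', star_add', hx, hx', mul_add]
    | single v c =>
      induction y using FreeStarAlgebra.induction with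
      | zero => rw [mul_zero, star_zero', zero_mul]
      | add x x' hx hx' => rw [mul_add, star_add', star_add', hx, hx', add_mul]
      | single w d =>
        rw [single_mul, star_single, star_single, star_single, single_mul, wordStar_mul,
          star_mul]

instance : StarModule ℂ (FreeStarAlgebra Y) where
  star_smul c x := by
    induction x using FreeStarAlgebra.induction with
    | zero => rw [smul_zero, star_zero', smul_zero]
    | add x y hx hy => rw [smul_add, star_add', star_add', hx, hy, smul_add]
    | single w d => rw [smul_single, star_single, star_single, smul_single, star_mul, mul_comm]

theorem star_gen (y : Y) : star (gen y) = gen (star y) := by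
  rw [gen, star_single, wordStar_of, star_one, gen]

section Eval

variable {B : Type u} [CStarAlgebra B] (g : Y → B)

/-- Evaluation of noncommutative `*`-polynomials at `g`. -/
def evalAlg : FreeStarAlgebra Y →ₐ[ℂ] B := MonoidAlgebra.lift ℂ B (FreeMonoid Y) (FreeMonoid.lift g)

theorem evalAlg_single (w : FreeMonoid Y) (c : ℂ) :
    evalAlg g (single w c) = c • FreeMonoid.lift g w := MonoidAlgebra.lift_single ..

theorem evalAlg_gen (y : Y) : evalAlg g (gen y) = g y := by
  rw [gen, evalAlg_single, one_smul, FreeMonoid.lift_eval_of]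

/-- Evaluation of noncommutative `*`-polynomials at a `star`-preserving `g`. -/
def eval (hg : ∀ y, g (star y) = star (g y)) : FreeStarAlgebra Y →⋆ₐ[ℂ] B where
  toAlgHom := evalAlg g
  map_star' x := by
    change evalAlg g (star x) = star (evalAlg g x)
    induction x using FreeStarAlgebra.induction with
    | zero => rw [star_zero, map_zero, star_zero]
    | add x y hx hy => rw [star_add, map_add, hx, hy, map_add, star_add]
    | single w c =>
      rw [star_single, evalAlg_single, evalAlg_single, star_smul]
      congr 1
      induction w using FreeMonoid.inductionOn with
      | one => rw [wordStar_one, map_one, star_one]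
      | of y => rw [wordStar_of, FreeMonoid.lift_eval_of, FreeMonoid.lift_eval_of, hg]
      | mul v w hv hw => rw [wordStar_mul, map_mul, hv, hw, map_mul, star_mul]

theorem eval_gen (hg : ∀ y, g (star y) = star (g y)) (y : Y) : eval g hg (gen y) = g y :=
  evalAlg_gen g y

theorem hom_eq_eval (hg : ∀ y, g (star y) = star (g y)) (f : FreeStarAlgebra Y →⋆ₐ[ℂ] B)
    (hf : ∀ y, f (gen y) = g y) (x : FreeStarAlgebra Y) : f x = eval g hg x := by
  induction x using FreeStarAlgebra.induction with
  | zero => rw [map_zero, map_zero]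
  | add x y hx hy => rw [map_add, map_add, hx, hy]
  | single w c =>
    have : single w c = c • single w 1 := by rw [smul_single, mul_one]
    rw [this, map_smul, map_smul]
    congr 1
    induction w using FreeMonoid.inductionOn with
    | one => rw [← one_eq, map_one, map_one]
    | of y => exact (hf y).trans (eval_gen g hg y).symm
    | mul v w hv hw =>
      have h2 : single (v * w) (1 : ℂ) = single v 1 * single w 1 := by rw [single_mul, mul_one]
      rw [h2, map_mul, map_mul, hv (by rw [smul_single, mul_one]),
        hw (by rw [smul_single, mul_one])]

end Eval

end FreeStarAlgebra

/-- Relations between generators `Y`, closed under `star`, in unital C*-algebras: `Holds B g` says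
that the elements `g y` of `B` satisfy the relations. The field `bounded` is the usual condition for
the existence of the universal C*-algebra. -/
structure CStarRelations (Y : Type u) [InvolutiveStar Y] where
  Holds : ∀ (B : Type u) [CStarAlgebra B], (Y → B) → Prop
  star_eq : ∀ (B : Type u) [CStarAlgebra B] (g : Y → B), Holds B g → ∀ y, g (star y) = star (g y)
  bounded : ∀ y, ∃ C : ℝ, ∀ (B : Type u) [CStarAlgebra B] (g : Y → B), Holds B g → ‖g y‖ ≤ C

namespace CStarRelations

variable {Y : Type u} [InvolutiveStar Y] (𝓡 : CStarRelations Y)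

/-- The C*-seminorms `x ↦ ‖x(g)‖` on the free `*`-algebra given by all families `g` in C*-algebras
satisfying the relations. -/
def seminorms : Set (CStarSeminorm (FreeStarAlgebra Y)) :=
  {p | ∃ (B : Type u) (_ : CStarAlgebra B) (g : Y → B) (hg : 𝓡.Holds B g),
    p = CStarSeminorm.ofStarHom (FreeStarAlgebra.eval g (𝓡.star_eq B g hg))}

theorem seminorms_bounded (x : FreeStarAlgebra Y) :
    ∃ C, ∀ p ∈ 𝓡.seminorms, p.toFun x ≤ C := by
  induction x using FreeStarAlgebra.induction with
  | zero => exact ⟨0, fun p _ => p.map_zero.le⟩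
  | add x y hx hy =>
    obtain ⟨C, hC⟩ := hx
    obtain ⟨D, hD⟩ := hy
    exact ⟨C + D, fun p hp => (p.add_le x y).trans (add_le_add (hC p hp) (hD p hp))⟩
  | single w c =>
    have hw : ∃ C, ∀ p ∈ 𝓡.seminorms, p.toFun (FreeStarAlgebra.single w 1) ≤ C := by
      induction w using FreeMonoid.inductionOn with
      | one =>
        refine ⟨1, fun p _ => ?_⟩
        have h := p.star_mul_self 1
        rw [star_one, mul_one] at h
        rw [← FreeStarAlgebra.one_eq]
        nlinarith [p.nonneg 1]
      | of y =>
        obtain ⟨C, hC⟩ := 𝓡.bounded y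
        refine ⟨C, ?_⟩
        rintro p ⟨B, _, g, hg, rfl⟩
        refine le_trans (le_of_eq ?_) (hC B g hg)
        exact congrArg norm (FreeStarAlgebra.eval_gen g _ y)
      | mul v w hv hw =>
        obtain ⟨C, hC⟩ := hv
        obtain ⟨D, hD⟩ := hw
        refine ⟨C * D, fun p hp => ?_⟩
        have h2 : FreeStarAlgebra.single (v * w) (1 : ℂ) =
            FreeStarAlgebra.single v 1 * FreeStarAlgebra.single w 1 := by
          rw [FreeStarAlgebra.single_mul, mul_one]
        rw [h2]
        exact (p.mul_le _ _).trans (mul_le_mul (hC p hp) (hD p hp) (p.nonneg _)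
          ((p.nonneg _).trans (hC p hp)))
    obtain ⟨C, hC⟩ := hw
    refine ⟨‖c‖ * C, fun p hp => ?_⟩
    have : FreeStarAlgebra.single w c = c • FreeStarAlgebra.single w 1 := by
      rw [FreeStarAlgebra.smul_single, mul_one]
    rw [this, p.smul]
    exact mul_le_mul_of_nonneg_left (hC p hp) (norm_nonneg c)

/-- The largest C*-seminorm on the free `*`-algebra compatible with the relations. -/
def seminorm : CStarSeminorm (FreeStarAlgebra Y) :=
  CStarSeminorm.sup 𝓡.seminorms 𝓡.seminorms_bounded

/-- The universal unital C*-algebra generated by `Y` subject to the relations `𝓡`. -/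
def Universal : Type u := 𝓡.seminorm.Completion

instance : CStarAlgebra 𝓡.Universal := inferInstanceAs (CStarAlgebra 𝓡.seminorm.Completion)

/-- The canonical map from the free `*`-algebra to the universal C*-algebra. -/
def of : FreeStarAlgebra Y →⋆ₐ[ℂ] 𝓡.Universal := 𝓡.seminorm.of

/-- The generators of the universal C*-algebra. -/
def gen (y : Y) : 𝓡.Universal := 𝓡.of (FreeStarAlgebra.gen y)

theorem star_gen (y : Y) : star (𝓡.gen y) = 𝓡.gen (star y) := by
  rw [gen, ← map_star, FreeStarAlgebra.star_gen, gen]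

/-- Identities that hold in all C*-algebras where the relations are satisfied hold in the universal
C*-algebra. -/
theorem of_eq {x y : FreeStarAlgebra Y}
    (h : ∀ (B : Type u) [CStarAlgebra B] (g : Y → B) (hg : 𝓡.Holds B g),
      FreeStarAlgebra.eval g (𝓡.star_eq B g hg) x = FreeStarAlgebra.eval g (𝓡.star_eq B g hg) y) :
    𝓡.of x = 𝓡.of y := by
  rw [← sub_eq_zero, ← map_sub, ← norm_le_zero_iff]
  refine (𝓡.seminorm.norm_of (x - y)).trans_le ?_
  refine CStarSeminorm.sup_le _ _ le_rfl ?_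
  rintro p ⟨B, _, g, hg, rfl⟩
  change ‖FreeStarAlgebra.eval g (𝓡.star_eq B g hg) (x - y)‖ ≤ 0
  rw [map_sub, h B g hg, sub_self, norm_zero]

section Lift

variable {B : Type u} [CStarAlgebra B]

/-- The universal property: elements `g y` of a C*-algebra satisfying the relations define a unital
`*`-homomorphism mapping the generator `y` to `g y`. -/
def lift (g : Y → B) (hg : 𝓡.Holds B g) : 𝓡.Universal →⋆ₐ[ℂ] B :=
  CStarSeminorm.lift (p := 𝓡.seminorm) (FreeStarAlgebra.eval g (𝓡.star_eq B g hg)) fun x =>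
    CStarSeminorm.le_sup (S := 𝓡.seminorms) 𝓡.seminorms_bounded ⟨B, _, g, hg, rfl⟩ x

theorem lift_gen (g : Y → B) (hg : 𝓡.Holds B g) (y : Y) : 𝓡.lift g hg (𝓡.gen y) = g y :=
  (CStarSeminorm.lift_of (p := 𝓡.seminorm) _ _ _).trans (FreeStarAlgebra.eval_gen g _ y)

end Lift

end CStarRelations

/-! ### Magic unitaries and the quantum permutation group -/

/-- A magic unitary: a square matrix of projections in a C*-algebra whose rows and columns sum up
to `1`. -/
structure IsMagicUnitary {B : Type u} [CStarAlgebra B] {K : Type u} [Fintype K]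
    (v : K → K → B) : Prop where
  star_eq : ∀ i j, star (v i j) = v i j
  mul_self : ∀ i j, v i j * v i j = v i j
  row_sum : ∀ i, ∑ j, v i j = 1
  col_sum : ∀ j, ∑ i, v i j = 1

theorem projection_norm_le {B : Type u} [CStarAlgebra B] {p : B} (h : star p = p)
    (h' : p * p = p) : ‖p‖ ≤ 1 := by
  have := CStarRing.norm_star_mul_self (x := p)
  rw [h, h'] at this
  nlinarith [norm_nonneg p]

/-- Projections with sum `1` in a C*-algebra are mutually orthogonal. -/
theorem projections_orthogonal {B : Type u} [CStarAlgebra B] {K : Type u} [Fintype K]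
    [DecidableEq K] {p : K → B} (hs : ∀ i, star (p i) = p i) (hm : ∀ i, p i * p i = p i)
    (h1 : ∑ i, p i = 1) (i j : K) : p i * p j = if i = j then p i else 0 := by
  split_ifs with hij
  · rw [← hij, hm]
  · let := CStarAlgebra.spectralOrder B
    let := CStarAlgebra.spectralOrderedRing B
    have h2 : ∑ k, star (p k * p j) * (p k * p j) = p j := by
      have : ∀ k, star (p k * p j) * (p k * p j) = p j * p k * p j := fun k => by
        rw [star_mul, hs, hs, mul_assoc, ← mul_assoc (p k), hm, mul_assoc]
      simp only [this]
      rw [← Finset.sum_mul, ← Finset.mul_sum, h1, mul_one, hm]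
    rw [← Finset.add_sum_erase _ _ (Finset.mem_univ j), hm, hs, hm] at h2
    have h3 := add_eq_left.mp h2
    rw [Finset.sum_eq_zero_iff_of_nonneg (fun k _ => star_mul_self_nonneg _)] at h3
    exact CStarRing.star_mul_self_eq_zero_iff _ |>.mp
      (h3 i (Finset.mem_erase.mpr ⟨hij, Finset.mem_univ i⟩))

namespace IsMagicUnitary

variable {B : Type u} [CStarAlgebra B] {K : Type u} [Fintype K] [DecidableEq K] {v : K → K → B}

theorem row_orthogonal (hv : IsMagicUnitary v) (i j k : K) :
    v i j * v i k = if j = k then v i j else 0 :=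
  projections_orthogonal (hv.star_eq i) (hv.mul_self i) (hv.row_sum i) j k

theorem comul (hv : IsMagicUnitary v) :
    IsMagicUnitary fun i j => ∑ k, MinTensor.tmul (v i k) (v k j) where
  star_eq i j := by
    simp only [star_sum, MinTensor.star_tmul, hv.star_eq]
  mul_self i j := by
    rw [Finset.sum_mul_sum]
    refine Finset.sum_congr rfl fun k _ => ?_
    simp only [MinTensor.tmul_mul_tmul, hv.row_orthogonal]
    rw [Finset.sum_eq_single k]
    · rw [if_pos rfl, hv.mul_self]
    · intro b _ hb
      rw [if_neg (Ne.symm hb), MinTensor.zero_tmul]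
    · simp
  row_sum i := by
    rw [Finset.sum_comm]
    simp only [← MinTensor.tmul_sum, hv.row_sum]
    rw [← MinTensor.sum_tmul, hv.row_sum, MinTensor.one_tmul_one]
  col_sum j := by
    rw [Finset.sum_comm]
    simp only [← MinTensor.sum_tmul, hv.col_sum]
    rw [← MinTensor.tmul_sum, hv.col_sum, MinTensor.one_tmul_one]

end IsMagicUnitary

/-- The generators of the C*-algebra of the quantum permutation group; they are self-adjoint. -/
inductive PermGen (K : Type u) : Type u
  | mk (i j : K)

instance (K : Type u) : InvolutiveStar (PermGen K) where
  star x := x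
  star_involutive _ := rfl

/-- The relations of the quantum permutation group: the generators form a magic unitary. -/
def permRelations (K : Type u) [Fintype K] : CStarRelations (PermGen K) where
  Holds _ _ g := IsMagicUnitary fun i j => g (.mk i j)
  star_eq _ _ _ hg := fun ⟨i, j⟩ => (hg.star_eq i j).symm
  bounded := fun ⟨i, j⟩ => ⟨1, fun _ _ _ hg => projection_norm_le (hg.star_eq i j) (hg.mul_self i j)⟩

/-- The C*-algebra `C(S_K⁺)` of the quantum permutation group of the finite set `K`: the universal
unital C*-algebra generated by the entries of a magic unitary. -/
def PermAlgebra (K : Type u) [Fintype K] : Type u := (permRelations K).Universal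

section Perm

variable (K : Type u) [Fintype K]

instance : CStarAlgebra (PermAlgebra K) := inferInstanceAs (CStarAlgebra (permRelations K).Universal)

/-- The generators `u i j` of `C(S_K⁺)`. -/
def PermAlgebra.u (i j : K) : PermAlgebra K := (permRelations K).gen (.mk i j)

theorem PermAlgebra.isMagicUnitary : IsMagicUnitary (PermAlgebra.u K) where
  star_eq i j := (permRelations K).star_gen _
  mul_self i j := by
    rw [PermAlgebra.u, CStarRelations.gen]
    refine (map_mul (permRelations K).of _ _).symm.trans ((permRelations K).of_eq ?_)
    intro B _ g hg
    rw [map_mul, FreeStarAlgebra.eval_gen]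
    exact hg.mul_self i j
  row_sum i := by
    refine (map_sum (permRelations K).of _ _).symm.trans (Eq.trans ((permRelations K).of_eq ?_)
      (map_one (permRelations K).of))
    intro B _ g hg
    rw [map_sum, map_one]
    simp only [FreeStarAlgebra.eval_gen]
    exact hg.row_sum i
  col_sum j := by
    refine (map_sum (permRelations K).of _ _).symm.trans (Eq.trans ((permRelations K).of_eq ?_)
      (map_one (permRelations K).of))
    intro B _ g hg
    rw [map_sum, map_one]
    simp only [FreeStarAlgebra.eval_gen]
    exact hg.col_sum j

variable [DecidableEq K]

/-- The comultiplication `Δ(u i j) = ∑ k, u i k ⊗ u k j` of `S_K⁺`. -/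
def permComul : PermAlgebra K →⋆ₐ[ℂ] MinTensor (PermAlgebra K) (PermAlgebra K) :=
  (permRelations K).lift
    (fun | .mk i j => ∑ k, MinTensor.tmul (PermAlgebra.u K i k) (PermAlgebra.u K k j))
    (PermAlgebra.isMagicUnitary K).comul

theorem permComul_u (i j : K) : permComul K (PermAlgebra.u K i j) =
    ∑ k, MinTensor.tmul (PermAlgebra.u K i k) (PermAlgebra.u K k j) :=
  (permRelations K).lift_gen _ _ _

end Perm

/-! ### Free wreath products by the quantum permutation group -/

/-- The generators of the C*-algebra of the free wreath product by `S_J⁺` of a quantum group with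
C*-algebra `A`: a copy `copy l a` of each `a : A` for every `l : J`, and the generators
`perm k l` of `C(S_J⁺)`. -/
inductive WreathGen (A J : Type u) : Type u
  | copy (l : J) (a : A)
  | perm (k l : J)

instance (A J : Type u) [InvolutiveStar A] : InvolutiveStar (WreathGen A J) where
  star
    | .copy l a => .copy l (star a)
    | .perm k l => .perm k l
  star_involutive
    | .copy l a => by simp
    | .perm k l => rfl

/-- The relations of the free wreath product by `S_J⁺`: the `l`-th copy of `A` is the image of a
unital `*`-homomorphism `ν l`, the `v k l` form a magic unitary, and `ν k a` commutes with
`v k l`. -/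
structure WreathHolds {A J B : Type u} [CStarAlgebra A] [Fintype J] [CStarAlgebra B]
    (g : WreathGen A J → B) : Prop where
  hom : ∀ l, ∃ ν : A →⋆ₐ[ℂ] B, ∀ a, g (.copy l a) = ν a
  magic : IsMagicUnitary fun k l => g (.perm k l)
  commute : ∀ k l a, g (.copy k a) * g (.perm k l) = g (.perm k l) * g (.copy k a)

/-- The relations of the free wreath product, as relations between the generators. -/
def wreathRelations (A J : Type u) [CStarAlgebra A] [Fintype J] :
    CStarRelations (WreathGen A J) where
  Holds B _ g := WreathHolds g
  star_eq _ _ g hg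
    | .copy l a => by
      obtain ⟨ν, hν⟩ := hg.hom l
      change g (.copy l (star a)) = _
      rw [hν, hν, map_star]
    | .perm k l => (hg.magic.star_eq k l).symm
  bounded
    | .copy l a => ⟨‖a‖, fun B _ g hg => by
      obtain ⟨ν, hν⟩ := hg.hom l
      rw [hν]
      exact NonUnitalStarAlgHom.norm_apply_le ν a⟩
    | .perm k l => ⟨1, fun _ _ _ hg =>
      projection_norm_le (hg.magic.star_eq k l) (hg.magic.mul_self k l)⟩

/-- The C*-algebra of the free wreath product by `S_J⁺` of a quantum group with C*-algebra `A`: the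
quotient of the free product `A * ⋯ * A * C(S_J⁺)`, with one copy `ν l : A → A * ⋯ * A` for every
`l : J`, by the relations `ν k a * v k l = v k l * ν k a`. -/
def WreathAlgebra (A J : Type u) [CStarAlgebra A] [Fintype J] : Type u :=
  (wreathRelations A J).Universal

namespace WreathAlgebra

variable (A J : Type u) [CStarAlgebra A] [Fintype J]

instance : CStarAlgebra (WreathAlgebra A J) :=
  inferInstanceAs (CStarAlgebra (wreathRelations A J).Universal)

/-- The generators `v k l` of `C(S_J⁺)` in the free wreath product. -/
def v (k l : J) : WreathAlgebra A J := (wreathRelations A J).gen (.perm k l)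

/-- The `l`-th copy of `A` in the free wreath product. -/
def ν (l : J) : A →⋆ₐ[ℂ] WreathAlgebra A J :=
  haveI key : ∀ {x y : FreeStarAlgebra (WreathGen A J)},
      (∀ (B : Type u) [CStarAlgebra B] (g : WreathGen A J → B)
        (hg : (wreathRelations A J).Holds B g) (ν : A →⋆ₐ[ℂ] B) (_ : ∀ a, g (.copy l a) = ν a),
        FreeStarAlgebra.eval g ((wreathRelations A J).star_eq B g hg) x =
          FreeStarAlgebra.eval g ((wreathRelations A J).star_eq B g hg) y) →
      (wreathRelations A J).of x = (wreathRelations A J).of y := fun h =>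
    (wreathRelations A J).of_eq fun B _ g hg => by
      obtain ⟨ν, hν⟩ := WreathHolds.hom hg l
      exact h B g hg ν hν
  { toFun := fun a => (wreathRelations A J).gen (.copy l a)
    map_one' := by
      refine (key fun B _ g hg ν hν => ?_).trans (map_one (wreathRelations A J).of)
      rw [FreeStarAlgebra.eval_gen, hν, map_one, map_one]
    map_zero' := by
      refine (key fun B _ g hg ν hν => ?_).trans (map_zero (wreathRelations A J).of)
      rw [FreeStarAlgebra.eval_gen, hν, map_zero, map_zero]
    map_mul' := fun a b => by
      refine (key fun B _ g hg ν hν => ?_).trans (map_mul (wreathRelations A J).of _ _)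
      rw [map_mul, FreeStarAlgebra.eval_gen, FreeStarAlgebra.eval_gen, FreeStarAlgebra.eval_gen,
        hν, hν, hν, map_mul]
    map_add' := fun a b => by
      refine (key fun B _ g hg ν hν => ?_).trans (map_add (wreathRelations A J).of _ _)
      rw [map_add, FreeStarAlgebra.eval_gen, FreeStarAlgebra.eval_gen, FreeStarAlgebra.eval_gen,
        hν, hν, hν, map_add]
    commutes' := fun c => by
      refine (key fun B _ g hg ν hν => ?_).trans (AlgHomClass.commutes (wreathRelations A J).of c)
      rw [FreeStarAlgebra.eval_gen, hν, AlgHomClass.commutes, AlgHomClass.commutes]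
    map_star' := fun a => ((wreathRelations A J).star_gen (.copy l a)).symm }

theorem isMagicUnitary : IsMagicUnitary (v A J) where
  star_eq k l := (wreathRelations A J).star_gen _
  mul_self k l := by
    refine (map_mul (wreathRelations A J).of _ _).symm.trans ((wreathRelations A J).of_eq ?_)
    intro B _ g hg
    rw [map_mul, FreeStarAlgebra.eval_gen]
    exact hg.magic.mul_self k l
  row_sum k := by
    refine (map_sum (wreathRelations A J).of _ _).symm.trans
      (Eq.trans ((wreathRelations A J).of_eq ?_) (map_one (wreathRelations A J).of))
    intro B _ g hg
    rw [map_sum, map_one]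
    simp only [FreeStarAlgebra.eval_gen]
    exact hg.magic.row_sum k
  col_sum l := by
    refine (map_sum (wreathRelations A J).of _ _).symm.trans
      (Eq.trans ((wreathRelations A J).of_eq ?_) (map_one (wreathRelations A J).of))
    intro B _ g hg
    rw [map_sum, map_one]
    simp only [FreeStarAlgebra.eval_gen]
    exact hg.magic.col_sum l

theorem ν_mul_v (k l : J) (a : A) : ν A J k a * v A J k l = v A J k l * ν A J k a := by
  refine (map_mul (wreathRelations A J).of _ _).symm.trans
    (Eq.trans ((wreathRelations A J).of_eq ?_) (map_mul (wreathRelations A J).of _ _))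
  intro B _ g hg
  rw [map_mul, map_mul, FreeStarAlgebra.eval_gen, FreeStarAlgebra.eval_gen]
  exact hg.commute k l a

variable {A J}

/-- The element `(ν l ⊗ ν k)(x)` commutes with `v l p ⊗ 1`. -/
theorem map_ν_mul_left (l k p : J) (x : MinTensor A A) :
    MinTensor.map (ν A J l) (ν A J k) x * MinTensor.tmul (v A J l p) 1 =
      MinTensor.tmul (v A J l p) 1 * MinTensor.map (ν A J l) (ν A J k) x := by
  have hc : Continuous (MinTensor.map (ν A J l) (ν A J k)) :=
    AddMonoidHomClass.continuous_of_bound (MinTensor.map (ν A J l) (ν A J k)) 1 fun x => by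
      simpa using NonUnitalStarAlgHom.norm_apply_le (MinTensor.map (ν A J l) (ν A J k)) x
  induction x using MinTensor.induction
  case hc => exact isClosed_eq (by fun_prop) (by fun_prop)
  case add x y hx hy => rw [map_add, add_mul, mul_add, hx, hy]
  case h a b =>
    rw [MinTensor.map_tmul, MinTensor.tmul_mul_tmul, MinTensor.tmul_mul_tmul, ν_mul_v, one_mul,
      mul_one]

/-- The element `(ν l ⊗ ν k)(x)` commutes with `1 ⊗ v k p`. -/
theorem map_ν_mul_right (l k p : J) (x : MinTensor A A) :
    MinTensor.map (ν A J l) (ν A J k) x * MinTensor.tmul 1 (v A J k p) =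
      MinTensor.tmul 1 (v A J k p) * MinTensor.map (ν A J l) (ν A J k) x := by
  have hc : Continuous (MinTensor.map (ν A J l) (ν A J k)) :=
    AddMonoidHomClass.continuous_of_bound (MinTensor.map (ν A J l) (ν A J k)) 1 fun x => by
      simpa using NonUnitalStarAlgHom.norm_apply_le (MinTensor.map (ν A J l) (ν A J k)) x
  induction x using MinTensor.induction
  case hc => exact isClosed_eq (by fun_prop) (by fun_prop)
  case add x y hx hy => rw [map_add, add_mul, mul_add, hx, hy]
  case h a b =>
    rw [MinTensor.map_tmul, MinTensor.tmul_mul_tmul, MinTensor.tmul_mul_tmul, ν_mul_v, one_mul,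
      mul_one]

variable (Δ : A →⋆ₐ[ℂ] MinTensor A A)

/-- The image `∑ k, (ν l ⊗ ν k)(Δ a) (v l k ⊗ 1)` of `ν l a` under the comultiplication of the free
wreath product. -/
def comulν (l : J) (a : A) : MinTensor (WreathAlgebra A J) (WreathAlgebra A J) :=
  ∑ k, MinTensor.map (ν A J l) (ν A J k) (Δ a) * MinTensor.tmul (v A J l k) 1

variable [DecidableEq J]

theorem comulν_mul (l : J) (a b : A) :
    comulν Δ l (a * b) = comulν Δ l a * comulν Δ l b := by
  rw [comulν, comulν, comulν, Finset.sum_mul_sum]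
  refine Finset.sum_congr rfl fun k _ => ?_
  have : ∀ p, MinTensor.map (ν A J l) (ν A J k) (Δ a) * MinTensor.tmul (v A J l k) 1 *
      (MinTensor.map (ν A J l) (ν A J p) (Δ b) * MinTensor.tmul (v A J l p) 1) =
      if k = p then MinTensor.map (ν A J l) (ν A J k) (Δ (a * b)) *
        MinTensor.tmul (v A J l k) 1 else 0 := fun p => by
    rw [map_ν_mul_left l p p, mul_assoc, ← mul_assoc (MinTensor.tmul (v A J l k) 1),
      MinTensor.tmul_mul_tmul, (isMagicUnitary A J).row_orthogonal]
    split_ifs with h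
    · subst h
      rw [mul_one, ← map_ν_mul_left, ← mul_assoc, ← map_mul, ← map_mul]
    · rw [MinTensor.zero_tmul, zero_mul, mul_zero]
  simp only [this]
  rw [Finset.sum_ite_eq, if_pos (Finset.mem_univ k)]

/-- `comulν` as a unital `*`-homomorphism. -/
def comulνHom (l : J) : A →⋆ₐ[ℂ] MinTensor (WreathAlgebra A J) (WreathAlgebra A J) where
  toFun := comulν Δ l
  map_one' := by
    simp only [comulν, map_one, one_mul]
    rw [← MinTensor.sum_tmul, (isMagicUnitary A J).row_sum, MinTensor.one_tmul_one]
  map_zero' := by simp only [comulν, map_zero, zero_mul, Finset.sum_const_zero]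
  map_mul' := comulν_mul Δ l
  map_add' a b := by
    simp only [comulν, map_add, add_mul, Finset.sum_add_distrib]
  commutes' c := by
    simp only [comulν, AlgHomClass.commutes]
    rw [← Finset.mul_sum, ← MinTensor.sum_tmul, (isMagicUnitary A J).row_sum,
      MinTensor.one_tmul_one, mul_one]
  map_star' a := by
    simp only [comulν, star_sum, star_mul, MinTensor.star_tmul, (isMagicUnitary A J).star_eq,
      star_one, map_star]
    refine Finset.sum_congr rfl fun k _ => ?_
    rw [← map_star, ← map_star, map_ν_mul_left]

/-- The images of the generators under the comultiplication of the free wreath product. -/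
def comulGen : WreathGen A J → MinTensor (WreathAlgebra A J) (WreathAlgebra A J)
  | .copy l a => comulν Δ l a
  | .perm k l => ∑ p, MinTensor.tmul (v A J k p) (v A J p l)

theorem comulGen_holds : WreathHolds (comulGen (J := J) Δ) where
  hom l := ⟨comulνHom Δ l, fun _ => rfl⟩
  magic := (isMagicUnitary A J).comul
  commute k l a := by
    simp only [comulGen, comulν]
    rw [Finset.sum_mul_sum, Finset.sum_mul_sum, Finset.sum_comm]
    refine Finset.sum_congr rfl fun p _ => Finset.sum_congr rfl fun q _ => ?_
    have h1 : MinTensor.tmul (v A J k p) (v A J p l) =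
        MinTensor.tmul (v A J k p) 1 * MinTensor.tmul 1 (v A J p l) := by
      rw [MinTensor.tmul_mul_tmul, mul_one, one_mul]
    have h2 : MinTensor.tmul (v A J k p) (v A J p l) =
        MinTensor.tmul 1 (v A J p l) * MinTensor.tmul (v A J k p) 1 := by
      rw [MinTensor.tmul_mul_tmul, mul_one, one_mul]
    by_cases hpq : p = q
    · subst hpq
      have h3 : Commute (MinTensor.map (ν A J k) (ν A J p) (Δ a))
          (MinTensor.tmul (v A J k p) (v A J p l)) := by
        rw [h1]
        exact Commute.mul_right (map_ν_mul_left k p p (Δ a)) (map_ν_mul_right k p l (Δ a))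
      have h4 : Commute (MinTensor.tmul (v A J k p) 1)
          (MinTensor.tmul (v A J k p) (v A J p l)) := by
        rw [commute_iff_eq, MinTensor.tmul_mul_tmul, MinTensor.tmul_mul_tmul, one_mul, mul_one]
      exact (Commute.mul_left h3 h4).eq
    · rw [mul_assoc, MinTensor.tmul_mul_tmul, (isMagicUnitary A J).row_orthogonal,
        if_neg (Ne.symm hpq), MinTensor.zero_tmul, mul_zero, map_ν_mul_left, ← mul_assoc,
        MinTensor.tmul_mul_tmul, (isMagicUnitary A J).row_orthogonal, if_neg hpq,
        MinTensor.zero_tmul, zero_mul]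

variable (J) in
/-- The comultiplication of the free wreath product by `S_J⁺` of the quantum group `(A, Δ)`,
`Δ(ν l a) = ∑ k, (ν l ⊗ ν k)(Δ a) (v l k ⊗ 1)` and `Δ(v k l) = ∑ p, v k p ⊗ v p l`. -/
def comul : WreathAlgebra A J →⋆ₐ[ℂ] MinTensor (WreathAlgebra A J) (WreathAlgebra A J) :=
  (wreathRelations A J).lift (comulGen Δ) (comulGen_holds Δ)

theorem comul_ν (l : J) (a : A) : comul J Δ (ν A J l a) =
    ∑ k, MinTensor.map (ν A J l) (ν A J k) (Δ a) * MinTensor.tmul (v A J l k) 1 :=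
  (wreathRelations A J).lift_gen _ _ _

theorem comul_v (k l : J) : comul J Δ (v A J k l) =
    ∑ p, MinTensor.tmul (v A J k p) (v A J p l) :=
  (wreathRelations A J).lift_gen _ _ _

end WreathAlgebra

/-! ### Compact quantum groups -/

/-- `(A, Δ)` is a compact quantum group `G` with `C(G) = A`: `Δ` is coassociative and
`[Δ(A)(1 ⊗ A)] = [Δ(A)(A ⊗ 1)] = A ⊗ A`. -/
structure IsCompactQuantumGroup {A : Type u} [CStarAlgebra A] (Δ : A →⋆ₐ[ℂ] MinTensor A A) :
    Prop where
  nontrivial : Nontrivial A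
  coassoc : ∀ a, AssocEq (MinTensor.map Δ (StarAlgHom.id ℂ A) (Δ a))
    (MinTensor.map (StarAlgHom.id ℂ A) Δ (Δ a))
  dense_right : Dense
    (Submodule.span ℂ {x | ∃ a b, x = Δ a * MinTensor.tmul 1 b} : Set (MinTensor A A))
  dense_left : Dense
    (Submodule.span ℂ {x | ∃ a b, x = Δ a * MinTensor.tmul b 1} : Set (MinTensor A A))

/-- Hopf `*`-homomorphisms `C(G₂) → C(G₁)`, i.e. morphisms `G₁ → G₂`. -/
def IsHopfStarHom {A B : Type u} [CStarAlgebra A] [CStarAlgebra B] (Δ : A →⋆ₐ[ℂ] MinTensor A A)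
    (Δ' : B →⋆ₐ[ℂ] MinTensor B B) (f : A →⋆ₐ[ℂ] B) : Prop :=
  ∀ a, MinTensor.map f f (Δ a) = Δ' (f a)

/-- Isomorphism of compact quantum groups. -/
def IsomorphicQuantumGroups {A B : Type u} [CStarAlgebra A] [CStarAlgebra B]
    (Δ : A →⋆ₐ[ℂ] MinTensor A A) (Δ' : B →⋆ₐ[ℂ] MinTensor B B) : Prop :=
  ∃ e : A ≃⋆ₐ[ℂ] B, IsHopfStarHom Δ Δ' e.toStarAlgHom

/-! ### Actions on finite spaces

For a finite set `X`, `C(X)` is `X → ℂ`, and `C(X) ⊗ A` is `C(X, A)`, i.e. `X → A`, where `f ⊗ a`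
is the function `x ↦ f x • a`. -/

section Action

variable {A B : Type u} [CStarAlgebra A] [CStarAlgebra B] {X : Type u} [Fintype X] [DecidableEq X]

/-- The map `T ⊗ id : C(X) ⊗ B → C(X) ⊗ A ⊗ B` for a linear map `T : C(X) → C(X) ⊗ A`. -/
def tensorId (T : (X → ℂ) →ₗ[ℂ] (X → A)) (F : X → B) : X → MinTensor A B :=
  fun x => ∑ y, MinTensor.tmul (T (Pi.single y 1) x) (F y)

/-- Coassociativity `(T ⊗ id) T = (id ⊗ Δ) T` of a linear map `T : C(X) → C(X) ⊗ A`. -/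
def IsCoassociative (Δ : A →⋆ₐ[ℂ] MinTensor A A) (T : (X → ℂ) →ₗ[ℂ] (X → A)) : Prop :=
  ∀ f, tensorId T (T f) = fun x => Δ (T f x)

/-- The Podleś condition `[T(C(X))(1 ⊗ A)] = C(X) ⊗ A`. -/
def PodlesCondition (T : (X → ℂ) →ₗ[ℂ] (X → A)) : Prop :=
  Dense (Submodule.span ℂ {F | ∃ (f : X → ℂ) (a : A), F = fun x => T f x * a} : Set (X → A))

/-- `(C(X), α)` is a `G`-C*-algebra, for the compact quantum group `G = (A, Δ)`. -/
structure IsAction (Δ : A →⋆ₐ[ℂ] MinTensor A A) (α : (X → ℂ) →ₗ[ℂ] (X → A)) : Prop where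
  map_one : α 1 = 1
  map_mul : ∀ f g, α (f * g) = α f * α g
  map_star : ∀ f, α (star f) = star (α f)
  coassoc : IsCoassociative Δ α
  podles : PodlesCondition α

/-- The slice `(ω ⊗ id)(F)` of `F` in `C(X) ⊗ A` by a functional `ω` on `C(X)`. -/
def slice (ω : (X → ℂ) →ₗ[ℂ] ℂ) (F : X → A) : A := ∑ x, ω (Pi.single x 1) • F x

/-- The action `α` on `C(X)` is faithful: the `*`-algebra generated by the elements
`(ω ⊗ id) α(f)` is dense. -/
def IsFaithfulAction (α : (X → ℂ) →ₗ[ℂ] (X → A)) : Prop :=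
  Dense (StarAlgebra.adjoin ℂ {a | ∃ (ω : (X → ℂ) →ₗ[ℂ] ℂ) (f : X → ℂ), a = slice ω (α f)} : Set A)

end Action

/-! ### Graphs and their correspondences -/

/-- A directed graph with vertex set `V` and edge set `E`, possibly with loops and multiple edges;
`r` and `s` are the range and source maps. -/
structure DirectedMultigraph (V E : Type u) where
  r : E → V
  s : E → V

namespace DirectedMultigraph

/-- The graph with one vertex and a loop for every element of `I`. -/
def loops (I : Type u) : DirectedMultigraph PUnit.{u + 1} I where
  r _ := PUnit.unit
  s _ := PUnit.unit

/-- The disjoint union of copies of the graph `𝒢`, one for every element of `J`. -/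
def copies {V E : Type u} (𝒢 : DirectedMultigraph V E) (J : Type u) :
    DirectedMultigraph (J × V) (J × E) where
  r e := (e.1, 𝒢.r e.2)
  s e := (e.1, 𝒢.s e.2)

variable {V E : Type u} [Fintype E] [DecidableEq V] (𝒢 : DirectedMultigraph V E)

/-- The right action of `C(V) ⊗ B` on `C(E) ⊗ B`; for `B = ℂ`, the right action of `C(V)` on the
graph correspondence `C(E)`. -/
def rightSMul {B : Type*} [CStarAlgebra B] (ξ : E → B) (f : V → B) : E → B :=
  fun e => ξ e * f (𝒢.r e)

/-- The left action of `C(V) ⊗ B` on `C(E) ⊗ B`; for `B = ℂ`, the left action `φ` of `C(V)` on the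
graph correspondence `C(E)`. -/
def leftSMul {B : Type*} [CStarAlgebra B] (f : V → B) (ξ : E → B) : E → B :=
  fun e => f (𝒢.s e) * ξ e

/-- The `C(V) ⊗ B`-valued inner product on `C(E) ⊗ B`; for `B = ℂ`, the `C(V)`-valued inner product
on the graph correspondence `C(E)`. -/
def innerProd {B : Type*} [CStarAlgebra B] (ξ η : E → B) : V → B :=
  fun v => ∑ e with 𝒢.r e = v, star (ξ e) * η e

end DirectedMultigraph

section Category

variable {V E : Type u} [Fintype V] [Fintype E] [DecidableEq V] [DecidableEq E]
  (𝒢 : DirectedMultigraph V E)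

/-- `(C(E), φ, lam)` is a `G`-equivariant C*-correspondence over `(C(V), α)`, for the compact
quantum group `G = (A, Δ)`. -/
structure IsEquivariantCorrespondence {A : Type u} [CStarAlgebra A] (Δ : A →⋆ₐ[ℂ] MinTensor A A)
    (α : (V → ℂ) →ₗ[ℂ] (V → A)) (lam : (E → ℂ) →ₗ[ℂ] (E → A)) : Prop where
  map_rightSMul : ∀ ξ f, lam (𝒢.rightSMul ξ f) = 𝒢.rightSMul (lam ξ) (α f)
  map_innerProd : ∀ ξ η, 𝒢.innerProd (lam ξ) (lam η) = α (𝒢.innerProd ξ η)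
  coassoc : IsCoassociative Δ lam
  podles : PodlesCondition lam
  map_leftSMul : ∀ f ξ, lam (𝒢.leftSMul f ξ) = 𝒢.leftSMul (α f) (lam ξ)

/-- The objects `(G, α, lam)` of the category `C_Bic^mult(𝒢)`, where `G = (A, Δ)`. -/
structure IsBicObject {A : Type u} [CStarAlgebra A] (Δ : A →⋆ₐ[ℂ] MinTensor A A)
    (α : (V → ℂ) →ₗ[ℂ] (V → A)) (lam : (E → ℂ) →ₗ[ℂ] (E → A)) : Prop where
  quantumGroup : IsCompactQuantumGroup Δ
  vertexAction : IsAction Δ α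
  correspondence : IsEquivariantCorrespondence 𝒢 Δ α lam
  edgeAction : IsAction Δ lam
  faithful : IsFaithfulAction lam

/-- The morphisms `(G₁, α₁, lam₁) → (G₂, α₂, lam₂)` of the category `C_Bic^mult(𝒢)`, where
`Gᵢ = (Aᵢ, Δᵢ)`: the Hopf `*`-homomorphisms `f : A₂ → A₁` with `(id ⊗ f) α₂ = α₁` and
`(id ⊗ f) lam₂ = lam₁`. -/
structure IsBicMorphism {A₁ A₂ : Type u} [CStarAlgebra A₁] [CStarAlgebra A₂]
    (Δ₁ : A₁ →⋆ₐ[ℂ] MinTensor A₁ A₁) (α₁ : (V → ℂ) →ₗ[ℂ] (V → A₁))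
    (lam₁ : (E → ℂ) →ₗ[ℂ] (E → A₁))
    (Δ₂ : A₂ →⋆ₐ[ℂ] MinTensor A₂ A₂) (α₂ : (V → ℂ) →ₗ[ℂ] (V → A₂))
    (lam₂ : (E → ℂ) →ₗ[ℂ] (E → A₂)) (f : A₂ →⋆ₐ[ℂ] A₁) : Prop where
  hopf : IsHopfStarHom Δ₂ Δ₁ f
  vertex : ∀ h v, f (α₂ h v) = α₁ h v
  edge : ∀ ξ e, f (lam₂ ξ e) = lam₁ ξ e

/-- `(G, α, lam)` is a universal object of `C_Bic^mult(𝒢)`: every object has a unique morphism to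
it. -/
structure IsUniversalBicObject {A : Type u} [CStarAlgebra A] (Δ : A →⋆ₐ[ℂ] MinTensor A A)
    (α : (V → ℂ) →ₗ[ℂ] (V → A)) (lam : (E → ℂ) →ₗ[ℂ] (E → A)) : Prop where
  isObject : IsBicObject 𝒢 Δ α lam
  universal : ∀ (B : Type u) [CStarAlgebra B] (Δ' : B →⋆ₐ[ℂ] MinTensor B B)
    (α' : (V → ℂ) →ₗ[ℂ] (V → B)) (lam' : (E → ℂ) →ₗ[ℂ] (E → B)), IsBicObject 𝒢 Δ' α' lam' →
    ∃! f : A →⋆ₐ[ℂ] B, IsBicMorphism Δ' α' lam' Δ α lam f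

end Category

end

noncomputable section

open scoped ComplexOrder InnerProductSpace

/-! ### States -/


/-! Over a finite set `X` everything is a matter of matrices. An action of a compact quantum group
on C(X) is a matrix w over C(G), w_{xk} being the value at x of the image of δ_k, with Δ(w_{xk}) =
∑_y w_{xy} ⊗ w_{yk}. That it is a unital *-homomorphism says that the entries are projections and
that each row is orthogonal with sum 1. The one analytic fact needed is that the columns sum to 1 as
well, so that w is a magic unitary (`IsAction.isMagicUnitary`).

The columns are controlled by an invariant state h, (ρ ⊗ h)Δ = h for all states ρ
(`IsCompactQuantumGroup.exists_invariant_state`). It is built by the classical route: Cesàro means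
of convolution powers give a state fixed by one given state (`exists_isState_convolution_eq`), a
Cauchy-Schwarz argument passes from an average to its members (`convolution_eq_of_average`), and
compactness of the state space treats all states at once. This needs states and slice maps on the
minimal tensor product, obtained from GNS representations. Invariance makes the Gram matrix g(l,l')
= h(∑_k w_{lk} w_{l'k}) satisfy (g(p,p') − g(l,l')) w_{lp} w_{l'p'} = 0, and the Podleś condition
excludes g(l,l') = 1 for l ≠ l'. Taking p = p' yields column orthogonality, and counting then forces
the column sums to be 1.

Conversely, a nonzero C*-algebra generated by the entries of a magic unitary on which Δ is matrix
comultiplication is a compact quantum group, acting on C(X) (`IsMagicUnitary.isCompactQuantumGroup`,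
`IsMagicUnitary.isAction`): explicit finite sums solve the density conditions for the generators.

In the free wreath product the relevant matrix is ν_l(u_{ji}) v_{lk}, indexed by edges (l,j), (k,i).
Summing over k returns ν_l(u_{ji}), and summing over j returns v_{lk}; so this one matrix generates
the algebra and determines all morphisms. For an arbitrary object, let λ and α also denote the
coefficient matrices. Put U^l_{ji} = ∑_k λ_{(l,j),(k,i)}. Compatibility with the right and left
actions gives U^l_{ji} α_{lk} = λ_{(l,j),(k,i)} = α_{lk} U^l_{ji}, which is exactly the wreath
commutation relation, and preservation of the inner product gives ∑_j λ_{(l,j),(k,i)} = α_{lk},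
whence the columns of U^l sum to 1. The universal property of the wreath algebra then supplies the
morphism (`IsBicObject.hom`), and uniqueness of morphisms makes any two universal objects
isomorphic. -/

/-- States of a unital C*-algebra: normalized positive functionals. -/
structure IsState {A : Type u} [CStarAlgebra A] (φ : A →L[ℂ] ℂ) : Prop where
  apply_one : φ 1 = 1
  nonneg : ∀ a, 0 ≤ φ (star a * a)

namespace IsState

variable {A : Type u} [CStarAlgebra A] {φ : A →L[ℂ] ℂ}

/-- A state is a vector state in its GNS representation. -/
theorem exists_rep (hφ : IsState φ) : ∃ (H : Type u) (_ : NormedAddCommGroup H)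
    (_ : InnerProductSpace ℂ H) (_ : CompleteSpace H) (π : A →⋆ₐ[ℂ] (H →L[ℂ] H)) (ξ : H),
    ‖ξ‖ = 1 ∧ ∀ a, φ a = ⟪ξ, π a ξ⟫_ℂ := by
  let := CStarAlgebra.spectralOrder A
  let := CStarAlgebra.spectralOrderedRing A
  let f : A →ₚ[ℂ] ℂ := PositiveLinearMap.mk₀ φ.toLinearMap fun x hx => by
    obtain ⟨b, rfl⟩ := CStarAlgebra.nonneg_iff_eq_star_mul_self.mp hx
    exact hφ.nonneg b
  -- The class of 1 is the cyclic GNS vector: π(a) sends it to the class of a, and its inner product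
  -- with that class is φ(a).
  have key : ∀ a, φ a = ⟪(f.toPreGNS 1 : f.GNS), f.gnsStarAlgHom a (f.toPreGNS 1 : f.GNS)⟫_ℂ := by
    intro a
    have h1 : f.gnsStarAlgHom a (f.toPreGNS 1 : f.GNS) = (f.toPreGNS a : f.GNS) := by
      refine (f.gnsNonUnitalStarAlgHom_apply_coe).trans ?_
      rw [PositiveLinearMap.leftMulMapPreGNS_apply]
      simp
    rw [h1, UniformSpace.Completion.inner_coe, PositiveLinearMap.preGNS_inner_def]
    change φ a = φ _
    simp
  refine ⟨f.GNS, inferInstance, inferInstance, inferInstance, f.gnsStarAlgHom,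
    (f.toPreGNS 1 : f.GNS), ?_, key⟩
  have h := key 1
  rw [hφ.apply_one, map_one f.gnsStarAlgHom, one_apply_eq_self, inner_self_eq_norm_sq_to_K] at h
  have h2 : ‖(f.toPreGNS 1 : f.GNS)‖ ^ 2 = 1 := by
    rw [RCLike.ofReal_eq_complex_ofReal] at h
    exact_mod_cast h.symm
  nlinarith [norm_nonneg (f.toPreGNS 1 : f.GNS)]

theorem apply_star (hφ : IsState φ) (a : A) : φ (star a) = star (φ a) := by
  obtain ⟨H, _, _, _, π, ξ, -, h⟩ := hφ.exists_rep
  rw [h, h, map_star, ContinuousLinearMap.star_eq_adjoint,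
    ContinuousLinearMap.adjoint_inner_right, ← inner_conj_symm]
  rfl

theorem norm_apply_le (hφ : IsState φ) (a : A) : ‖φ a‖ ≤ ‖a‖ := by
  obtain ⟨H, _, _, _, π, ξ, hξ, h⟩ := hφ.exists_rep
  rw [h]
  calc ‖⟪ξ, π a ξ⟫_ℂ‖ ≤ ‖ξ‖ * ‖π a ξ‖ := norm_inner_le_norm _ _
    _ ≤ ‖ξ‖ * (‖π a‖ * ‖ξ‖) := by gcongr; exact (π a).le_opNorm ξ
    _ = ‖π a‖ := by rw [hξ]; ring
    _ ≤ ‖a‖ := NonUnitalStarAlgHom.norm_apply_le π a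

/-- The consequence of the Cauchy-Schwarz inequality for null vectors. -/
theorem mul_eq_zero (hφ : IsState φ) {d : A} (hd : φ (star d * d) = 0) (c : A) :
    φ (c * d) = 0 := by
  obtain ⟨H, _, _, _, π, ξ, -, h⟩ := hφ.exists_rep
  rw [h, map_mul, map_star, ContinuousLinearMap.star_eq_adjoint,
    mul_apply_eq_comp, ContinuousLinearMap.adjoint_inner_right, inner_self_eq_zero]
    at hd
  rw [h, map_mul, mul_apply_eq_comp, hd, map_zero, inner_zero_right]

/-- The adjoint of the preceding statement, using that a state commutes with the involution. -/
theorem mul_eq_zero' (hφ : IsState φ) {d : A} (hd : φ (star d * d) = 0) (c : A) :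
    φ (star d * c) = 0 := by
  have := hφ.mul_eq_zero hd (star c)
  have h2 := hφ.apply_star (star c * d)
  rw [this, star_mul, star_star, star_zero] at h2
  exact h2

/-- A functional of norm one that is attained at the unit is a state. -/
theorem of_norm_le (h1 : φ 1 = 1) (h : ∀ a, ‖φ a‖ ≤ ‖a‖) : IsState φ where
  apply_one := h1
  nonneg b := by
    let := CStarAlgebra.spectralOrder A
    let := CStarAlgebra.spectralOrderedRing A
    set a := star b * b with ha
    have hsa : star a = a := by rw [ha, star_mul, star_star]
    have ha0 : 0 ≤ a := star_mul_self_nonneg b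
    have hnt : Nontrivial A := by
      refine ⟨1, 0, fun h0 => ?_⟩
      rw [h0, map_zero] at h1
      exact zero_ne_one h1
    -- Perturb a by it·1. Since a is self-adjoint the cross terms cancel in the C*-identity, so the
    -- squared norm grows only by t², whereas the square of Im φ(a) + t also contains the linear
    -- term 2t·Im φ(a).
    have him : ∀ t : ℝ, (φ a).re ^ 2 + ((φ a).im + t) ^ 2 ≤ ‖a‖ ^ 2 + t ^ 2 := fun t => by
      have e1 : φ (a + (t * Complex.I) • (1 : A)) = φ a + t * Complex.I := by
        rw [map_add, map_smul, h1, smul_eq_mul, mul_one]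
      have e2 := h (a + (t * Complex.I) • (1 : A))
      have e3 : star (a + (t * Complex.I) • (1 : A)) * (a + (t * Complex.I) • (1 : A)) =
          a * a + ((t ^ 2 : ℝ) : ℂ) • (1 : A) := by
        have hc : star ((t : ℂ) * Complex.I) = -(t * Complex.I) := by
          simp
        rw [star_add, star_smul, star_one, hsa, hc, add_mul, mul_add, mul_add, neg_smul,
          neg_mul, neg_mul, smul_mul_assoc, one_mul, mul_smul_comm, mul_one,
          smul_mul_smul_comm, one_mul]
        have : (t : ℂ) * Complex.I * (t * Complex.I) = -((t ^ 2 : ℝ) : ℂ) := by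
          push_cast
          linear_combination (t : ℂ) ^ 2 * Complex.I_sq
        rw [this, neg_smul]
        abel
      have e4 : ‖a + (t * Complex.I) • (1 : A)‖ ^ 2 ≤ ‖a‖ ^ 2 + t ^ 2 := by
        rw [sq, ← CStarRing.norm_star_mul_self, e3]
        refine (norm_add_le _ _).trans ?_
        rw [norm_smul, norm_one, mul_one, Complex.norm_real, Real.norm_of_nonneg (sq_nonneg t)]
        gcongr
        rw [sq]
        exact norm_mul_le a a
      have e5 : ‖φ a + t * Complex.I‖ ^ 2 = (φ a).re ^ 2 + ((φ a).im + t) ^ 2 := by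
        rw [← Complex.normSq_eq_norm_sq, Complex.normSq_apply]
        simp
        ring
      rw [← e5, ← e1]
      exact (pow_le_pow_left₀ (norm_nonneg _) e2 2).trans e4
    have him0 : (φ a).im = 0 := by
      by_contra hne
      -- This t makes the linear term 2t·Im φ(a) equal to ‖a‖² + 1, more than the bound allows.
      have h2 := him ((‖a‖ ^ 2 + 1) / (2 * (φ a).im))
      have h3 : 2 * (φ a).im * ((‖a‖ ^ 2 + 1) / (2 * (φ a).im)) = ‖a‖ ^ 2 + 1 := by
        field_simp
      nlinarith [sq_nonneg (φ a).re, sq_nonneg (φ a).im]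
    -- From 0 ≤ a ≤ ‖a‖·1, the element ‖a‖·1 − a has norm at most ‖a‖. Hence ‖a‖ − Re φ(a) ≤ ‖a‖,
    -- which is positivity of the real part.
    have hle : ‖(‖a‖ : ℂ) • (1 : A) - a‖ ≤ ‖a‖ := by
      have e1 : (‖a‖ : ℂ) • (1 : A) = algebraMap ℝ A ‖a‖ := by
        rw [Algebra.algebraMap_eq_smul_one, Complex.coe_smul]
      have e2 : a ≤ algebraMap ℝ A ‖a‖ := IsSelfAdjoint.le_algebraMap_norm_self hsa
      rw [e1]
      refine (CStarAlgebra.norm_le_norm_of_nonneg_of_le (sub_nonneg.mpr e2)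
        (sub_le_self _ ha0)).trans ?_
      rw [norm_algebraMap', Real.norm_of_nonneg (norm_nonneg a)]
    have hre : 0 ≤ (φ a).re := by
      have e1 := (h _).trans hle
      rw [map_sub, map_smul, h1, smul_eq_mul, mul_one] at e1
      have e2 := (Complex.abs_re_le_norm _).trans e1
      rw [Complex.sub_re, Complex.ofReal_re] at e2
      linarith [(abs_le.mp e2).2]
    exact Complex.nonneg_iff.mpr ⟨hre, him0.symm⟩

end IsState

variable {A B : Type u} [CStarAlgebra A] [CStarAlgebra B]

/-- Every spectral value of an element is its value at a state. -/
theorem exists_isState_of_mem_spectrum {a : A} {z : ℂ} (hz : z ∈ spectrum ℂ a) :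
    ∃ φ : A →L[ℂ] ℂ, IsState φ ∧ φ a = z := by
  have hnt : Nontrivial A := by
    by_contra h
    rw [not_nontrivial_iff_subsingleton] at h
    simp [spectrum.of_subsingleton] at hz
  set b := algebraMap ℂ A z - a with hb
  have hbu : ¬ IsUnit b := hz
  let S := Submodule.span ℂ {b}
  -- The line through the non-invertible element b has distance at least 1 from the unit, because 1
  -- lies in the spectrum of 1 − μb and the norm dominates spectral values.
  have hone : ∀ μ : ℂ, 1 ≤ ‖(1 : A) - μ • b‖ := fun μ => by
    have h1 : (1 : ℂ) ∈ spectrum ℂ ((1 : A) - μ • b) := by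
      rw [spectrum.mem_iff, map_one, sub_sub_cancel]
      intro hu
      rcases eq_or_ne μ 0 with rfl | hμ
      · rw [zero_smul] at hu
        exact not_isUnit_zero hu
      · exact hbu ((isUnit_smul_iff (Units.mk0 μ hμ) b).mp hu)
    simpa using spectrum.norm_le_norm_of_mem h1
  have hq : ‖(Submodule.Quotient.mk 1 : A ⧸ S)‖ = 1 := by
    apply le_antisymm
    · simpa using Submodule.Quotient.norm_mk_le S (1 : A)
    · refine le_of_forall_pos_le_add fun ε hε => ?_
      obtain ⟨m, hm, hlt⟩ := Submodule.Quotient.norm_mk_lt (Submodule.Quotient.mk 1 : A ⧸ S) hε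
      rw [Submodule.Quotient.eq] at hm
      obtain ⟨μ, hμ⟩ := Submodule.mem_span_singleton.mp hm
      have : m = 1 - (-μ) • b := by rw [neg_smul, hμ]; abel
      rw [this] at hlt
      exact (hone _).trans hlt.le
  -- Hahn-Banach on the quotient by the line through b: the pulled back functional is contractive,
  -- takes the value 1 at the unit and kills z − a.
  obtain ⟨g, hg, hg1⟩ := exists_dual_vector'' ℂ (Submodule.Quotient.mk 1 : A ⧸ S)
  rw [hq] at hg1
  let φ : A →L[ℂ] ℂ := LinearMap.mkContinuous (g.toLinearMap ∘ₗ S.mkQ) 1 fun x => by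
    refine (g.le_opNorm _).trans ?_
    exact mul_le_mul hg (Submodule.Quotient.norm_mk_le S x) (norm_nonneg _) zero_le_one
  have hφ1 : φ 1 = 1 := by
    refine hg1.trans (by simp)
  refine ⟨φ, IsState.of_norm_le hφ1 fun x => ?_, ?_⟩
  · refine (φ.le_opNorm x).trans ?_
    exact mul_le_of_le_one_left (norm_nonneg _) (LinearMap.mkContinuous_norm_le _ zero_le_one _)
  · have h0 : φ b = 0 := by
      change g (Submodule.Quotient.mk b) = 0
      rw [(Submodule.Quotient.mk_eq_zero S).mpr (Submodule.mem_span_singleton_self b), map_zero]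
    rw [hb, map_sub, Algebra.algebraMap_eq_smul_one, map_smul, hφ1, smul_eq_mul, mul_one,
      sub_eq_zero] at h0
    exact h0.symm

/-- For self-adjoint a one of ±‖a‖ is a spectral value, and spectral values are values of states. -/
theorem exists_isState_norm_apply [Nontrivial A] {a : A} (ha : star a = a) :
    ∃ φ : A →L[ℂ] ℂ, IsState φ ∧ ‖φ a‖ = ‖a‖ := by
  have hmem : ∀ r : ℝ, r ∈ spectrum ℝ a → |r| = ‖a‖ →
      ∃ φ : A →L[ℂ] ℂ, IsState φ ∧ ‖φ a‖ = ‖a‖ := fun r hr h => by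
    have h2 := (spectrum.algebraMap_mem_iff ℂ (R := ℝ) (a := a) (r := r)).mpr hr
    obtain ⟨φ, hφ, h3⟩ := exists_isState_of_mem_spectrum h2
    refine ⟨φ, hφ, ?_⟩
    rw [h3, norm_algebraMap', Real.norm_eq_abs, h]
  rcases CStarAlgebra.norm_or_neg_norm_mem_spectrum (a := a) ha with h | h
  · exact hmem _ h (abs_norm a)
  · exact hmem _ h (by rw [abs_neg, abs_norm])

/-- The states of a C*-algebra separate its points. -/
theorem eq_zero_of_forall_isState {a : A} (h : ∀ φ : A →L[ℂ] ℂ, IsState φ → φ a = 0) : a = 0 := by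
  rcases subsingleton_or_nontrivial A with hA | hA
  · exact Subsingleton.elim _ _
  have hsa : ∀ b : A, star b = b → (∀ φ : A →L[ℂ] ℂ, IsState φ → φ b = 0) → b = 0 := by
    intro b hb h
    obtain ⟨φ, hφ, h1⟩ := exists_isState_norm_apply hb
    rw [h φ hφ, norm_zero] at h1
    exact norm_eq_zero.mp h1.symm
  -- The self-adjoint case applies to a + a* and to i(a − a*), on which all states vanish too;
  -- together they give 2a = 0.
  have h1 : a + star a = 0 := hsa _ (by rw [star_add, star_star, add_comm]) fun φ hφ => by
    rw [map_add, hφ.apply_star, h φ hφ, star_zero, add_zero]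
  have h2 : Complex.I • (a - star a) = 0 := hsa _ (by
      rw [star_smul, star_sub, star_star, Complex.star_def, Complex.conj_I, neg_smul, ← smul_neg,
        neg_sub]) fun φ hφ => by
    rw [map_smul, map_sub, hφ.apply_star, h φ hφ, star_zero, sub_zero, smul_zero]
  have h3 := (smul_eq_zero_iff_right Complex.I_ne_zero).mp h2
  have h4 : (2 : ℂ) • a = 0 := by
    have : (2 : ℂ) • a = (a + star a) + (a - star a) := by rw [two_smul]; abel
    rw [this, h1, h3, add_zero]
  exact (smul_eq_zero_iff_right two_ne_zero).mp h4

theorem ext_of_forall_isState {a b : A} (h : ∀ φ : A →L[ℂ] ℂ, IsState φ → φ a = φ b) :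
    a = b := by
  rw [← sub_eq_zero]
  exact eq_zero_of_forall_isState fun φ hφ => by rw [map_sub, h φ hφ, sub_self]

/-! ### Vector functionals -/

/-- The contractive functionals of the form `a ↦ ⟪ζ, π a ξ⟫` for a representation `π`. -/
def IsVectorFunctional (φ : A →L[ℂ] ℂ) : Prop :=
  ∃ (H : Type u) (_ : NormedAddCommGroup H) (_ : InnerProductSpace ℂ H) (_ : CompleteSpace H)
    (π : A →⋆ₐ[ℂ] (H →L[ℂ] H)) (ζ ξ : H), ‖ζ‖ ≤ 1 ∧ ‖ξ‖ ≤ 1 ∧ ∀ a, φ a = ⟪ζ, π a ξ⟫_ℂ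

theorem IsState.isVectorFunctional {φ : A →L[ℂ] ℂ} (hφ : IsState φ) : IsVectorFunctional φ := by
  obtain ⟨H, _, _, _, π, ξ, hξ, h⟩ := hφ.exists_rep
  exact ⟨H, _, _, _, π, ξ, ξ, hξ.le, hξ.le, h⟩

/-- The norm of a C*-algebra is attained on vector functionals. -/
theorem exists_isVectorFunctional {c : A} (hc : c ≠ 0) :
    ∃ φ : A →L[ℂ] ℂ, IsVectorFunctional φ ∧ φ c = ‖c‖ := by
  have : Nontrivial A := ⟨c, 0, hc⟩
  -- States attain the norm of self-adjoint elements, so the state is taken at c*c; its GNS vector ξ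
  -- then satisfies ‖π(c)ξ‖ = ‖c‖.
  obtain ⟨φ, hφ, h1⟩ := exists_isState_norm_apply (a := star c * c) (by rw [star_mul, star_star])
  obtain ⟨H, _, _, _, π, ξ, hξ, h⟩ := hφ.exists_rep
  have hcn : ‖c‖ ≠ 0 := norm_ne_zero_iff.mpr hc
  have h2 : φ (star c * c) = ((‖π c ξ‖ ^ 2 : ℝ) : ℂ) := by
    rw [h, map_mul, map_star, ContinuousLinearMap.star_eq_adjoint,
      mul_apply_eq_comp, ContinuousLinearMap.adjoint_inner_right,
      inner_self_eq_norm_sq_to_K]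
    simp
  have h3 : ‖π c ξ‖ = ‖c‖ := by
    rw [h2, Complex.norm_real, CStarRing.norm_star_mul_self, norm_pow, norm_norm] at h1
    nlinarith [norm_nonneg c, norm_nonneg (π c ξ)]
  -- The normalization of π(c)ξ, which turns the inner product with π(c)ξ into ‖c‖.
  let ζ : H := ((‖c‖⁻¹ : ℝ) : ℂ) • π c ξ
  have hζ : ‖ζ‖ ≤ 1 := by
    rw [norm_smul, h3, Complex.norm_real, norm_inv, norm_norm, inv_mul_cancel₀ hcn]
  let ψ : A →L[ℂ] ℂ := LinearMap.mkContinuous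
    { toFun := fun a => ⟪ζ, π a ξ⟫_ℂ
      map_add' := fun a b => by rw [map_add, add_apply, inner_add_right]
      map_smul' := fun z a => by
        rw [map_smul, smul_apply, inner_smul_right]; rfl } 1 fun a => by
    calc ‖⟪ζ, π a ξ⟫_ℂ‖ ≤ ‖ζ‖ * ‖π a ξ‖ := norm_inner_le_norm _ _
      _ ≤ 1 * (‖π a‖ * ‖ξ‖) := by gcongr; exact (π a).le_opNorm ξ
      _ = 1 * ‖π a‖ := by rw [hξ, mul_one]
      _ ≤ 1 * ‖a‖ := by gcongr; exact NonUnitalStarAlgHom.norm_apply_le π a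
  refine ⟨ψ, ⟨H, _, _, _, π, ζ, ξ, hζ, hξ.le, fun a => rfl⟩, ?_⟩
  change ⟪ζ, π c ξ⟫_ℂ = _
  rw [inner_smul_left, inner_self_eq_norm_sq_to_K, h3, Complex.conj_ofReal]
  simp only [Complex.coe_algebraMap]
  rw [← Complex.ofReal_pow, ← Complex.ofReal_mul, sq, ← mul_assoc, inv_mul_cancel₀ hcn, one_mul]

/-! ### Slice maps and product states on the minimal tensor product -/

namespace MinTensor

/-- The product of two functionals, on the algebraic tensor product. -/
def prodAlg (φ : A →L[ℂ] ℂ) (ψ : B →L[ℂ] ℂ) : A ⊗[ℂ] B →ₗ[ℂ] ℂ :=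
  LinearMap.mul' ℂ ℂ ∘ₗ TensorProduct.map φ.toLinearMap ψ.toLinearMap

/-- Inner products on H ⊗ K factor on elementary tensors, so a product of two matrix coefficients is
a matrix coefficient of π ⊗ σ. -/
theorem prodAlg_eq_inner {H K : Type u} [NormedAddCommGroup H] [InnerProductSpace ℂ H]
    [CompleteSpace H] [NormedAddCommGroup K] [InnerProductSpace ℂ K] [CompleteSpace K]
    {φ : A →L[ℂ] ℂ} {ψ : B →L[ℂ] ℂ} {π : A →⋆ₐ[ℂ] (H →L[ℂ] H)} {σ : B →⋆ₐ[ℂ] (K →L[ℂ] K)}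
    {ζ ξ : H} {ζ' ξ' : K} (h : ∀ a, φ a = ⟪ζ, π a ξ⟫_ℂ) (h' : ∀ b, ψ b = ⟪ζ', σ b ξ'⟫_ℂ)
    (x : A ⊗[ℂ] B) : prodAlg φ ψ x = ⟪ζ ⊗ₜ[ℂ] ζ', rep π σ x (ξ ⊗ₜ[ℂ] ξ')⟫_ℂ := by
  induction x with
  | zero => simp
  | add x y hx hy => rw [map_add, hx, hy, map_add, add_apply, inner_add_right]
  | tmul a b =>
    rw [rep_tmul, TensorProduct.mapL_tmul, TensorProduct.inner_tmul, ← h, ← h']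
    simp [prodAlg]

/-- The functional is a coefficient of π ⊗ σ between vectors of norm at most 1, and ‖(π ⊗ σ)(x)‖ is
one of the terms in the supremum that defines the minimal norm. -/
theorem norm_prodAlg_le {φ : A →L[ℂ] ℂ} {ψ : B →L[ℂ] ℂ} (hφ : IsVectorFunctional φ)
    (hψ : IsVectorFunctional ψ) (x : A ⊗[ℂ] B) :
    ‖prodAlg φ ψ x‖ ≤ (seminorm A B).toFun x := by
  obtain ⟨H, _, _, _, π, ζ, ξ, hζ, hξ, h⟩ := hφ
  obtain ⟨K, _, _, _, σ, ζ', ξ', hζ', hξ', h'⟩ := hψ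
  rw [prodAlg_eq_inner h h']
  calc _ ≤ ‖ζ ⊗ₜ[ℂ] ζ'‖ * ‖rep π σ x (ξ ⊗ₜ[ℂ] ξ')‖ := norm_inner_le_norm _ _
    _ ≤ ‖ζ ⊗ₜ[ℂ] ζ'‖ * (‖rep π σ x‖ * ‖ξ ⊗ₜ[ℂ] ξ'‖) := by
      gcongr
      exact ContinuousLinearMap.le_opNorm _ _
    _ ≤ 1 * (‖rep π σ x‖ * 1) := by
      rw [TensorProduct.norm_tmul, TensorProduct.norm_tmul]
      gcongr
      · exact mul_le_one₀ hζ (norm_nonneg _) hζ'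
      · exact mul_le_one₀ hξ (norm_nonneg _) hξ'
    _ = ‖rep π σ x‖ := by ring
    _ ≤ _ := CStarSeminorm.le_sup (S := repSeminorms A B) repSeminorms_bounded
      ⟨H, K, _, _, _, _, _, _, π, σ, rfl⟩ x

theorem denseRange_ofTensor : DenseRange (ofTensor A B) := (seminorm A B).denseRange_of

theorem norm_ofTensor (x : A ⊗[ℂ] B) : ‖ofTensor A B x‖ = (seminorm A B).toFun x :=
  (seminorm A B).norm_of x

/-- The slice map `id ⊗ ψ`, on the algebraic tensor product. -/
def sliceRightAlg (ψ : B →L[ℂ] ℂ) : A ⊗[ℂ] B →ₗ[ℂ] A :=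
  TensorProduct.lift ((LinearMap.lsmul ℂ A).flip.compl₂ ψ.toLinearMap)

/-- The slice map `φ ⊗ id`, on the algebraic tensor product. -/
def sliceLeftAlg (φ : A →L[ℂ] ℂ) : A ⊗[ℂ] B →ₗ[ℂ] B :=
  TensorProduct.lift ((LinearMap.lsmul ℂ B) ∘ₗ φ.toLinearMap)

theorem apply_sliceRightAlg (φ : A →L[ℂ] ℂ) (ψ : B →L[ℂ] ℂ) (x : A ⊗[ℂ] B) :
    φ (sliceRightAlg ψ x) = prodAlg φ ψ x := by
  induction x with
  | zero => simp
  | add x y hx hy => rw [map_add, map_add, map_add, hx, hy]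
  | tmul a b => simp [sliceRightAlg, prodAlg, mul_comm]

theorem apply_sliceLeftAlg (φ : A →L[ℂ] ℂ) (ψ : B →L[ℂ] ℂ) (x : A ⊗[ℂ] B) :
    ψ (sliceLeftAlg φ x) = prodAlg φ ψ x := by
  induction x with
  | zero => simp
  | add x y hx hy => rw [map_add, map_add, map_add, hx, hy]
  | tmul a b => simp [sliceLeftAlg, prodAlg]

/-- The norm of the slice is attained on a vector functional φ, and φ composed with the slice is φ ⊗
ψ, which is contractive. This bound is what lets slices extend to the completion. -/
theorem norm_sliceRightAlg_le {ψ : B →L[ℂ] ℂ} (hψ : IsVectorFunctional ψ) (x : A ⊗[ℂ] B) :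
    ‖sliceRightAlg ψ x‖ ≤ 1 * ‖ofTensor A B x‖ := by
  rcases eq_or_ne (sliceRightAlg ψ x) 0 with h0 | h0
  · rw [h0, norm_zero]
    positivity
  obtain ⟨φ, hφ, h⟩ := exists_isVectorFunctional h0
  rw [one_mul, norm_ofTensor, ← norm_norm (sliceRightAlg ψ x), ← Complex.norm_real, ← h,
    apply_sliceRightAlg]
  exact norm_prodAlg_le hφ hψ x

theorem norm_sliceLeftAlg_le {φ : A →L[ℂ] ℂ} (hφ : IsVectorFunctional φ) (x : A ⊗[ℂ] B) :
    ‖sliceLeftAlg φ x‖ ≤ 1 * ‖ofTensor A B x‖ := by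
  rcases eq_or_ne (sliceLeftAlg φ x) 0 with h0 | h0
  · rw [h0, norm_zero]
    positivity
  obtain ⟨ψ, hψ, h⟩ := exists_isVectorFunctional h0
  rw [one_mul, norm_ofTensor, ← norm_norm (sliceLeftAlg φ x), ← Complex.norm_real, ← h,
    apply_sliceLeftAlg]
  exact norm_prodAlg_le hφ hψ x

/-- The slice map `id ⊗ ψ : A ⊗ B → A` of a state `ψ` on `B`. -/
def sliceRight (ψ : B →L[ℂ] ℂ) : MinTensor A B →L[ℂ] A :=
  (sliceRightAlg ψ).extendOfNorm (ofTensor A B).toAlgHom.toLinearMap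

/-- The slice map `φ ⊗ id : A ⊗ B → B` of a state `φ` on `A`. -/
def sliceLeft (φ : A →L[ℂ] ℂ) : MinTensor A B →L[ℂ] B :=
  (sliceLeftAlg φ).extendOfNorm (ofTensor A B).toAlgHom.toLinearMap

/-- `extendOfNorm` is an actual extension only when the norm bound holds; ψ being a state supplies
it, through its GNS vector. -/
theorem sliceRight_tmul {ψ : B →L[ℂ] ℂ} (hψ : IsState ψ) (a : A) (b : B) :
    sliceRight ψ (tmul a b) = ψ b • a := by
  refine (LinearMap.extendOfNorm_eq (e := (ofTensor A B).toAlgHom.toLinearMap)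
    denseRange_ofTensor ⟨1, norm_sliceRightAlg_le hψ.isVectorFunctional⟩ (a ⊗ₜ[ℂ] b)).trans ?_
  simp [sliceRightAlg]

theorem sliceLeft_tmul {φ : A →L[ℂ] ℂ} (hφ : IsState φ) (a : A) (b : B) :
    sliceLeft φ (tmul a b) = φ a • b := by
  refine (LinearMap.extendOfNorm_eq (e := (ofTensor A B).toAlgHom.toLinearMap)
    denseRange_ofTensor ⟨1, norm_sliceLeftAlg_le hφ.isVectorFunctional⟩ (a ⊗ₜ[ℂ] b)).trans ?_
  simp [sliceLeftAlg]

theorem continuous_starAlgHom (f : A →⋆ₐ[ℂ] B) : Continuous f :=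
  AddMonoidHomClass.continuous_of_bound f 1 fun x => by
    simpa using NonUnitalStarAlgHom.norm_apply_le f x

/-- Continuous linear maps on the minimal tensor product are determined by their values on
elementary tensors. -/
theorem clm_ext {E : Type*} [NormedAddCommGroup E] [NormedSpace ℂ E]
    {f g : MinTensor A B →L[ℂ] E} (h : ∀ a b, f (tmul a b) = g (tmul a b)) : f = g := by
  ext x
  induction x using MinTensor.induction
  case hc => exact isClosed_eq f.continuous g.continuous
  case add x y hx hy => rw [map_add, map_add, hx, hy]
  case h a b => exact h a b

/-- The product functional `φ ⊗ ψ` of two states. -/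
def prodState (φ : A →L[ℂ] ℂ) (ψ : B →L[ℂ] ℂ) : MinTensor A B →L[ℂ] ℂ := φ ∘L sliceRight ψ

/-- The Fubini property: the order of slicing is immaterial. It allows either leg to be evaluated
last. -/
theorem prodState_eq_sliceLeft {φ : A →L[ℂ] ℂ} {ψ : B →L[ℂ] ℂ} (hφ : IsState φ) (hψ : IsState ψ) :
    prodState φ ψ = ψ ∘L sliceLeft φ := by
  refine clm_ext fun a b => ?_
  simp [prodState, sliceRight_tmul hψ, sliceLeft_tmul hφ, mul_comm]

theorem prodState_tmul (φ : A →L[ℂ] ℂ) {ψ : B →L[ℂ] ℂ} (hψ : IsState ψ) (a : A) (b : B) :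
    prodState φ ψ (tmul a b) = φ a * ψ b := by
  simp [prodState, sliceRight_tmul hψ, mul_comm]

/-- On algebraic tensors (φ ⊗ ψ)(r*r) is the squared norm of (π ⊗ σ)(r) applied to the tensor of the
GNS vectors; positivity passes to the completion because it is a closed condition. -/
theorem isState_prodState {φ : A →L[ℂ] ℂ} {ψ : B →L[ℂ] ℂ} (hφ : IsState φ) (hψ : IsState ψ) :
    IsState (prodState φ ψ) where
  apply_one := by
    rw [← one_tmul_one, prodState_tmul φ hψ, hφ.apply_one, hψ.apply_one, mul_one]
  nonneg x := by
    obtain ⟨H, _, _, _, π, ξ, -, h⟩ := hφ.exists_rep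
    obtain ⟨K, _, _, _, σ, ξ', -, h'⟩ := hψ.exists_rep
    have hcl : IsClosed {x : MinTensor A B | 0 ≤ prodState φ ψ (star x * x)} :=
      isClosed_le continuous_const (by fun_prop)
    refine (seminorm A B).of_induction x hcl fun r => ?_
    have h1 : ∀ r : A ⊗[ℂ] B, prodState φ ψ (ofTensor A B r) = prodAlg φ ψ r := fun r => by
      rw [← apply_sliceRightAlg, prodState]
      exact congrArg φ (LinearMap.extendOfNorm_eq (e := (ofTensor A B).toAlgHom.toLinearMap)
        denseRange_ofTensor ⟨1, norm_sliceRightAlg_le hψ.isVectorFunctional⟩ r)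
    change 0 ≤ prodState φ ψ (star (ofTensor A B r) * ofTensor A B r)
    rw [← map_star, ← map_mul, h1, prodAlg_eq_inner h h', map_mul, mul_apply_eq_comp]
    have h2 := inner_rep_star π σ (star r) (ξ ⊗ₜ[ℂ] ξ') (rep π σ r (ξ ⊗ₜ[ℂ] ξ'))
    rw [star_star] at h2
    have h3 := inner_self_eq_norm_sq_to_K (𝕜 := ℂ) (E := H ⊗[ℂ] K) (rep π σ r (ξ ⊗ₜ[ℂ] ξ'))
    refine le_of_le_of_eq ?_ (h3.symm.trans h2)
    simp only [Complex.coe_algebraMap]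
    exact_mod_cast sq_nonneg ‖rep π σ r (ξ ⊗ₜ[ℂ] ξ')‖

theorem norm_tmul_le (a : A) (b : B) : ‖tmul a b‖ ≤ ‖a‖ * ‖b‖ := by
  rw [tmul, norm_ofTensor]
  refine CStarSeminorm.sup_le _ _ (by positivity) ?_
  rintro p ⟨H, K, _, _, _, _, _, _, π, σ, rfl⟩
  exact norm_rep_tmul_le π σ a b

/-- Slicing commutes with homomorphisms on the other leg. -/
theorem sliceRight_map {A' : Type u} [CStarAlgebra A'] (f : A →⋆ₐ[ℂ] A') {ψ : B →L[ℂ] ℂ}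
    (hψ : IsState ψ) (x : MinTensor A B) :
    sliceRight ψ (map f (StarAlgHom.id ℂ B) x) = f (sliceRight ψ x) := by
  have h1 := continuous_starAlgHom f
  have h2 := continuous_starAlgHom (map f (StarAlgHom.id ℂ B))
  induction x using MinTensor.induction
  case hc => exact isClosed_eq (by fun_prop) (by fun_prop)
  case add x y hx hy => rw [map_add, map_add, map_add, map_add, hx, hy]
  case h a b =>
    rw [map_tmul, sliceRight_tmul hψ, sliceRight_tmul hψ, map_smul]
    rfl

theorem sliceRight_map_right {B' : Type u} [CStarAlgebra B'] (g : B →⋆ₐ[ℂ] B')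
    {ψ : B' →L[ℂ] ℂ} (hψ : IsState ψ) {ψ' : B →L[ℂ] ℂ} (hψ' : IsState ψ')
    (h : ∀ b, ψ (g b) = ψ' b) (x : MinTensor A B) :
    sliceRight ψ (map (StarAlgHom.id ℂ A) g x) = sliceRight ψ' x := by
  have h2 := continuous_starAlgHom (map (StarAlgHom.id ℂ A) g)
  induction x using MinTensor.induction
  case hc => exact isClosed_eq (by fun_prop) (by fun_prop)
  case add x y hx hy => rw [map_add, map_add, map_add, hx, hy]
  case h a b =>
    rw [map_tmul, sliceRight_tmul hψ, sliceRight_tmul hψ', ← h]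
    rfl

/-- Iterated slices of corresponding elements agree. -/
theorem sliceRight_sliceRight {C : Type u} [CStarAlgebra C] {φ : B →L[ℂ] ℂ} {ψ : C →L[ℂ] ℂ}
    (hφ : IsState φ) (hψ : IsState ψ) {x : MinTensor (MinTensor A B) C}
    {y : MinTensor A (MinTensor B C)} (h : AssocEq x y) :
    sliceRight φ (sliceRight ψ x) = sliceRight (prodState φ ψ) y := by
  have hcl : IsClosed {p : MinTensor (MinTensor A B) C × MinTensor A (MinTensor B C) |
      sliceRight φ (sliceRight ψ p.1) = sliceRight (prodState φ ψ) p.2} :=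
    isClosed_eq (by fun_prop) (by fun_prop)
  -- The associator is a closure of its algebraic graph, so an identity between continuous maps is
  -- checked on algebraic tensors, hence on elementary ones.
  refine closure_minimal ?_ hcl h
  rintro _ ⟨z, rfl⟩
  simp only [Set.mem_ofPred_eq]
  induction z with
  | zero => simp
  | add x y hx hy => simp only [map_add, hx, hy]
  | tmul z c =>
    induction z with
    | zero => simp
    | add x y hx hy => simp only [TensorProduct.add_tmul, map_add, hx, hy]
    | tmul a b =>
      have h1 : ofTensorLeft A B C ((a ⊗ₜ[ℂ] b) ⊗ₜ[ℂ] c) = tmul (tmul a b) c := rfl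
      have h2 : ofTensorRight A B C (TensorProduct.assoc ℂ A B C ((a ⊗ₜ[ℂ] b) ⊗ₜ[ℂ] c)) =
        tmul a (tmul b c) := rfl
      rw [h1, h2, sliceRight_tmul hψ, sliceRight_tmul (isState_prodState hφ hψ), map_smul,
        sliceRight_tmul hφ, prodState_tmul φ hψ, smul_smul, mul_comm]

/-- Slicing the second leg is linear over left multiplication by the first; this converts identities
in A ⊗ B into identities h(c·) = h(c·) in A. -/
theorem sliceRight_tmul_mul {ψ : B →L[ℂ] ℂ} (hψ : IsState ψ) (c : A) (x : MinTensor A B) :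
    sliceRight ψ (tmul c 1 * x) = c * sliceRight ψ x := by
  induction x using MinTensor.induction
  case hc => exact isClosed_eq (by fun_prop) (by fun_prop)
  case add x y hx hy => rw [mul_add, map_add, map_add, mul_add, hx, hy]
  case h a b =>
    rw [tmul_mul_tmul, sliceRight_tmul hψ, sliceRight_tmul hψ, one_mul, mul_smul_comm]

end MinTensor

/-! ### The Haar state of a compact quantum group -/

section Haar

open Filter Topology

variable {A : Type u} [CStarAlgebra A]

/-- Compactness of the state space: every family of states converges along every ultrafilter. -/
theorem exists_isState_tendsto {ι : Type*} (U : Ultrafilter ι) {φ : ι → A →L[ℂ] ℂ}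
    (hφ : ∀ i, IsState (φ i)) :
    ∃ h : A →L[ℂ] ℂ, IsState h ∧ ∀ a, Tendsto (fun i => φ i a) U (𝓝 (h a)) := by
  -- The values at a stay in the compact disc of radius ‖a‖, so an ultrafilter makes them converge.
  -- Linearity and positivity survive by uniqueness of limits and closedness.
  have hlim : ∀ a, ∃ z, ‖z‖ ≤ ‖a‖ ∧ Tendsto (fun i => φ i a) U (𝓝 z) := fun a => by
    obtain ⟨z, hz, hle⟩ := (isCompact_closedBall (0 : ℂ) ‖a‖).ultrafilter_le_nhds
      (U.map fun i => φ i a) (by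
        rw [le_principal_iff]
        exact mem_map.mpr (Eventually.of_forall fun i => by
          simpa using (hφ i).norm_apply_le a))
    exact ⟨z, by simpa using hz, hle⟩
  choose f hf hft using hlim
  let h : A →L[ℂ] ℂ := LinearMap.mkContinuous
    { toFun := f
      map_add' := fun a b => tendsto_nhds_unique (hft (a + b))
        (((hft a).add (hft b)).congr fun i => (map_add (φ i) a b).symm)
      map_smul' := fun c a => tendsto_nhds_unique (hft (c • a))
        (((hft a).const_mul c).congr fun i => (map_smul (φ i) c a).symm) } 1 fun a => by
    rw [one_mul]
    exact hf a
  refine ⟨h, ⟨?_, fun a => ?_⟩, hft⟩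
  · exact tendsto_nhds_unique (hft 1)
      (tendsto_const_nhds.congr fun i => (hφ i).apply_one.symm)
  · exact ge_of_tendsto (hft (star a * a)) (Eventually.of_forall fun i => (hφ i).nonneg a)

/-- Averages of states are states. -/
theorem isState_average {ι : Type*} {s : Finset ι} (hs : s.Nonempty) {φ : ι → A →L[ℂ] ℂ}
    (hφ : ∀ i ∈ s, IsState (φ i)) : IsState ((s.card : ℂ)⁻¹ • ∑ i ∈ s, φ i) where
  apply_one := by
    rw [smul_apply, sum_apply, Finset.sum_congr rfl fun i hi => (hφ i hi).apply_one,
      Finset.sum_const, nsmul_eq_mul, mul_one, smul_eq_mul, inv_mul_cancel₀]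
    exact_mod_cast hs.card_ne_zero
  nonneg a := by
    rw [smul_apply, sum_apply, smul_eq_mul]
    refine mul_nonneg ?_ (Finset.sum_nonneg fun i hi => (hφ i hi).nonneg a)
    rw [← Complex.ofReal_natCast, ← Complex.ofReal_inv, Complex.zero_le_real]
    positivity

/-! ### Convolution of states -/

variable (Δ : A →⋆ₐ[ℂ] MinTensor A A)

/-- The convolution `(φ ⊗ ψ) Δ` of states. -/
def convolution (φ ψ : A →L[ℂ] ℂ) : A →L[ℂ] ℂ :=
  MinTensor.prodState φ ψ ∘L ⟨Δ.toAlgHom.toLinearMap, MinTensor.continuous_starAlgHom Δ⟩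

theorem convolution_apply (φ ψ : A →L[ℂ] ℂ) (a : A) :
    convolution Δ φ ψ a = MinTensor.prodState φ ψ (Δ a) := rfl

theorem IsState.convolution {φ ψ : A →L[ℂ] ℂ} (hφ : IsState φ) (hψ : IsState ψ) :
    IsState (convolution Δ φ ψ) where
  apply_one := by
    rw [convolution_apply, map_one, (MinTensor.isState_prodState hφ hψ).apply_one]
  nonneg a := by
    rw [convolution_apply, map_mul, map_star]
    exact (MinTensor.isState_prodState hφ hψ).nonneg _


/-- For fixed φ and a the convolution is ψ evaluated at one fixed element, so pointwise limits in ψ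
pass through it. -/
theorem convolution_eq_sliceLeft {φ ψ : A →L[ℂ] ℂ} (hφ : IsState φ) (hψ : IsState ψ) (a : A) :
    convolution Δ φ ψ a = ψ (MinTensor.sliceLeft φ (Δ a)) := by
  rw [convolution_apply, MinTensor.prodState_eq_sliceLeft hφ hψ]
  rfl

variable {Δ}

/-- Coassociativity in operator form: the operators R_ψ = (id ⊗ ψ)Δ on A satisfy R_φ R_ψ = R_{φ*ψ},
since both sides slice (Δ ⊗ id)Δ = (id ⊗ Δ)Δ by φ ⊗ ψ in the last two legs. -/
theorem sliceRight_comul_sliceRight_comul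
    (hΔ : ∀ a, AssocEq (MinTensor.map Δ (StarAlgHom.id ℂ A) (Δ a))
      (MinTensor.map (StarAlgHom.id ℂ A) Δ (Δ a)))
    {φ ψ : A →L[ℂ] ℂ} (hφ : IsState φ) (hψ : IsState ψ) (a : A) :
    MinTensor.sliceRight φ (Δ (MinTensor.sliceRight ψ (Δ a))) =
      MinTensor.sliceRight (convolution Δ φ ψ) (Δ a) := by
  rw [← MinTensor.sliceRight_map Δ hψ, MinTensor.sliceRight_sliceRight hφ hψ (hΔ a)]
  exact MinTensor.sliceRight_map_right Δ (MinTensor.isState_prodState hφ hψ)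
    (hφ.convolution Δ hψ) (fun _ => rfl) _

theorem convolution_assoc
    (hΔ : ∀ a, AssocEq (MinTensor.map Δ (StarAlgHom.id ℂ A) (Δ a))
      (MinTensor.map (StarAlgHom.id ℂ A) Δ (Δ a)))
    (φ : A →L[ℂ] ℂ) {ψ χ : A →L[ℂ] ℂ} (hψ : IsState ψ) (hχ : IsState χ) :
    convolution Δ (convolution Δ φ ψ) χ = convolution Δ φ (convolution Δ ψ χ) := by
  ext a
  exact congrArg φ (sliceRight_comul_sliceRight_comul hΔ hψ hχ a)

/-- Every state `ω` admits a state `h` with `ω * h = h * ω = h`, a limit of averages of convolution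
powers of `ω`. -/
theorem exists_isState_convolution_eq
    (hΔ : ∀ a, AssocEq (MinTensor.map Δ (StarAlgHom.id ℂ A) (Δ a))
      (MinTensor.map (StarAlgHom.id ℂ A) Δ (Δ a)))
    {ω : A →L[ℂ] ℂ} (hω : IsState ω) :
    ∃ h, IsState h ∧ convolution Δ ω h = h ∧ convolution Δ h ω = h := by
  -- `p n` is the convolution power of exponent n + 1, starting with ω itself, so no counit is
  -- needed.
  let p : ℕ → A →L[ℂ] ℂ := fun n => (fun φ => convolution Δ φ ω)^[n] ω
  have hsucc : ∀ n, p (n + 1) = convolution Δ (p n) ω := fun n =>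
    Function.iterate_succ_apply' _ _ _
  have hp : ∀ n, IsState (p n) := fun n => by
    induction n with
    | zero => exact hω
    | succ n ih => rw [hsucc]; exact ih.convolution Δ hω
  have hsucc' : ∀ n, convolution Δ ω (p n) = p (n + 1) := fun n => by
    induction n with
    | zero => exact (hsucc 0).symm
    | succ n ih => rw [hsucc n, ← convolution_assoc hΔ ω (hp n) hω, ih, hsucc (n + 1)]
  -- Cesàro means of the first n + 1 powers. Convolving with ω shifts the index by one and so
  -- changes the mean only by the telescoped boundary term below, of norm at most 2‖a‖/(n + 1) at a.
  let q : ℕ → A →L[ℂ] ℂ := fun n =>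
    ((Finset.range (n + 1)).card : ℂ)⁻¹ • ∑ i ∈ Finset.range (n + 1), p i
  have hq : ∀ n, IsState (q n) := fun n => isState_average (by simp) fun i _ => hp i
  obtain ⟨h, hh, hlim⟩ := exists_isState_tendsto (hyperfilter ℕ) hq
  have hzero : ∀ a, Tendsto (fun n : ℕ => ((n : ℂ) + 1)⁻¹ * (p (n + 1) a - p 0 a))
      (hyperfilter ℕ) (𝓝 0) := fun a => by
    refine Tendsto.mono_left ?_ (Nat.hyperfilter_le_atTop)
    have h1 : Tendsto (fun n : ℕ => ((n : ℝ) + 1)⁻¹ * (2 * ‖a‖)) atTop (𝓝 0) := by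
      have := (tendsto_one_div_add_atTop_nhds_zero_nat (𝕜 := ℝ)).mul_const (2 * ‖a‖)
      simpa using this
    refine squeeze_zero_norm (fun n => ?_) h1
    rw [norm_mul, norm_inv]
    have h2 : ‖(n : ℂ) + 1‖ = (n : ℝ) + 1 := by
      have : (n : ℂ) + 1 = ((n + 1 : ℕ) : ℂ) := by push_cast; rfl
      rw [this, Complex.norm_natCast]
      push_cast
      rfl
    rw [h2]
    gcongr
    calc _ ≤ ‖p (n + 1) a‖ + ‖p 0 a‖ := norm_sub_le _ _
      _ ≤ ‖a‖ + ‖a‖ := add_le_add ((hp _).norm_apply_le a) ((hp _).norm_apply_le a)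
      _ = _ := by ring
  have hq_apply : ∀ (n : ℕ) a, q n a = ((n : ℂ) + 1)⁻¹ * ∑ i ∈ Finset.range (n + 1), p i a :=
    fun n a => by
      simp only [q, smul_apply, sum_apply, Finset.card_range, smul_eq_mul]
      push_cast
      rfl
  have htel : ∀ (n : ℕ) a, ((n : ℂ) + 1)⁻¹ * (p (n + 1) a - p 0 a) =
      ((n : ℂ) + 1)⁻¹ * ∑ i ∈ Finset.range (n + 1), p (i + 1) a - q n a := fun n a => by
    rw [hq_apply, ← mul_sub, ← Finset.sum_sub_distrib, Finset.sum_range_sub (fun i => p i a)]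
  refine ⟨h, hh, ?_, ?_⟩
  · ext a
    -- Convolution on the left is evaluated through the left slice, so that the limiting state is
    -- applied to a fixed element; on the right the definition already has this form.
    rw [convolution_eq_sliceLeft Δ hω hh]
    refine tendsto_nhds_unique (hlim _) ?_
    have h1 := (hzero a).add (hlim a)
    rw [zero_add] at h1
    refine h1.congr fun n => ?_
    rw [htel, sub_add_cancel, hq_apply]
    simp only [← hsucc', convolution_eq_sliceLeft Δ hω (hp _)]
  · ext a
    refine tendsto_nhds_unique (hlim (MinTensor.sliceRight ω (Δ a))) ?_
    have h1 := (hzero a).add (hlim a)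
    rw [zero_add] at h1
    refine h1.congr fun n => ?_
    rw [htel, sub_add_cancel, hq_apply]
    simp only [hsucc]
    rfl

/-- Checked on elementary tensors, which determine a continuous functional. Here the average and its
members are states, so the product formula applies to each. -/
theorem prodState_average {ι : Type*} {s : Finset ι} (hs : s.Nonempty) (φ : A →L[ℂ] ℂ)
    {ψ : ι → A →L[ℂ] ℂ} (hψ : ∀ i ∈ s, IsState (ψ i)) :
    MinTensor.prodState φ ((s.card : ℂ)⁻¹ • ∑ i ∈ s, ψ i) =
      (s.card : ℂ)⁻¹ • ∑ i ∈ s, MinTensor.prodState φ (ψ i) := by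
  refine MinTensor.clm_ext fun a b => ?_
  rw [MinTensor.prodState_tmul φ (isState_average hs hψ), smul_apply, sum_apply, smul_apply,
    sum_apply, Finset.sum_congr rfl fun i hi => MinTensor.prodState_tmul φ (hψ i hi) a b,
    ← Finset.mul_sum, smul_eq_mul, smul_eq_mul]
  ring

/-- If `h` is invariant under an average of states, then it is invariant under each of them. -/
theorem convolution_eq_of_average (hG : IsCompactQuantumGroup Δ) {ι : Type*} {s : Finset ι}
    (hs : s.Nonempty) {ρ : ι → A →L[ℂ] ℂ} (hρ : ∀ i ∈ s, IsState (ρ i)) {h : A →L[ℂ] ℂ}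
    (hh : IsState h) (hl : convolution Δ ((s.card : ℂ)⁻¹ • ∑ i ∈ s, ρ i) h = h)
    (hr : convolution Δ h ((s.card : ℂ)⁻¹ • ∑ i ∈ s, ρ i) = h) {i : ι} (hi : i ∈ s) :
    convolution Δ (ρ i) h = h := by
  set ω := (s.card : ℂ)⁻¹ • ∑ i ∈ s, ρ i with hω_def
  have hω : IsState ω := isState_average hs hρ
  have hi' := hρ i hi
  have hP := MinTensor.isState_prodState hh hω
  -- Write R_χ = (id ⊗ χ)Δ and b = R_h(a). Then R_ω(b) = b, because ω * h = h. The aim is h(c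
  -- R_{ρ_i}(b)) = h(c b), where R_{ρ_i}(b) = R_{ρ_i * h}(a).
  have key : ∀ a c, MinTensor.prodState h (convolution Δ (ρ i) h) (MinTensor.tmul c 1 * Δ a) =
      MinTensor.prodState h h (MinTensor.tmul c 1 * Δ a) := fun a c => by
    set b := MinTensor.sliceRight h (Δ a) with hb
    set D := Δ b - MinTensor.tmul b 1 with hD
    have hbω : MinTensor.sliceRight ω (Δ b) = b := by
      rw [hb, sliceRight_comul_sliceRight_comul hG.coassoc hω hh, hl]
    have e1 : MinTensor.prodState h ω (Δ (star b * b)) = h (star b * b) := by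
      rw [← convolution_apply, hr]
    have e2 : MinTensor.prodState h ω (MinTensor.tmul (star b) 1 * Δ b) = h (star b * b) := by
      rw [MinTensor.prodState, ContinuousLinearMap.comp_apply,
        MinTensor.sliceRight_tmul_mul hω, hbω]
    have e3 : MinTensor.prodState h ω (Δ (star b) * MinTensor.tmul b 1) = h (star b * b) := by
      have := hP.apply_star (MinTensor.tmul (star b) 1 * Δ b)
      rw [e2, star_mul, MinTensor.star_tmul, star_star, star_one, ← map_star] at this
      rw [this, ← hh.apply_star, star_mul, star_star]
    have e4 : MinTensor.prodState h ω (MinTensor.tmul (star b) 1 * MinTensor.tmul b 1) =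
        h (star b * b) := by
      rw [MinTensor.tmul_mul_tmul, MinTensor.prodState_tmul h hω, mul_one, hω.apply_one, mul_one]
    -- In the expansion of D*D for D = Δ(b) − b ⊗ 1 all four terms take the same value h(b*b) under
    -- h ⊗ ω: the first by h * ω = h, the mixed ones by R_ω(b) = b. With their signs they cancel.
    have hDω : MinTensor.prodState h ω (star D * D) = 0 := by
      have : star D * D = Δ (star b * b) - Δ (star b) * MinTensor.tmul b 1 -
          MinTensor.tmul (star b) 1 * Δ b + MinTensor.tmul (star b) 1 * MinTensor.tmul b 1 := by
        rw [hD, star_sub, MinTensor.star_tmul, star_one, ← map_star, map_mul]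
        noncomm_ring
      rw [this, map_add, map_sub, map_sub, e1, e2, e3, e4]
      ring
    -- h ⊗ ω is the average of the states h ⊗ ρ_j, each nonnegative at D*D, so a vanishing average
    -- makes every term vanish. Cauchy-Schwarz then gives (h ⊗ ρ_i)((c ⊗ 1)D) = 0.
    have hDρ : MinTensor.prodState h (ρ i) (star D * D) = 0 := by
      rw [hω_def, prodState_average hs h hρ, smul_apply, sum_apply, smul_eq_zero_iff_right,
        Finset.sum_eq_zero_iff_of_nonneg fun j hj =>
          (MinTensor.isState_prodState hh (hρ j hj)).nonneg D] at hDω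
      · exact hDω i hi
      · exact inv_ne_zero (by exact_mod_cast hs.card_ne_zero)
    have h1 := (MinTensor.isState_prodState hh hi').mul_eq_zero hDρ (MinTensor.tmul c 1)
    rw [hD, mul_sub, map_sub, sub_eq_zero, MinTensor.tmul_mul_tmul,
      MinTensor.prodState_tmul h hi', mul_one, hi'.apply_one, mul_one, MinTensor.prodState,
      ContinuousLinearMap.comp_apply, MinTensor.sliceRight_tmul_mul hi', hb,
      sliceRight_comul_sliceRight_comul hG.coassoc hi' hh] at h1
    rw [MinTensor.prodState, ContinuousLinearMap.comp_apply,
      MinTensor.sliceRight_tmul_mul (hi'.convolution Δ hh), h1, MinTensor.prodState,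
      ContinuousLinearMap.comp_apply, MinTensor.sliceRight_tmul_mul hh]
  have hF := MinTensor.isState_prodState hh (hi'.convolution Δ hh)
  have hF' := MinTensor.isState_prodState hh hh
  -- The products (c ⊗ 1)Δ(a) are adjoints of the elements of Δ(A)(A ⊗ 1), which span a dense
  -- subspace; hence the two product states agree everywhere, and evaluation at 1 ⊗ a isolates the
  -- second factor.
  have heq : MinTensor.prodState h (convolution Δ (ρ i) h) = MinTensor.prodState h h := by
    refine ContinuousLinearMap.ext_on hG.dense_left ?_
    rintro _ ⟨a, c, rfl⟩
    have h1 := congrArg star (key (star a) (star c))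
    rw [← hF.apply_star, ← hF'.apply_star, star_mul, MinTensor.star_tmul, star_one, star_star,
      ← map_star, star_star] at h1
    exact h1
  ext a
  have := DFunLike.congr_fun heq (MinTensor.tmul 1 a)
  rwa [MinTensor.prodState_tmul h (hi'.convolution Δ hh), MinTensor.prodState_tmul h hh,
    hh.apply_one, one_mul, one_mul] at this

/-- Existence of a right invariant state, `(ρ ⊗ h) Δ = h` for all states `ρ`. -/
theorem IsCompactQuantumGroup.exists_invariant_state (hG : IsCompactQuantumGroup Δ) :
    ∃ h : A →L[ℂ] ℂ, IsState h ∧ ∀ ρ, IsState ρ → convolution Δ ρ h = h := by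
  classical
  have := hG.nontrivial
  obtain ⟨z, hz⟩ := spectrum.nonempty (1 : A)
  obtain ⟨ω₀, hω₀, -⟩ := exists_isState_of_mem_spectrum hz
  let T := {φ : A →L[ℂ] ℂ // IsState φ}
  have hfin : ∀ s : Finset T, ∃ h : A →L[ℂ] ℂ, IsState h ∧
      ∀ ρ ∈ s, convolution Δ ρ.1 h = h := fun s => by
    -- The auxiliary state `ω₀` keeps the average meaningful when s is empty.
    have hs : (insert (⟨ω₀, hω₀⟩ : T) s).Nonempty := Finset.insert_nonempty _ _
    obtain ⟨h, hh, hl, hr⟩ := exists_isState_convolution_eq hG.coassoc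
      (isState_average hs fun ρ _ => ρ.2)
    exact ⟨h, hh, fun ρ hρ => convolution_eq_of_average hG hs (fun ρ _ => ρ.2) hh hl hr
      (Finset.mem_insert_of_mem hρ)⟩
  choose h hh hinv using hfin
  -- Take an ultrafilter finer than the filter of large finite sets of states. Each fixed ρ
  -- eventually belongs to the set, so invariance under it holds in the limit.
  obtain ⟨k, hk, hlim⟩ := exists_isState_tendsto (Ultrafilter.of atTop) hh
  refine ⟨k, hk, fun ρ hρ => ?_⟩
  ext a
  rw [convolution_eq_sliceLeft Δ hρ hk]
  refine tendsto_nhds_unique (hlim _) ((hlim a).congr' ?_)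
  refine Ultrafilter.of_le atTop ?_
  filter_upwards [eventually_ge_atTop ({⟨ρ, hρ⟩} : Finset T)] with s hs
  rw [← convolution_eq_sliceLeft Δ hρ (hh s)]
  exact (DFunLike.congr_fun (hinv s ⟨ρ, hρ⟩ (hs (Finset.mem_singleton_self _))) a).symm

end Haar

/-! ### Actions of compact quantum groups on finite spaces -/

section FiniteSpace

variable {A : Type u} [CStarAlgebra A] {X : Type u} [Fintype X] [DecidableEq X]
  {Δ : A →⋆ₐ[ℂ] MinTensor A A} {α : (X → ℂ) →ₗ[ℂ] (X → A)}

theorem linearMap_apply_eq_sum {E : Type*} [AddCommGroup E] [Module ℂ E]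
    (T : (X → ℂ) →ₗ[ℂ] (X → E)) (f : X → ℂ) (x : X) :
    T f x = ∑ k, f k • T (Pi.single k 1) x := by
  conv_lhs => rw [← Finset.univ_sum_single f]
  rw [map_sum, Finset.sum_apply]
  refine Finset.sum_congr rfl fun k _ => ?_
  have : (Pi.single k (f k) : X → ℂ) = f k • Pi.single k 1 := by
    rw [← Pi.single_smul, smul_eq_mul, mul_one]
  rw [this, map_smul, Pi.smul_apply]

theorem IsCoassociative.comul_apply (hα : IsCoassociative Δ α) (x k : X) :
    Δ (α (Pi.single k 1) x) =
      ∑ y, MinTensor.tmul (α (Pi.single y 1) x) (α (Pi.single k 1) y) :=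
  (congrFun (hα (Pi.single k 1)) x).symm

namespace IsAction

theorem star_apply_single (hα : IsAction Δ α) (x k : X) :
    star (α (Pi.single k 1) x) = α (Pi.single k 1) x := by
  have h := congrFun (hα.map_star (Pi.single k 1)) x
  have h1 : star (Pi.single k 1 : X → ℂ) = Pi.single k 1 := by
    rw [← Pi.single_star, star_one]
  rw [h1, Pi.star_apply] at h
  exact h.symm

theorem apply_single_mul (hα : IsAction Δ α) (x k l : X) :
    α (Pi.single k 1) x * α (Pi.single l 1) x = if k = l then α (Pi.single k 1) x else 0 := by
  have h := congrFun (hα.map_mul (Pi.single k 1) (Pi.single l 1)) x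
  rw [Pi.mul_apply] at h
  rw [← h]
  split_ifs with hkl
  · subst hkl
    rw [← Pi.single_mul, mul_one]
  · have h1 : (Pi.single k 1 * Pi.single l 1 : X → ℂ) = 0 := by
      funext y
      rw [Pi.mul_apply, Pi.single_apply, Pi.single_apply, Pi.zero_apply]
      split_ifs with e1 e2
      · exact absurd (e1.symm.trans e2) hkl
      all_goals simp
    rw [h1, map_zero, Pi.zero_apply]

/-- This is unitality. Unlike the sum over a column, it needs no invariant state. -/
theorem row_sum (hα : IsAction Δ α) (x : X) : ∑ k, α (Pi.single k 1) x = 1 := by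
  have h := congrFun hα.map_one x
  rw [linearMap_apply_eq_sum] at h
  simpa using h

/-- The Gram matrix of the rows with respect to the Haar state is intertwined by the action. -/
theorem gram_mul (hα : IsAction Δ α) {h : A →L[ℂ] ℂ} (hh : IsState h)
    (hinv : ∀ ρ, IsState ρ → convolution Δ ρ h = h) (l l' p p' : X) :
    (h (∑ k, α (Pi.single k 1) p * α (Pi.single k 1) p') -
      h (∑ k, α (Pi.single k 1) l * α (Pi.single k 1) l')) •
      (α (Pi.single p 1) l * α (Pi.single p' 1) l') = 0 := by
  set v : X → X → A := fun x k => α (Pi.single k 1) x with hv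
  have horth : ∀ x k k', v x k * v x k' = if k = k' then v x k else 0 := hα.apply_single_mul
  -- With g(q,q') = h(∑_k v_{qk} v_{q'k}), this is (id ⊗ h)Δ = h(·)1 applied to ∑_k v_{lk} v_{l'k}.
  -- It is tested against all states, since invariance is only available after pairing with states.
  have hint : ∑ q, ∑ q', h (∑ k, v q k * v q' k) • (v l q * v l' q') =
      h (∑ k, v l k * v l' k) • (1 : A) := by
    refine ext_of_forall_isState fun ρ hρ => ?_
    have e1 := DFunLike.congr_fun (hinv ρ hρ) (∑ k, v l k * v l' k)
    rw [map_smul, hρ.apply_one, smul_eq_mul, mul_one, ← e1, convolution_apply]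
    have e2 : Δ (∑ k, v l k * v l' k) =
        ∑ q, ∑ q', MinTensor.tmul (v l q * v l' q') (∑ k, v q k * v q' k) := by
      rw [map_sum]
      have e3 : ∀ k, Δ (v l k * v l' k) =
          ∑ q, ∑ q', MinTensor.tmul (v l q * v l' q') (v q k * v q' k) := fun k => by
        rw [_root_.map_mul]; simp only [hv]; rw [hα.coassoc.comul_apply, hα.coassoc.comul_apply, Finset.sum_mul_sum]
        simp only [MinTensor.tmul_mul_tmul]
      simp only [e3, MinTensor.tmul_sum]
      rw [Finset.sum_comm]
      exact Finset.sum_congr rfl fun q _ => Finset.sum_comm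
    rw [e2]
    rw [map_sum, map_sum]
    refine Finset.sum_congr rfl fun q _ => ?_
    rw [map_sum, map_sum]
    refine Finset.sum_congr rfl fun q' _ => ?_
    rw [MinTensor.prodState_tmul ρ hh, map_smul, smul_eq_mul, mul_comm]
  -- Multiplying by v_{lp} on the left and v_{l'p'} on the right leaves a single term of the double
  -- sum, by orthogonality within the rows l and l'.
  have h1 := congrArg (fun y => v l p * y * v l' p') hint
  simp only [Finset.mul_sum, Finset.sum_mul, mul_smul_comm, smul_mul_assoc, mul_one] at h1
  have h2 : ∀ q q', v l p * (v l q * v l' q') * v l' p' =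
      if p = q then if q' = p' then v l p * v l' p' else 0 else 0 := fun q q' => by
    rw [← mul_assoc (v l p), mul_assoc _ (v l' q'), horth, horth]
    split_ifs with e1 e2
    · rw [e2]
    · rw [mul_zero]
    · rw [zero_mul]
    · rw [zero_mul]
  simp only [h2, smul_ite, smul_zero, Finset.sum_ite_eq, Finset.sum_ite_eq', Finset.mem_univ,
    if_true, Finset.sum_ite_irrel, Finset.sum_const_zero] at h1
  rw [sub_smul, h1, sub_self]

/-- Distinct rows are not identified by the Haar state, because of the Podleś condition. -/
theorem gram_ne_one (hα : IsAction Δ α) {h : A →L[ℂ] ℂ} (hh : IsState h) {l l' : X}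
    (hl : l ≠ l') : h (∑ k, α (Pi.single k 1) l * α (Pi.single k 1) l') ≠ 1 := by
  intro h1
  set v : X → X → A := fun x k => α (Pi.single k 1) x with hv
  have hself : ∀ x, h (∑ k, v x k * v x k) = 1 := fun x => by
    simp only [hv, hα.apply_single_mul, if_true]
    rw [hα.row_sum, hh.apply_one]
  have h1' : h (∑ k, v l' k * v l k) = 1 := by
    have h2 := hh.apply_star (∑ k, v l k * v l' k)
    rw [h1, star_one, star_sum] at h2
    rw [← h2]
    congr 1
    refine Finset.sum_congr rfl fun k _ => ?_
    rw [star_mul, hα.star_apply_single, hα.star_apply_single]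
  have hstar : ∀ k, star (v l k - v l' k) = v l k - v l' k := fun k => by
    rw [star_sub, hα.star_apply_single, hα.star_apply_single]
  -- The sum of the h-values of (v_{lk} − v_{l'k})² is g(l,l) + g(l',l') − g(l,l') − g(l',l) = 0, so
  -- each difference is a null vector of h.
  have hnull : ∀ k, h (star (v l k - v l' k) * (v l k - v l' k)) = 0 := by
    have hsum : ∑ k, h (star (v l k - v l' k) * (v l k - v l' k)) = 0 := by
      simp only [hstar, mul_sub, sub_mul, map_sub, Finset.sum_sub_distrib]
      simp only [← map_sum]
      rw [hself, hself, h1']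
      simp only [hv] at h1 ⊢
      rw [h1]
      ring
    rw [Finset.sum_eq_zero_iff_of_nonneg fun k _ => hh.nonneg _] at hsum
    exact fun k => hsum k (Finset.mem_univ k)
  -- The functional F ↦ h(F(l) − F(l')). By Cauchy-Schwarz for the null differences it kills every
  -- α(f)(1 ⊗ a), hence everything by the Podleś condition; but its value at δ_l ⊗ 1 is 1.
  let Λ : (X → A) →L[ℂ] ℂ :=
    h ∘L (ContinuousLinearMap.proj (R := ℂ) (φ := fun _ : X => A) l -
      ContinuousLinearMap.proj (R := ℂ) (φ := fun _ : X => A) l')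
  have hΛ : Λ = 0 := by
    refine ContinuousLinearMap.ext_on hα.podles ?_
    rintro _ ⟨f, a, rfl⟩
    change h (α f l * a - α f l' * a) = 0
    rw [← sub_mul, linearMap_apply_eq_sum, linearMap_apply_eq_sum α f l',
      ← Finset.sum_sub_distrib, Finset.sum_mul, map_sum]
    refine Finset.sum_eq_zero fun k _ => ?_
    have h2 := hh.mul_eq_zero' (hnull k) a
    rw [hstar] at h2
    rw [← smul_sub, smul_mul_assoc, map_smul]
    exact (congrArg (f k • ·) h2).trans (smul_zero _)
  have h3 := DFunLike.congr_fun hΛ (Pi.single l 1)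
  change h ((Pi.single l 1 : X → A) l - (Pi.single l 1 : X → A) l') = 0 at h3
  rw [Pi.single_eq_same, Pi.single_eq_of_ne (Ne.symm hl), sub_zero, hh.apply_one] at h3
  exact one_ne_zero h3

/-- The coefficients of an action of a compact quantum group on a finite space form a magic
unitary. -/
theorem isMagicUnitary (hG : IsCompactQuantumGroup Δ) (hα : IsAction Δ α) :
    IsMagicUnitary fun x k => α (Pi.single k 1) x where
  star_eq := hα.star_apply_single
  mul_self x k := by rw [hα.apply_single_mul, if_pos rfl]
  row_sum := hα.row_sum
  col_sum := by
    obtain ⟨h, hh, hinv⟩ := hG.exists_invariant_state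
    -- The Gram relation with p = p' = k: the diagonal entry is 1 and the entry at (l,l') is not, so
    -- the scalar factor of v_{lk} v_{l'k} is nonzero.
    have hcol : ∀ k l l', α (Pi.single k 1) l * α (Pi.single k 1) l' =
        if l = l' then α (Pi.single k 1) l else 0 := fun k l l' => by
      split_ifs with hl
      · rw [← hl, hα.apply_single_mul, if_pos rfl]
      · have h1 := hα.gram_mul hh hinv l l' k k
        refine (smul_eq_zero_iff_right ?_).mp h1
        simp only [hα.apply_single_mul, if_true]
        rw [hα.row_sum, hh.apply_one]
        exact sub_ne_zero.mpr (hα.gram_ne_one hh hl).symm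
    set q : X → A := fun k => ∑ l, α (Pi.single k 1) l with hq
    have hqs : ∀ k, star (1 - q k) = 1 - q k := fun k => by
      simp only [hq, star_sub, star_one, star_sum, hα.star_apply_single]
    have hqq : ∀ k, q k * q k = q k := fun k => by
      simp only [hq, Finset.sum_mul_sum, hcol]
      simp
    have hr : ∀ k, star (1 - q k) * (1 - q k) = 1 - q k := fun k => by
      rw [hqs, mul_sub, mul_one, sub_mul, one_mul, hqq, sub_self, sub_zero]
    -- Column sums are now projections. Summed over all columns they equal |X|·1, the sum of the row
    -- sums, so the positive defects 1 − q_k add up to 0 and all vanish.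
    have hsum : ∑ k, star (1 - q k) * (1 - q k) = 0 := by
      rw [Finset.sum_congr rfl fun k _ => hr k]
      simp only [hq]
      rw [Finset.sum_sub_distrib, Finset.sum_comm]
      simp [hα.row_sum]
    let := CStarAlgebra.spectralOrder A
    let := CStarAlgebra.spectralOrderedRing A
    rw [Finset.sum_eq_zero_iff_of_nonneg fun k _ => star_mul_self_nonneg _] at hsum
    intro k
    have h2 := hsum k (Finset.mem_univ k)
    rw [hr, sub_eq_zero] at h2
    exact h2.symm

end IsAction

end FiniteSpace

/-! ### Quantum groups generated by a magic unitary -/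

/-! ### Embeddings of the tensor factors and the associator -/

namespace MinTensor

variable {A B C : Type u} [CStarAlgebra A] [CStarAlgebra B] [CStarAlgebra C]

variable (A B) in
/-- The embedding `a ↦ a ⊗ 1`. -/
def inl : A →ₐ[ℂ] MinTensor A B :=
  (ofTensor A B).toAlgHom.comp Algebra.TensorProduct.includeLeft

variable (A B) in
/-- The embedding `b ↦ 1 ⊗ b`. -/
def inr : B →ₐ[ℂ] MinTensor A B :=
  (ofTensor A B).toAlgHom.comp Algebra.TensorProduct.includeRight

theorem inl_apply (a : A) : inl A B a = tmul a 1 := rfl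

theorem inr_apply (b : B) : inr A B b = tmul 1 b := rfl

theorem continuous_inl : Continuous (inl A B) :=
  AddMonoidHomClass.continuous_of_bound (inl A B) ‖(1 : B)‖ fun a =>
    (norm_tmul_le a 1).trans_eq (mul_comm _ _)

theorem continuous_inr : Continuous (inr A B) :=
  AddMonoidHomClass.continuous_of_bound (inr A B) ‖(1 : A)‖ fun b => norm_tmul_le 1 b

theorem ofTensorLeft_mul (x y : (A ⊗[ℂ] B) ⊗[ℂ] C) :
    ofTensorLeft A B C (x * y) = ofTensorLeft A B C x * ofTensorLeft A B C y :=
  map_mul ((ofTensor (MinTensor A B) C).toAlgHom.comp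
    (Algebra.TensorProduct.map (ofTensor A B).toAlgHom (AlgHom.id ℂ C))) x y

theorem ofTensorRight_mul (x y : A ⊗[ℂ] (B ⊗[ℂ] C)) :
    ofTensorRight A B C (x * y) = ofTensorRight A B C x * ofTensorRight A B C y :=
  map_mul ((ofTensor A (MinTensor B C)).toAlgHom.comp
    (Algebra.TensorProduct.map (AlgHom.id ℂ A) (ofTensor B C).toAlgHom)) x y

end MinTensor

namespace AssocEq

variable {A B C : Type u} [CStarAlgebra A] [CStarAlgebra B] [CStarAlgebra C]
  {x x' : MinTensor (MinTensor A B) C} {y y' : MinTensor A (MinTensor B C)}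

theorem tmul (a : A) (b : B) (c : C) : AssocEq (MinTensor.tmul (MinTensor.tmul a b) c)
    (MinTensor.tmul a (MinTensor.tmul b c)) :=
  subset_closure ⟨(a ⊗ₜ[ℂ] b) ⊗ₜ[ℂ] c, rfl⟩

theorem add (h : AssocEq x y) (h' : AssocEq x' y') : AssocEq (x + x') (y + y') := by
  change (x, y) + (x', y') ∈ closure _
  refine map_mem_closure₂ continuous_add h h' ?_
  rintro _ ⟨a, rfl⟩ _ ⟨b, rfl⟩
  exact ⟨a + b, by simp only [map_add]; rfl⟩

/-- The algebraic associator is multiplicative and multiplication is continuous. Hence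
coassociativity, a relation between elements of two different algebras, can be verified on
generators. -/
theorem mul (h : AssocEq x y) (h' : AssocEq x' y') : AssocEq (x * x') (y * y') := by
  change (x, y) * (x', y') ∈ closure _
  refine map_mem_closure₂ continuous_mul h h' ?_
  rintro _ ⟨a, rfl⟩ _ ⟨b, rfl⟩
  refine ⟨a * b, ?_⟩
  have h1 : TensorProduct.assoc ℂ A B C (a * b) =
      TensorProduct.assoc ℂ A B C a * TensorProduct.assoc ℂ A B C b :=
    map_mul (Algebra.TensorProduct.assoc ℂ ℂ ℂ A B C) a b
  simp only [h1, MinTensor.ofTensorLeft_mul, MinTensor.ofTensorRight_mul]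
  rfl

theorem smul (c : ℂ) (h : AssocEq x y) : AssocEq (c • x) (c • y) := by
  change c • (x, y) ∈ closure _
  refine map_mem_closure (continuous_const_smul c) h ?_
  rintro _ ⟨a, rfl⟩
  exact ⟨c • a, by simp only [map_smul]; rfl⟩

theorem zero : AssocEq (0 : MinTensor (MinTensor A B) C) 0 :=
  subset_closure ⟨0, by simp only [map_zero]⟩

theorem one : AssocEq (1 : MinTensor (MinTensor A B) C) 1 := by
  have := AssocEq.tmul (1 : A) (1 : B) (1 : C)
  rwa [MinTensor.one_tmul_one, MinTensor.one_tmul_one, MinTensor.one_tmul_one,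
    MinTensor.one_tmul_one] at this

theorem sum {ι : Type*} (s : Finset ι) {f : ι → MinTensor (MinTensor A B) C}
    {g : ι → MinTensor A (MinTensor B C)} (h : ∀ i ∈ s, AssocEq (f i) (g i)) :
    AssocEq (∑ i ∈ s, f i) (∑ i ∈ s, g i) := by
  classical
  induction s using Finset.induction_on with
  | empty => exact zero
  | insert i s hi ih =>
    rw [Finset.sum_insert hi, Finset.sum_insert hi]
    exact (h i (Finset.mem_insert_self i s)).add
      (ih fun j hj => h j (Finset.mem_insert_of_mem hj))

end AssocEq

/-! ### Actions and quantum groups from a magic unitary -/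

section Magic

variable {A : Type u} [CStarAlgebra A] {X : Type u} [Fintype X] [DecidableEq X]

/-- The linear map `δ_k ↦ ∑ x, δ_x ⊗ w x k` given by a matrix `w`. -/
def matrixCoaction (w : X → X → A) : (X → ℂ) →ₗ[ℂ] (X → A) where
  toFun f x := ∑ k, f k • w x k
  map_add' f g := by
    funext x
    simp [add_smul, Finset.sum_add_distrib]
  map_smul' c f := by
    funext x
    simp [Finset.smul_sum, mul_smul]

theorem matrixCoaction_apply (w : X → X → A) (f : X → ℂ) (x : X) :
    matrixCoaction w f x = ∑ k, f k • w x k := rfl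

theorem matrixCoaction_single (w : X → X → A) (x k : X) :
    matrixCoaction w (Pi.single k 1) x = w x k := by
  rw [matrixCoaction_apply, Finset.sum_eq_single k]
  · rw [Pi.single_eq_same, one_smul]
  · intro b _ hb
    rw [Pi.single_eq_of_ne hb, zero_smul]
  · simp

variable {w : X → X → A} {Δ : A →⋆ₐ[ℂ] MinTensor A A}

theorem slice_proj (F : X → A) (x : X) : slice (LinearMap.proj x) F = F x := by
  rw [slice, Finset.sum_eq_single x]
  · simp
  · intro y _ hy
    simp [Pi.single_eq_of_ne (Ne.symm hy)]
  · simp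

namespace IsMagicUnitary

theorem col_orthogonal (hw : IsMagicUnitary w) (x y k : X) :
    w x k * w y k = if x = y then w x k else 0 :=
  projections_orthogonal (fun x => hw.star_eq x k) (fun x => hw.mul_self x k) (hw.col_sum k) x y

/-- The action on `C(X)` given by a magic unitary that is a corepresentation. -/
theorem isAction (hw : IsMagicUnitary w)
    (hΔ : ∀ x k, Δ (w x k) = ∑ y, MinTensor.tmul (w x y) (w y k)) :
    IsAction Δ (matrixCoaction w) where
  map_one := by
    funext x
    simp [matrixCoaction_apply, hw.row_sum]
  map_mul f g := by
    funext x
    rw [Pi.mul_apply]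
    simp only [matrixCoaction_apply, Finset.sum_mul_sum, smul_mul_smul_comm, hw.row_orthogonal,
      smul_ite, smul_zero, Finset.sum_ite_eq, Finset.mem_univ, if_true, Pi.mul_apply]
  map_star f := by
    funext x
    rw [Pi.star_apply]
    simp only [matrixCoaction_apply, star_sum, star_smul, hw.star_eq, Pi.star_apply]
  coassoc f := by
    funext x
    simp only [tensorId, matrixCoaction_single]
    simp only [matrixCoaction_apply]
    rw [map_sum]
    have h1 : ∀ k, Δ (f k • w x k) = ∑ y, MinTensor.tmul (w x y) (f k • w y k) := fun k => by
      rw [map_smul, hΔ, Finset.smul_sum]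
      refine Finset.sum_congr rfl fun y _ => ?_
      rw [MinTensor.tmul, MinTensor.tmul, TensorProduct.tmul_smul, map_smul]
    simp only [h1, MinTensor.tmul_sum]
    exact Finset.sum_comm
  podles := by
    have h1 : (Submodule.span ℂ {F : X → A | ∃ (f : X → ℂ) (a : A),
        F = fun x => matrixCoaction w f x * a}) = ⊤ := by
      rw [eq_top_iff]
      rintro F -
      -- Column orthogonality kills the terms with z ≠ x, and the row sum at x removes what remains
      -- of w; so the span is everything even before closure.
      have h2 : F = ∑ z, ∑ k, (fun x => matrixCoaction w (Pi.single k 1) x * (w z k * F z)) := by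
        funext x
        simp only [Finset.sum_apply, matrixCoaction_single, ← mul_assoc, hw.col_orthogonal]
        simp only [← Finset.sum_mul]
        rw [Finset.sum_eq_single x]
        · simp [hw.row_sum]
        · intro z _ hz
          simp [Ne.symm hz]
        · simp
      rw [h2]
      exact Submodule.sum_mem _ fun z _ => Submodule.sum_mem _ fun k _ =>
        Submodule.subset_span ⟨Pi.single k 1, w z k * F z, rfl⟩
    rw [PodlesCondition, h1]
    exact dense_univ

/-- Induction principle for C*-algebras generated by a magic unitary. -/
theorem induction (hw : IsMagicUnitary w)
    (hd : Dense (StarAlgebra.adjoin ℂ {a | ∃ x k, a = w x k} : Set A)) {P : A → Prop}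
    (hc : IsClosed {a | P a}) (gen : ∀ x k, P (w x k)) (scalar : ∀ c, P (algebraMap ℂ A c))
    (add : ∀ a b, P a → P b → P (a + b)) (mul : ∀ a b, P a → P b → P (a * b)) (a : A) : P a := by
  refine hc.closure_subset_iff.mpr ?_ (hd a)
  intro b hb
  have hb' : b ∈ Algebra.adjoin ℂ ({a | ∃ x k, a = w x k} ∪ star {a | ∃ x k, a = w x k}) := hb
  clear hb
  induction hb' using Algebra.adjoin_induction with
  | mem b hb =>
    rcases hb with ⟨x, k, rfl⟩ | hb
    · exact gen x k
    · obtain ⟨x, k, h⟩ := hb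
      rw [star_eq_iff_star_eq, hw.star_eq] at h
      rw [← h]
      exact gen x k
  | algebraMap c => exact scalar c
  | add a b _ _ ha hb => exact add a b ha hb
  | mul a b _ _ ha hb => exact mul a b ha hb

/-- If `ι` and `κ` are commuting homomorphisms and `ι` maps the generators into
`[Δ(A) κ(A)]`, then it maps all of `A` into `[Δ(A) κ(A)]`. -/
theorem mul_mem_closure_span (hw : IsMagicUnitary w)
    (hd : Dense (StarAlgebra.adjoin ℂ {a | ∃ x k, a = w x k} : Set A))
    {M : Type u} [CStarAlgebra M] (Δ : A →⋆ₐ[ℂ] M) {ι κ : A →ₐ[ℂ] M} (hι : Continuous ι)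
    (hcomm : ∀ a b, ι a * κ b = κ b * ι a) (S : Submodule ℂ M)
    (hS : S = Submodule.span ℂ {x | ∃ a b, x = Δ a * κ b})
    (gen : ∀ x k, ι (w x k) ∈ S) (a b : A) : ι a * κ b ∈ S.topologicalClosure := by
  have hmem : ∀ a b, Δ a * κ b ∈ S := fun a b => hS ▸ Submodule.subset_span ⟨a, b, rfl⟩
  have hright : ∀ x ∈ S.topologicalClosure, ∀ b, x * κ b ∈ S.topologicalClosure := by
    intro x hx b
    refine map_mem_closure (f := (· * κ b)) (continuous_mul_const (κ b)) hx fun y hy => ?_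
    change y * κ b ∈ S
    rw [hS] at hy
    induction hy using Submodule.span_induction with
    | mem y hy =>
      obtain ⟨c, d, rfl⟩ := hy
      rw [mul_assoc, ← map_mul]
      exact hmem _ _
    | zero => rw [zero_mul]; exact S.zero_mem
    | add y z _ _ hy hz => rw [add_mul]; exact S.add_mem hy hz
    | smul c y _ hy => rw [smul_mul_assoc]; exact S.smul_mem c hy
  have hleft : ∀ x ∈ S.topologicalClosure, ∀ a, Δ a * x ∈ S.topologicalClosure := by
    intro x hx a
    refine map_mem_closure (continuous_const_mul (Δ a)) hx fun y hy => ?_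
    change Δ a * y ∈ S
    rw [hS] at hy
    induction hy using Submodule.span_induction with
    | mem y hy =>
      obtain ⟨c, d, rfl⟩ := hy
      rw [← mul_assoc, ← map_mul]
      exact hmem _ _
    | zero => rw [mul_zero]; exact S.zero_mem
    | add y z _ _ hy hz => rw [mul_add]; exact S.add_mem hy hz
    | smul c y _ hy => rw [mul_smul_comm]; exact S.smul_mem c hy
  suffices h : ∀ a, ι a ∈ S.topologicalClosure from hright _ (h a) b
  refine hw.induction hd ?_ (fun x k => S.le_topologicalClosure (gen x k)) (fun c => ?_)
    (fun a b ha hb => ?_) (fun a b ha hb => ?_)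
  · exact S.isClosed_topologicalClosure.preimage hι
  · refine S.le_topologicalClosure ?_
    -- A scalar c is Δ(c)κ(1).
    have := hmem (algebraMap ℂ A c) 1
    rwa [AlgHomClass.commutes, map_one, mul_one, ← AlgHomClass.commutes ι] at this
  · rw [map_add]
    exact Submodule.add_mem _ ha hb
  · rw [map_mul]
    -- Approximate ι(a) by sums of Δ(c)κ(d). Since κ(d) commutes with ι(b), each term times ι(b) is
    -- Δ(c)(ι(b)κ(d)), and the closure is stable under right multiplication by κ and left
    -- multiplication by Δ.
    have hcl : S.topologicalClosure ≤
        S.topologicalClosure.comap (LinearMap.mulRight ℂ (ι b)) := by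
      refine Submodule.topologicalClosure_minimal _ ?_
        (S.isClosed_topologicalClosure.preimage (continuous_mul_const (ι b)))
      conv_lhs => rw [hS]
      rw [Submodule.span_le]
      rintro _ ⟨c, d, rfl⟩
      change Δ c * κ d * ι b ∈ S.topologicalClosure
      rw [mul_assoc, ← hcomm]
      exact hleft _ (hright _ hb d) c
    exact hcl ha

/-- A C*-algebra generated by the entries of a magic unitary that is a corepresentation is a compact
quantum group. -/
theorem isCompactQuantumGroup [Nontrivial A] (hw : IsMagicUnitary w)
    (hd : Dense (StarAlgebra.adjoin ℂ {a | ∃ x k, a = w x k} : Set A))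
    (hΔ : ∀ x k, Δ (w x k) = ∑ y, MinTensor.tmul (w x y) (w y k)) :
    IsCompactQuantumGroup Δ where
  nontrivial := inferInstance
  coassoc := by
    have h1 := MinTensor.continuous_starAlgHom Δ
    have h2 := MinTensor.continuous_starAlgHom (MinTensor.map Δ (StarAlgHom.id ℂ A))
    have h3 := MinTensor.continuous_starAlgHom (MinTensor.map (StarAlgHom.id ℂ A) Δ)
    refine hw.induction hd ?_ (fun x k => ?_) (fun c => ?_) (fun a b ha hb => ?_)
      (fun a b ha hb => ?_)
    · exact isClosed_closure.preimage ((h2.comp h1).prodMk (h3.comp h1))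
    · have e1 : MinTensor.map Δ (StarAlgHom.id ℂ A) (Δ (w x k)) =
          ∑ y, ∑ z, MinTensor.tmul (MinTensor.tmul (w x z) (w z y)) (w y k) := by
        rw [hΔ, map_sum]
        refine Finset.sum_congr rfl fun y _ => ?_
        rw [MinTensor.map_tmul, hΔ, MinTensor.sum_tmul]
        rfl
      have e2 : MinTensor.map (StarAlgHom.id ℂ A) Δ (Δ (w x k)) =
          ∑ z, ∑ y, MinTensor.tmul (w x z) (MinTensor.tmul (w z y) (w y k)) := by
        rw [hΔ, map_sum]
        refine Finset.sum_congr rfl fun y _ => ?_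
        rw [MinTensor.map_tmul, hΔ, MinTensor.tmul_sum]
        rfl
      rw [e1, e2, Finset.sum_comm]
      exact AssocEq.sum _ fun z _ => AssocEq.sum _ fun y _ => AssocEq.tmul _ _ _
    · rw [Algebra.algebraMap_eq_smul_one, map_smul, map_smul, map_smul, map_one, map_one, map_one]
      exact AssocEq.one.smul c
    · rw [map_add, map_add, map_add]
      exact ha.add hb
    · rw [map_mul, map_mul, map_mul]
      exact ha.mul hb
  dense_right := by
    set S := Submodule.span ℂ {x | ∃ a b, x = Δ a * MinTensor.tmul 1 b} with hS
    have hmem : ∀ a b, Δ a * MinTensor.tmul 1 b ∈ S := fun a b =>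
      Submodule.subset_span ⟨a, b, rfl⟩
    have key := hw.mul_mem_closure_span hd Δ (ι := MinTensor.inl A A) (κ := MinTensor.inr A A)
      MinTensor.continuous_inl (fun a b => by
        rw [MinTensor.inl_apply, MinTensor.inr_apply, MinTensor.tmul_mul_tmul,
          MinTensor.tmul_mul_tmul, mul_one, one_mul, one_mul, mul_one]) S hS fun x y => by
      -- The transpose of w plays the role of the antipode: ∑_k w_{zk} w_{yk} is 1 if z = y and 0
      -- otherwise.
      have : MinTensor.inl A A (w x y) = ∑ k, Δ (w x k) * MinTensor.tmul 1 (w y k) := by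
        simp only [hΔ, Finset.sum_mul, MinTensor.tmul_mul_tmul, mul_one, hw.col_orthogonal]
        rw [Finset.sum_comm, Finset.sum_eq_single y]
        · simp only [if_true, ← MinTensor.tmul_sum, hw.row_sum]
          rfl
        · intro z _ hz
          simp only [if_neg hz, MinTensor.tmul_zero, Finset.sum_const_zero]
        · simp
      rw [this]
      exact Submodule.sum_mem _ fun k _ => hmem _ _
    intro x
    change x ∈ S.topologicalClosure
    induction x using MinTensor.induction
    case hc => exact S.isClosed_topologicalClosure
    case add x y hx hy => exact Submodule.add_mem _ hx hy
    case h a b =>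
      have := key a b
      rwa [MinTensor.inl_apply, MinTensor.inr_apply, MinTensor.tmul_mul_tmul, mul_one,
        one_mul] at this
  dense_left := by
    set S := Submodule.span ℂ {x | ∃ a b, x = Δ a * MinTensor.tmul b 1} with hS
    have hmem : ∀ a b, Δ a * MinTensor.tmul b 1 ∈ S := fun a b =>
      Submodule.subset_span ⟨a, b, rfl⟩
    have key := hw.mul_mem_closure_span hd Δ (ι := MinTensor.inr A A) (κ := MinTensor.inl A A)
      MinTensor.continuous_inr (fun a b => by
        rw [MinTensor.inl_apply, MinTensor.inr_apply, MinTensor.tmul_mul_tmul,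
          MinTensor.tmul_mul_tmul, mul_one, one_mul, one_mul, mul_one]) S hS fun y k => by
      -- Here rows replace columns: ∑_x w_{xz} w_{xy} is 1 if z = y and 0 otherwise.
      have : MinTensor.inr A A (w y k) = ∑ x, Δ (w x k) * MinTensor.tmul (w x y) 1 := by
        simp only [hΔ, Finset.sum_mul, MinTensor.tmul_mul_tmul, mul_one, hw.row_orthogonal]
        rw [Finset.sum_comm, Finset.sum_eq_single y]
        · simp only [if_true, ← MinTensor.sum_tmul, hw.col_sum]
          rfl
        · intro z _ hz
          simp only [if_neg hz, MinTensor.zero_tmul, Finset.sum_const_zero]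
        · simp
      rw [this]
      exact Submodule.sum_mem _ fun k _ => hmem _ _
    intro x
    change x ∈ S.topologicalClosure
    induction x using MinTensor.induction
    case hc => exact S.isClosed_topologicalClosure
    case add x y hx hy => exact Submodule.add_mem _ hx hy
    case h a b =>
      have := key b a
      rwa [MinTensor.inl_apply, MinTensor.inr_apply, MinTensor.tmul_mul_tmul, mul_one,
        one_mul] at this

/-- The action given by a magic unitary is faithful if its entries generate the C*-algebra. -/
theorem isFaithfulAction (hd : Dense (StarAlgebra.adjoin ℂ {a | ∃ x k, a = w x k} : Set A)) :
    IsFaithfulAction (matrixCoaction w) := by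
  refine hd.mono (StarAlgebra.adjoin_mono ?_)
  rintro _ ⟨x, k, rfl⟩
  exact ⟨LinearMap.proj x, Pi.single k 1, by rw [slice_proj, matrixCoaction_single]⟩

end IsMagicUnitary

end Magic

/-! ### The free wreath product as an object of the category -/

/-! ### Induction and extensionality for universal C*-algebras -/

namespace CStarRelations

variable {Y : Type u} [InvolutiveStar Y] (𝓡 : CStarRelations Y)

/-- Induction principle for universal C*-algebras. -/
theorem induction {P : 𝓡.Universal → Prop} (hc : IsClosed {x | P x})
    (gen : ∀ y, P (𝓡.gen y)) (scalar : ∀ c, P (algebraMap ℂ 𝓡.Universal c))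
    (add : ∀ a b, P a → P b → P (a + b)) (mul : ∀ a b, P a → P b → P (a * b))
    (x : 𝓡.Universal) : P x := by
  refine 𝓡.seminorm.of_induction x hc fun r => ?_
  change P (𝓡.of r)
  induction r using FreeStarAlgebra.induction with
  | zero => simpa using scalar 0
  | add x y hx hy => rw [map_add]; exact add _ _ hx hy
  | single w c =>
    have h1 : FreeStarAlgebra.single w c = c • FreeStarAlgebra.single w 1 := by
      rw [FreeStarAlgebra.smul_single, mul_one]
    rw [h1, map_smul, Algebra.smul_def]
    refine mul _ _ (scalar c) ?_
    induction w using FreeMonoid.inductionOn with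
    | one => rw [← FreeStarAlgebra.one_eq, map_one]; simpa using scalar 1
    | of y => exact gen y
    | mul v w hv hw =>
      have h2 : FreeStarAlgebra.single (v * w) (1 : ℂ) =
          FreeStarAlgebra.single v 1 * FreeStarAlgebra.single w 1 := by
        rw [FreeStarAlgebra.single_mul, mul_one]
      rw [h2, map_mul]
      exact mul _ _ (hv (by rw [FreeStarAlgebra.smul_single, mul_one]))
        (hw (by rw [FreeStarAlgebra.smul_single, mul_one]))

/-- Homomorphisms on a universal C*-algebra are determined by their values on the generators. -/
theorem hom_ext {B : Type u} [CStarAlgebra B] {f g : 𝓡.Universal →⋆ₐ[ℂ] B}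
    (h : ∀ y, f (𝓡.gen y) = g (𝓡.gen y)) : f = g := by
  ext x
  refine 𝓡.induction (isClosed_eq (MinTensor.continuous_starAlgHom f)
    (MinTensor.continuous_starAlgHom g)) h (fun c => ?_) (fun a b ha hb => ?_)
    (fun a b ha hb => ?_) x
  · rw [AlgHomClass.commutes, AlgHomClass.commutes]
  · rw [map_add, map_add, ha, hb]
  · rw [map_mul, map_mul, ha, hb]

end CStarRelations

theorem PermAlgebra.induction {K : Type u} [Fintype K] {P : PermAlgebra K → Prop}
    (hc : IsClosed {x | P x}) (u : ∀ i j, P (PermAlgebra.u K i j))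
    (scalar : ∀ c, P (algebraMap ℂ (PermAlgebra K) c))
    (add : ∀ a b, P a → P b → P (a + b)) (mul : ∀ a b, P a → P b → P (a * b))
    (x : PermAlgebra K) : P x :=
  (permRelations K).induction hc (fun ⟨i, j⟩ => u i j) scalar add mul x

theorem PermAlgebra.hom_ext {K : Type u} [Fintype K] {B : Type u} [CStarAlgebra B]
    {f g : PermAlgebra K →⋆ₐ[ℂ] B}
    (h : ∀ i j, f (PermAlgebra.u K i j) = g (PermAlgebra.u K i j)) : f = g :=
  (permRelations K).hom_ext fun ⟨i, j⟩ => h i j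

theorem isMagicUnitary_one {K B : Type u} [Fintype K] [DecidableEq K] [CStarAlgebra B] :
    IsMagicUnitary fun i j : K => if i = j then (1 : B) else 0 where
  star_eq i j := by split_ifs <;> simp
  mul_self i j := by split_ifs <;> simp
  row_sum i := by simp
  col_sum j := by simp

namespace WreathAlgebra

section

variable {A J B : Type u} [CStarAlgebra A] [Fintype J] [CStarAlgebra B]

theorem induction {P : WreathAlgebra A J → Prop} (hc : IsClosed {x | P x})
    (ν : ∀ l a, P (ν A J l a)) (v : ∀ k l, P (v A J k l))
    (scalar : ∀ c, P (algebraMap ℂ (WreathAlgebra A J) c))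
    (add : ∀ a b, P a → P b → P (a + b)) (mul : ∀ a b, P a → P b → P (a * b))
    (x : WreathAlgebra A J) : P x :=
  (wreathRelations A J).induction hc (fun
    | .copy l a => ν l a
    | .perm k l => v k l) scalar add mul x

theorem hom_ext {f g : WreathAlgebra A J →⋆ₐ[ℂ] B} (hν : ∀ l a, f (ν A J l a) = g (ν A J l a))
    (hv : ∀ k l, f (v A J k l) = g (v A J k l)) : f = g :=
  (wreathRelations A J).hom_ext fun
    | .copy l a => hν l a
    | .perm k l => hv k l

end

/-! ### The fundamental magic unitary of the free wreath product -/

variable {I J : Type u} [Fintype I] [Fintype J] [DecidableEq I] [DecidableEq J]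

/-- Homomorphisms on `C(S_n⁺ ≀_* S_m⁺)` are determined by their values on the generators. -/
theorem hom_ext_perm {B : Type u} [CStarAlgebra B]
    {f g : WreathAlgebra (PermAlgebra I) J →⋆ₐ[ℂ] B}
    (hν : ∀ l i j, f (ν (PermAlgebra I) J l (PermAlgebra.u I i j)) =
      g (ν (PermAlgebra I) J l (PermAlgebra.u I i j)))
    (hv : ∀ k l, f (v (PermAlgebra I) J k l) = g (v (PermAlgebra I) J k l)) : f = g :=
  hom_ext (fun l a => DFunLike.congr_fun (PermAlgebra.hom_ext (f := f.comp (ν _ _ l))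
    (g := g.comp (ν _ _ l)) fun i j => hν l i j) a) hv

variable (I J) in
/-- The fundamental magic unitary of `S_n⁺ ≀_* S_m⁺`. -/
def edgeMatrix (x k : J × I) : WreathAlgebra (PermAlgebra I) J :=
  ν (PermAlgebra I) J x.1 (PermAlgebra.u I x.2 k.2) * v (PermAlgebra I) J x.1 k.1

variable (I J) in
/-- The magic unitary of `S_m⁺` in `S_n⁺ ≀_* S_m⁺`, indexed by the vertices. -/
def vertexMatrix (x k : J × PUnit.{u + 1}) : WreathAlgebra (PermAlgebra I) J :=
  v (PermAlgebra I) J x.1 k.1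

/-- The identity matrices satisfy all relations in a commutative algebra, so the counit is a
character. Functions on a point serve as a copy of ℂ in the right universe. -/
instance : Nontrivial (WreathAlgebra (PermAlgebra I) J) := by
  let B : Type u := PUnit.{u + 1} → ℂ
  let ε : PermAlgebra I →⋆ₐ[ℂ] B := (permRelations I).lift
    (fun | .mk i j => if i = j then 1 else 0) isMagicUnitary_one
  let g : WreathGen (PermAlgebra I) J → B
    | .copy _ a => ε a
    | .perm k l => if k = l then 1 else 0
  let f : WreathAlgebra (PermAlgebra I) J →⋆ₐ[ℂ] B := (wreathRelations _ J).lift g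
    { hom := fun _ => ⟨ε, fun _ => rfl⟩
      magic := isMagicUnitary_one
      commute := fun _ _ _ => mul_comm _ _ }
  exact f.toAlgHom.toRingHom.domain_nontrivial

theorem vertexMatrix_isMagicUnitary : IsMagicUnitary (vertexMatrix I J) where
  star_eq x k := (isMagicUnitary (PermAlgebra I) J).star_eq _ _
  mul_self x k := (isMagicUnitary (PermAlgebra I) J).mul_self _ _
  row_sum x := by
    simp [vertexMatrix, Fintype.sum_prod_type, (isMagicUnitary (PermAlgebra I) J).row_sum]
  col_sum k := by
    simp [vertexMatrix, Fintype.sum_prod_type, (isMagicUnitary (PermAlgebra I) J).col_sum]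

theorem ν_magic (l : J) :
    IsMagicUnitary fun i j => ν (PermAlgebra I) J l (PermAlgebra.u I i j) where
  star_eq i j := by rw [← map_star, (PermAlgebra.isMagicUnitary I).star_eq]
  mul_self i j := by rw [← map_mul, (PermAlgebra.isMagicUnitary I).mul_self]
  row_sum i := by rw [← map_sum, (PermAlgebra.isMagicUnitary I).row_sum, map_one]
  col_sum j := by rw [← map_sum, (PermAlgebra.isMagicUnitary I).col_sum, map_one]

/-- Each entry is a product of two commuting projections. The sums are taken in two stages, over the
loop index and then over the copy index. -/
theorem edgeMatrix_isMagicUnitary : IsMagicUnitary (edgeMatrix I J) where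
  star_eq x k := by
    rw [edgeMatrix, star_mul, (isMagicUnitary _ J).star_eq, (ν_magic x.1).star_eq, ν_mul_v]
  mul_self x k := by
    rw [edgeMatrix, mul_assoc, ← mul_assoc (v _ _ _ _), ← ν_mul_v, mul_assoc,
      (isMagicUnitary _ J).mul_self, ← mul_assoc, (ν_magic x.1).mul_self]
  row_sum x := by
    simp only [edgeMatrix, Fintype.sum_prod_type, ← Finset.sum_mul, (ν_magic x.1).row_sum,
      one_mul, (isMagicUnitary _ J).row_sum]
  col_sum k := by
    simp only [edgeMatrix, Fintype.sum_prod_type, ← Finset.sum_mul, (ν_magic _).col_sum,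
      one_mul, (isMagicUnitary _ J).col_sum]

/-- Together with the sum over the target copy below, this recovers the defining generators from the
edge entries; density and uniqueness of morphisms both rest on it. -/
theorem sum_edgeMatrix_col (l k : J) (i : I) :
    ∑ j, edgeMatrix I J (l, j) (k, i) = v (PermAlgebra I) J l k := by
  simp only [edgeMatrix, ← Finset.sum_mul, (ν_magic l).col_sum, one_mul]

theorem sum_edgeMatrix_row (l : J) (j i : I) :
    ∑ k, edgeMatrix I J (l, j) (k, i) = ν (PermAlgebra I) J l (PermAlgebra.u I j i) := by
  simp only [edgeMatrix, ← Finset.mul_sum, (isMagicUnitary _ J).row_sum, mul_one]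

theorem comul_vertexMatrix (x k : J × PUnit.{u + 1}) :
    comul J (permComul I) (vertexMatrix I J x k) =
      ∑ y, MinTensor.tmul (vertexMatrix I J x y) (vertexMatrix I J y k) := by
  simp [vertexMatrix, comul_v, Fintype.sum_prod_type]

/-- In the product of the two comultiplication formulas, row orthogonality of v in the first leg
removes all mixed terms, and what is left is matrix multiplication over pairs. -/
theorem comul_edgeMatrix (x k : J × I) :
    comul J (permComul I) (edgeMatrix I J x k) =
      ∑ y, MinTensor.tmul (edgeMatrix I J x y) (edgeMatrix I J y k) := by
  rw [edgeMatrix, map_mul, comul_ν, comul_v, Finset.sum_mul_sum, Fintype.sum_prod_type]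
  refine Finset.sum_congr rfl fun p _ => ?_
  rw [Finset.sum_eq_single p]
  · rw [permComul_u, map_sum, Finset.sum_mul, Finset.sum_mul]
    refine Finset.sum_congr rfl fun q _ => ?_
    rw [MinTensor.map_tmul, MinTensor.tmul_mul_tmul, MinTensor.tmul_mul_tmul, mul_one, mul_assoc,
      (isMagicUnitary _ J).mul_self]
    rfl
  · intro q _ hq
    rw [mul_assoc, MinTensor.tmul_mul_tmul, (isMagicUnitary _ J).row_orthogonal,
      if_neg (Ne.symm hq), MinTensor.zero_tmul, mul_zero]
  · simp

theorem sum_filter_fst {M : Type*} [AddCommMonoid M] (F : J × I → M) (p : J × PUnit.{u + 1}) :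
    ∑ e with ((DirectedMultigraph.loops I).copies J).r e = p, F e = ∑ j, F (p.1, j) := by
  rw [Finset.sum_filter, Fintype.sum_prod_type, Finset.sum_eq_single p.1]
  · refine Finset.sum_congr rfl fun j _ => if_pos rfl
  · intro l _ hl
    refine Finset.sum_eq_zero fun j _ => if_neg fun h => hl ?_
    exact congrArg Prod.fst h
  · simp

theorem edgeMatrix_mul_vertexMatrix (l k q : J) (j i : I) :
    edgeMatrix I J (l, j) (k, i) * v (PermAlgebra I) J l q =
      if k = q then edgeMatrix I J (l, j) (k, i) else 0 := by
  rw [edgeMatrix, mul_assoc, (isMagicUnitary _ J).row_orthogonal]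
  split_ifs
  · rfl
  · rw [mul_zero]

/-- The wreath commutation relation moves v past ν, after which row orthogonality of v applies. This
side is what equivariance of the left action uses. -/
theorem vertexMatrix_mul_edgeMatrix (l k q : J) (j i : I) :
    v (PermAlgebra I) J l q * edgeMatrix I J (l, j) (k, i) =
      if k = q then edgeMatrix I J (l, j) (k, i) else 0 := by
  rw [edgeMatrix, ← mul_assoc, ← ν_mul_v, mul_assoc, (isMagicUnitary _ J).row_orthogonal]
  split_ifs with h1 h2 h2
  · rw [h1]
  · exact absurd h1.symm h2
  · exact absurd h2.symm h1
  · rw [mul_zero]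

variable [Nonempty I] [Nonempty J]

/-- The generators are sums of edge entries: ν_l(u_{ji}) over the target copies, v_{kl} over the
loops of copy k for any fixed target loop, which exists as `I` is nonempty. -/
theorem dense_adjoin_edgeMatrix :
    Dense (StarAlgebra.adjoin ℂ {a | ∃ x k, a = edgeMatrix I J x k} :
      Set (WreathAlgebra (PermAlgebra I) J)) := by
  set S := StarAlgebra.adjoin ℂ {a | ∃ x k, a = edgeMatrix I J x k} with hS
  have hmem : ∀ x k, edgeMatrix I J x k ∈ S := fun x k =>
    StarAlgebra.subset_adjoin ℂ _ ⟨x, k, rfl⟩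
  intro x
  change x ∈ S.topologicalClosure
  have hcl := S.isClosed_topologicalClosure
  refine induction (P := (· ∈ S.topologicalClosure)) hcl (fun l a => ?_) (fun k l => ?_)
    (fun c => algebraMap_mem _ c) (fun a b ha hb => add_mem ha hb)
    (fun a b ha hb => mul_mem ha hb) x
  · refine PermAlgebra.induction (P := fun a => ν (PermAlgebra I) J l a ∈ S.topologicalClosure)
      (hcl.preimage (MinTensor.continuous_starAlgHom _)) (fun j i => ?_) (fun c => ?_)
      (fun a b ha hb => ?_) (fun a b ha hb => ?_) a
    · refine S.le_topologicalClosure ?_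
      rw [← sum_edgeMatrix_row]
      exact sum_mem fun k _ => hmem _ _
    · rw [AlgHomClass.commutes]
      exact algebraMap_mem _ c
    · rw [map_add]
      exact add_mem ha hb
    · rw [map_mul]
      exact mul_mem ha hb
  · refine S.le_topologicalClosure ?_
    rw [← sum_edgeMatrix_col k l (Classical.arbitrary I)]
    exact sum_mem fun j _ => hmem _ _

variable (I J) in
/-- The free wreath product, with its actions on vertices and edges, is an object. -/
theorem isBicObject : IsBicObject ((DirectedMultigraph.loops I).copies J)
    (comul J (permComul I)) (matrixCoaction (vertexMatrix I J))
    (matrixCoaction (edgeMatrix I J)) where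
  quantumGroup := edgeMatrix_isMagicUnitary.isCompactQuantumGroup dense_adjoin_edgeMatrix
    comul_edgeMatrix
  vertexAction := vertexMatrix_isMagicUnitary.isAction comul_vertexMatrix
  edgeAction := edgeMatrix_isMagicUnitary.isAction comul_edgeMatrix
  faithful := IsMagicUnitary.isFaithfulAction dense_adjoin_edgeMatrix
  correspondence :=
    { coassoc := (edgeMatrix_isMagicUnitary.isAction comul_edgeMatrix).coassoc
      podles := (edgeMatrix_isMagicUnitary.isAction comul_edgeMatrix).podles
      map_rightSMul := fun ξ f => by
        funext ⟨l, j⟩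
        simp only [matrixCoaction_apply, DirectedMultigraph.rightSMul, Finset.sum_mul_sum,
          smul_mul_smul_comm]
        refine Finset.sum_congr rfl fun ⟨k, i⟩ _ => ?_
        rw [Fintype.sum_prod_type]
        simp [DirectedMultigraph.copies, DirectedMultigraph.loops, vertexMatrix,
          edgeMatrix_mul_vertexMatrix]
      map_leftSMul := fun f ξ => by
        funext ⟨l, j⟩
        simp only [matrixCoaction_apply, DirectedMultigraph.leftSMul, Finset.sum_mul_sum,
          smul_mul_smul_comm]
        rw [Finset.sum_comm]
        refine Finset.sum_congr rfl fun ⟨k, i⟩ _ => ?_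
        rw [Fintype.sum_prod_type]
        simp [DirectedMultigraph.copies, DirectedMultigraph.loops, vertexMatrix,
          vertexMatrix_mul_edgeMatrix]
      map_innerProd := fun ξ η => by
        have hact := edgeMatrix_isMagicUnitary.isAction (comul_edgeMatrix (I := I) (J := J))
        funext p
        -- As the edge map is a *-homomorphism, the inner product is it applied to ξ̄η, summed over
        -- the loops at a vertex; the sums over loops in a column then turn edge entries into vertex
        -- entries.
        have h1 : ∀ e, star (matrixCoaction (edgeMatrix I J) ξ e) *
            matrixCoaction (edgeMatrix I J) η e =
            matrixCoaction (edgeMatrix I J) (star ξ * η) e := fun e => by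
          rw [hact.map_mul, hact.map_star, Pi.mul_apply, Pi.star_apply]
        simp only [DirectedMultigraph.innerProd, h1]
        rw [sum_filter_fst]
        simp only [matrixCoaction_apply]
        rw [Finset.sum_comm, Fintype.sum_prod_type, Fintype.sum_prod_type]
        refine Finset.sum_congr rfl fun k _ => ?_
        simp only [← Finset.smul_sum, sum_edgeMatrix_col, vertexMatrix, ← Finset.sum_smul,
          Finset.univ_unique, Finset.sum_singleton, DirectedMultigraph.innerProd]
        rw [sum_filter_fst]
        rfl }

end WreathAlgebra

/-! ### Universality -/

namespace MinTensor

variable {A B A' B' A'' B'' : Type u} [CStarAlgebra A] [CStarAlgebra B] [CStarAlgebra A']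
  [CStarAlgebra B'] [CStarAlgebra A''] [CStarAlgebra B'']

theorem map_comp (f : A →⋆ₐ[ℂ] A') (g : B →⋆ₐ[ℂ] B') (f' : A' →⋆ₐ[ℂ] A'') (g' : B' →⋆ₐ[ℂ] B'') :
    map (f'.comp f) (g'.comp g) = (map f' g').comp (map f g) := by
  ext x
  have h1 := continuous_starAlgHom (map (f'.comp f) (g'.comp g))
  have h2 := continuous_starAlgHom ((map f' g').comp (map f g))
  induction x using MinTensor.induction
  case hc => exact isClosed_eq h1 h2
  case add x y hx hy => rw [map_add, map_add, hx, hy]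
  case h a b =>
    rw [StarAlgHom.comp_apply, map_tmul, map_tmul, map_tmul]
    rfl

theorem map_id : map (StarAlgHom.id ℂ A) (StarAlgHom.id ℂ B) = StarAlgHom.id ℂ _ := by
  ext x
  have h1 := continuous_starAlgHom (map (StarAlgHom.id ℂ A) (StarAlgHom.id ℂ B))
  induction x using MinTensor.induction
  case hc => exact isClosed_eq h1 continuous_id
  case add x y hx hy => rw [map_add, map_add, hx, hy]
  case h a b =>
    rw [map_tmul]
    rfl

end MinTensor

/-! ### Morphisms and uniqueness of universal objects -/

section Morphisms

variable {A₁ A₂ A₃ : Type u} [CStarAlgebra A₁] [CStarAlgebra A₂] [CStarAlgebra A₃]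
  {V E : Type u} [Fintype V] [Fintype E] [DecidableEq V] [DecidableEq E]
  {Δ₁ : A₁ →⋆ₐ[ℂ] MinTensor A₁ A₁} {α₁ : (V → ℂ) →ₗ[ℂ] (V → A₁)} {lam₁ : (E → ℂ) →ₗ[ℂ] (E → A₁)}
  {Δ₂ : A₂ →⋆ₐ[ℂ] MinTensor A₂ A₂} {α₂ : (V → ℂ) →ₗ[ℂ] (V → A₂)} {lam₂ : (E → ℂ) →ₗ[ℂ] (E → A₂)}
  {Δ₃ : A₃ →⋆ₐ[ℂ] MinTensor A₃ A₃} {α₃ : (V → ℂ) →ₗ[ℂ] (V → A₃)} {lam₃ : (E → ℂ) →ₗ[ℂ] (E → A₃)}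

namespace IsBicMorphism

theorem id : IsBicMorphism Δ₁ α₁ lam₁ Δ₁ α₁ lam₁ (StarAlgHom.id ℂ A₁) where
  hopf a := by rw [MinTensor.map_id]; rfl
  vertex _ _ := rfl
  edge _ _ := rfl

theorem comp {f : A₂ →⋆ₐ[ℂ] A₁} {g : A₃ →⋆ₐ[ℂ] A₂}
    (hf : IsBicMorphism Δ₁ α₁ lam₁ Δ₂ α₂ lam₂ f) (hg : IsBicMorphism Δ₂ α₂ lam₂ Δ₃ α₃ lam₃ g) :
    IsBicMorphism Δ₁ α₁ lam₁ Δ₃ α₃ lam₃ (f.comp g) where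
  hopf a := by
    rw [MinTensor.map_comp, StarAlgHom.comp_apply, hg.hopf, hf.hopf, StarAlgHom.comp_apply]
  vertex h v := by rw [StarAlgHom.comp_apply, hg.vertex, hf.vertex]
  edge ξ e := by rw [StarAlgHom.comp_apply, hg.edge, hf.edge]

end IsBicMorphism

/-- The quantum groups of two universal objects are isomorphic. -/
theorem IsUniversalBicObject.isomorphic {𝒢 : DirectedMultigraph V E}
    (h₁ : IsUniversalBicObject 𝒢 Δ₁ α₁ lam₁) (h₂ : IsUniversalBicObject 𝒢 Δ₂ α₂ lam₂) :
    IsomorphicQuantumGroups Δ₁ Δ₂ := by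
  obtain ⟨f, hf, -⟩ := h₁.universal A₂ Δ₂ α₂ lam₂ h₂.isObject
  obtain ⟨g, hg, -⟩ := h₂.universal A₁ Δ₁ α₁ lam₁ h₁.isObject
  -- Both sides are endomorphisms of a universal object, which has only one.
  have hgf : g.comp f = StarAlgHom.id ℂ A₁ :=
    (h₁.universal A₁ Δ₁ α₁ lam₁ h₁.isObject).unique (hg.comp hf) IsBicMorphism.id
  have hfg : f.comp g = StarAlgHom.id ℂ A₂ :=
    (h₂.universal A₂ Δ₂ α₂ lam₂ h₂.isObject).unique (hf.comp hg) IsBicMorphism.id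
  exact ⟨StarAlgEquiv.ofStarAlgHom f g hgf hfg, hf.hopf⟩

end Morphisms

/-! ### The morphism from an arbitrary object -/

section Universal

variable {I J : Type u} [Fintype I] [Fintype J] [DecidableEq I] [DecidableEq J]
  {B : Type u} [CStarAlgebra B] {Δ : B →⋆ₐ[ℂ] MinTensor B B}
  {α : (J × PUnit.{u + 1} → ℂ) →ₗ[ℂ] (J × PUnit.{u + 1} → B)}
  {lam : (J × I → ℂ) →ₗ[ℂ] (J × I → B)}

namespace IsBicObject

/-- This is where the invariant state enters: the column sums of the vertex matrix are not part of
the axioms of an action. -/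
theorem vertex_isMagicUnitary
    (h : IsBicObject ((DirectedMultigraph.loops I).copies J) Δ α lam) :
    IsMagicUnitary fun l k : J => α (Pi.single (k, PUnit.unit) 1) (l, PUnit.unit) := by
  have hv := h.vertexAction.isMagicUnitary h.quantumGroup
  refine ⟨fun l k => hv.star_eq _ _, fun l k => hv.mul_self _ _, fun l => ?_, fun k => ?_⟩
  · have := hv.row_sum (l, PUnit.unit)
    simpa [Fintype.sum_prod_type] using this
  · have := hv.col_sum (k, PUnit.unit)
    simpa [Fintype.sum_prod_type] using this

/-- The inner product is preserved: the sum over the loops at a vertex. -/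
theorem sum_edge_col (h : IsBicObject ((DirectedMultigraph.loops I).copies J) Δ α lam)
    (l k : J) (i : I) : ∑ j, lam (Pi.single (k, i) 1) (l, j) =
      α (Pi.single (k, PUnit.unit) 1) (l, PUnit.unit) := by
  -- Test the inner product on a single loop: its indicator has inner product δ_k with itself, and
  -- on the other side every coefficient is a projection, so star-squares disappear.
  have h1 := congrFun (h.correspondence.map_innerProd (Pi.single (k, i) 1) (Pi.single (k, i) 1))
    (l, PUnit.unit)
  rw [DirectedMultigraph.innerProd, WreathAlgebra.sum_filter_fst] at h1
  simp only [h.edgeAction.star_apply_single, h.edgeAction.apply_single_mul, if_true] at h1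
  have h2 : ((DirectedMultigraph.loops I).copies J).innerProd (Pi.single (k, i) (1 : ℂ))
      (Pi.single (k, i) 1) = Pi.single (k, PUnit.unit) 1 := by
    funext ⟨p, ⟨⟩⟩
    rw [DirectedMultigraph.innerProd, WreathAlgebra.sum_filter_fst]
    rcases eq_or_ne p k with rfl | hp
    · rw [Finset.sum_eq_single i]
      · simp
      · intro j _ hj
        simp [hj]
      · simp
    · simp [hp]
  rw [h1, h2]

/-- The right module property for the indicator of a vertex: restricting a loop indicator to a
vertex keeps or kills it according to the copy the loop belongs to. For loops source and range
coincide, so the left action gives the mirror statement. -/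
theorem edge_mul_vertex (h : IsBicObject ((DirectedMultigraph.loops I).copies J) Δ α lam)
    (l k q : J) (j i : I) :
    lam (Pi.single (k, i) 1) (l, j) * α (Pi.single (q, PUnit.unit) 1) (l, PUnit.unit) =
      if k = q then lam (Pi.single (k, i) 1) (l, j) else 0 := by
  have h1 := congrFun (h.correspondence.map_rightSMul (Pi.single (k, i) 1)
    (Pi.single (q, PUnit.unit) 1)) (l, j)
  refine h1.symm.trans ?_
  have h2 : ((DirectedMultigraph.loops I).copies J).rightSMul (Pi.single (k, i) (1 : ℂ))
      (Pi.single (q, PUnit.unit) 1) = if k = q then Pi.single (k, i) 1 else 0 := by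
    funext ⟨p, j⟩
    simp only [DirectedMultigraph.rightSMul, DirectedMultigraph.copies, Pi.single_apply]
    split_ifs <;> simp_all
  rw [h2]
  split_ifs
  · rfl
  · rw [map_zero, Pi.zero_apply]

theorem vertex_mul_edge (h : IsBicObject ((DirectedMultigraph.loops I).copies J) Δ α lam)
    (l k q : J) (j i : I) :
    α (Pi.single (q, PUnit.unit) 1) (l, PUnit.unit) * lam (Pi.single (k, i) 1) (l, j) =
      if k = q then lam (Pi.single (k, i) 1) (l, j) else 0 := by
  have h1 := congrFun (h.correspondence.map_leftSMul (Pi.single (q, PUnit.unit) 1)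
    (Pi.single (k, i) 1)) (l, j)
  refine h1.symm.trans ?_
  have h2 : ((DirectedMultigraph.loops I).copies J).leftSMul (Pi.single (q, PUnit.unit) (1 : ℂ))
      (Pi.single (k, i) 1) = if k = q then Pi.single (k, i) 1 else 0 := by
    funext ⟨p, j⟩
    simp only [DirectedMultigraph.leftSMul, DirectedMultigraph.copies, Pi.single_apply]
    split_ifs <;> simp_all
  rw [h2]
  split_ifs
  · rfl
  · rw [map_zero, Pi.zero_apply]

variable (lam) in
/-- The images of the generators of the `l`-th copy of `C(S_n⁺)`. -/
def copyMatrix (l : J) (j i : I) : B := ∑ k, lam (Pi.single (k, i) 1) (l, j)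

/-- Entries are sums of mutually orthogonal projections from one row of the edge matrix. Summing a
column first over loops gives vertex entries, by preservation of the inner product, and these sum to
1 along their row. -/
theorem copyMatrix_isMagicUnitary
    (h : IsBicObject ((DirectedMultigraph.loops I).copies J) Δ α lam) (l : J) :
    IsMagicUnitary (copyMatrix lam l) where
  star_eq j i := by simp only [copyMatrix, star_sum, h.edgeAction.star_apply_single]
  mul_self j i := by
    simp only [copyMatrix, Finset.sum_mul_sum, h.edgeAction.apply_single_mul, Prod.mk.injEq,
      and_true, Finset.sum_ite_eq, Finset.mem_univ, if_true]
  row_sum j := by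
    have h1 := h.edgeAction.row_sum (l, j)
    rw [Fintype.sum_prod_type, Finset.sum_comm] at h1
    exact h1
  col_sum i := by
    simp only [copyMatrix]
    rw [Finset.sum_comm]
    simp only [h.sum_edge_col]
    exact h.vertex_isMagicUnitary.row_sum l

/-- Multiplying by the vertex entry selects one term of the sum over copies. The product in the
other order selects the same term, and this coincidence is the commutation relation of the wreath
product. -/
theorem copyMatrix_mul (h : IsBicObject ((DirectedMultigraph.loops I).copies J) Δ α lam)
    (l k : J) (j i : I) :
    copyMatrix lam l j i * α (Pi.single (k, PUnit.unit) 1) (l, PUnit.unit) =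
      lam (Pi.single (k, i) 1) (l, j) := by
  simp only [copyMatrix, Finset.sum_mul, h.edge_mul_vertex, Finset.sum_ite_eq', Finset.mem_univ,
    if_true]

theorem mul_copyMatrix (h : IsBicObject ((DirectedMultigraph.loops I).copies J) Δ α lam)
    (l k : J) (j i : I) :
    α (Pi.single (k, PUnit.unit) 1) (l, PUnit.unit) * copyMatrix lam l j i =
      lam (Pi.single (k, i) 1) (l, j) := by
  simp only [copyMatrix, Finset.mul_sum, h.vertex_mul_edge, Finset.sum_ite_eq', Finset.mem_univ,
    if_true]

/-- The homomorphism from the `l`-th copy of `C(S_n⁺)`. -/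
def copyHom (h : IsBicObject ((DirectedMultigraph.loops I).copies J) Δ α lam) (l : J) :
    PermAlgebra I →⋆ₐ[ℂ] B :=
  (permRelations I).lift (fun | .mk j i => copyMatrix lam l j i) (h.copyMatrix_isMagicUnitary l)

theorem copyHom_u (h : IsBicObject ((DirectedMultigraph.loops I).copies J) Δ α lam) (l : J)
    (j i : I) : h.copyHom l (PermAlgebra.u I j i) = copyMatrix lam l j i :=
  (permRelations I).lift_gen _ _ _

/-- The images of the generators of `C(S_n⁺ ≀_* S_m⁺)`. -/
def homGen (h : IsBicObject ((DirectedMultigraph.loops I).copies J) Δ α lam) :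
    WreathGen (PermAlgebra I) J → B
  | .copy l a => h.copyHom l a
  | .perm k l => α (Pi.single (l, PUnit.unit) 1) (k, PUnit.unit)

theorem homGen_holds (h : IsBicObject ((DirectedMultigraph.loops I).copies J) Δ α lam) :
    WreathHolds h.homGen where
  hom l := ⟨h.copyHom l, fun _ => rfl⟩
  magic := h.vertex_isMagicUnitary
  commute k l a := by
    change h.copyHom k a * α (Pi.single (l, PUnit.unit) 1) (k, PUnit.unit) =
      α (Pi.single (l, PUnit.unit) 1) (k, PUnit.unit) * h.copyHom k a
    have hc := MinTensor.continuous_starAlgHom (h.copyHom k)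
    refine PermAlgebra.induction (P := fun a =>
      h.copyHom k a * α (Pi.single (l, PUnit.unit) 1) (k, PUnit.unit) =
      α (Pi.single (l, PUnit.unit) 1) (k, PUnit.unit) * h.copyHom k a)
      (isClosed_eq (by fun_prop) (by fun_prop)) (fun j i => ?_) (fun c => ?_)
      (fun a b ha hb => ?_) (fun a b ha hb => ?_) a
    · rw [copyHom_u, copyMatrix_mul h, mul_copyMatrix h]
    · rw [AlgHomClass.commutes]
      exact Algebra.commutes c _
    · rw [map_add, add_mul, mul_add, ha, hb]
    · rw [map_mul, mul_assoc, hb, ← mul_assoc, ha, mul_assoc]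

/-- The morphism from an object to `S_n⁺ ≀_* S_m⁺`. -/
def hom (h : IsBicObject ((DirectedMultigraph.loops I).copies J) Δ α lam) :
    WreathAlgebra (PermAlgebra I) J →⋆ₐ[ℂ] B :=
  (wreathRelations (PermAlgebra I) J).lift h.homGen h.homGen_holds

theorem hom_ν (h : IsBicObject ((DirectedMultigraph.loops I).copies J) Δ α lam) (l : J)
    (j i : I) : h.hom (WreathAlgebra.ν (PermAlgebra I) J l (PermAlgebra.u I j i)) =
      copyMatrix lam l j i :=
  ((wreathRelations (PermAlgebra I) J).lift_gen _ _ _).trans (h.copyHom_u l j i)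

theorem hom_v (h : IsBicObject ((DirectedMultigraph.loops I).copies J) Δ α lam) (l k : J) :
    h.hom (WreathAlgebra.v (PermAlgebra I) J l k) =
      α (Pi.single (k, PUnit.unit) 1) (l, PUnit.unit) :=
  (wreathRelations (PermAlgebra I) J).lift_gen _ _ _

theorem hom_edgeMatrix (h : IsBicObject ((DirectedMultigraph.loops I).copies J) Δ α lam)
    (x k : J × I) : h.hom (WreathAlgebra.edgeMatrix I J x k) = lam (Pi.single k 1) x := by
  rw [WreathAlgebra.edgeMatrix, map_mul, hom_ν, hom_v, copyMatrix_mul h]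

/-- On edge entries both sides are matrix comultiplication of the coefficients of the object; sums
of edge entries give the copies ν_l, and the vertex coefficients treat v in the same way. -/
theorem hom_hopf (h : IsBicObject ((DirectedMultigraph.loops I).copies J) Δ α lam) :
    IsHopfStarHom (WreathAlgebra.comul J (permComul I)) Δ h.hom := by
  have hedge : ∀ x k, MinTensor.map h.hom h.hom (WreathAlgebra.comul J (permComul I)
      (WreathAlgebra.edgeMatrix I J x k)) = Δ (h.hom (WreathAlgebra.edgeMatrix I J x k)) :=
    fun x k => by
      rw [WreathAlgebra.comul_edgeMatrix, hom_edgeMatrix, h.edgeAction.coassoc.comul_apply,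
        map_sum]
      simp only [MinTensor.map_tmul, hom_edgeMatrix]
  have hext : (MinTensor.map h.hom h.hom).comp (WreathAlgebra.comul J (permComul I)) =
      Δ.comp h.hom := by
    refine WreathAlgebra.hom_ext_perm (fun l i j => ?_) (fun l k => ?_)
    · rw [StarAlgHom.comp_apply, StarAlgHom.comp_apply, ← WreathAlgebra.sum_edgeMatrix_row,
        map_sum, map_sum, map_sum, map_sum]
      exact Finset.sum_congr rfl fun k _ => hedge _ _
    · rw [StarAlgHom.comp_apply, StarAlgHom.comp_apply, WreathAlgebra.comul_v, hom_v,
        h.vertexAction.coassoc.comul_apply, map_sum, Fintype.sum_prod_type]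
      simp only [MinTensor.map_tmul, hom_v, Finset.univ_unique, Finset.sum_singleton]
  exact fun a => DFunLike.congr_fun hext a

theorem isBicMorphism_hom (h : IsBicObject ((DirectedMultigraph.loops I).copies J) Δ α lam) :
    IsBicMorphism Δ α lam (WreathAlgebra.comul J (permComul I))
      (matrixCoaction (WreathAlgebra.vertexMatrix I J))
      (matrixCoaction (WreathAlgebra.edgeMatrix I J)) h.hom where
  hopf := h.hom_hopf
  vertex f x := by
    rw [matrixCoaction_apply, map_sum, linearMap_apply_eq_sum α]
    refine Finset.sum_congr rfl fun k _ => ?_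
    rw [map_smul, WreathAlgebra.vertexMatrix, hom_v]
  edge f x := by
    rw [matrixCoaction_apply, map_sum, linearMap_apply_eq_sum lam]
    refine Finset.sum_congr rfl fun k _ => ?_
    rw [map_smul, hom_edgeMatrix]

end IsBicObject

variable (I J) in
/-- The free wreath product is a universal object. -/
theorem WreathAlgebra.isUniversalBicObject [Nonempty I] [Nonempty J] :
    IsUniversalBicObject ((DirectedMultigraph.loops I).copies J)
      (WreathAlgebra.comul J (permComul I)) (matrixCoaction (WreathAlgebra.vertexMatrix I J))
      (matrixCoaction (WreathAlgebra.edgeMatrix I J)) where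
  isObject := WreathAlgebra.isBicObject I J
  universal B _ Δ α lam h := by
    refine ⟨h.hom, h.isBicMorphism_hom, fun f hf => ?_⟩
    -- The edge condition prescribes a morphism on all edge entries, and the defining generators are
    -- sums of these.
    have hfe : ∀ x k, f (WreathAlgebra.edgeMatrix I J x k) =
        h.hom (WreathAlgebra.edgeMatrix I J x k) := fun x k => by
      rw [← matrixCoaction_single (WreathAlgebra.edgeMatrix I J), hf.edge,
        h.isBicMorphism_hom.edge]
    refine WreathAlgebra.hom_ext_perm (fun l i j => ?_) (fun l k => ?_)
    · rw [← WreathAlgebra.sum_edgeMatrix_row, map_sum, map_sum]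
      exact Finset.sum_congr rfl fun k _ => hfe _ _
    · rw [← WreathAlgebra.sum_edgeMatrix_col l k (Classical.arbitrary I), map_sum, map_sum]
      exact Finset.sum_congr rfl fun k _ => hfe _ _

end Universal

end

/-- Let `I` and `J` be finite nonempty sets with `n` and `m` elements, and let `𝒢` be the graph with
one vertex and loops indexed by `I`. The free wreath product `S_n⁺ ≀_* S_m⁺`, with its canonical
actions on the vertices and on the edges, is a universal object of the category
`C_Bic^mult(𝒢^{⊕ m})`, and the quantum group of every universal object is isomorphic to it. -/
theorem mainTheorem9 {I J : Type u} [Fintype I] [Fintype J] [DecidableEq I] [DecidableEq J]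
    [Nonempty I] [Nonempty J] :
    (∃ (α : (J × PUnit.{u + 1} → ℂ) →ₗ[ℂ]
          (J × PUnit.{u + 1} → WreathAlgebra (PermAlgebra I) J))
        (lam : (J × I → ℂ) →ₗ[ℂ] (J × I → WreathAlgebra (PermAlgebra I) J)),
      (∀ k l : J, α (Pi.single (k, PUnit.unit) 1) (l, PUnit.unit) =
        WreathAlgebra.v (PermAlgebra I) J l k) ∧
      (∀ (k l : J) (i j : I), lam (Pi.single (k, i) 1) (l, j) =
        WreathAlgebra.ν (PermAlgebra I) J l (PermAlgebra.u I j i) *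
          WreathAlgebra.v (PermAlgebra I) J l k) ∧
      IsUniversalBicObject ((DirectedMultigraph.loops I).copies J)
        (WreathAlgebra.comul J (permComul I)) α lam) ∧
    ∀ (A : Type u) [CStarAlgebra A] (Δ : A →⋆ₐ[ℂ] MinTensor A A)
      (α : (J × PUnit.{u + 1} → ℂ) →ₗ[ℂ] (J × PUnit.{u + 1} → A))
      (lam : (J × I → ℂ) →ₗ[ℂ] (J × I → A)),
      IsUniversalBicObject ((DirectedMultigraph.loops I).copies J) Δ α lam →
      IsomorphicQuantumGroups Δ (WreathAlgebra.comul J (permComul I)) :=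
  ⟨⟨matrixCoaction (WreathAlgebra.vertexMatrix I J), matrixCoaction (WreathAlgebra.edgeMatrix I J),
      fun k l => matrixCoaction_single (WreathAlgebra.vertexMatrix I J) (l, PUnit.unit)
        (k, PUnit.unit),
      fun k l i j => matrixCoaction_single (WreathAlgebra.edgeMatrix I J) (l, j) (k, i),
      WreathAlgebra.isUniversalBicObject I J⟩,
    fun _ _ _ _ _ h => h.isomorphic (WreathAlgebra.isUniversalBicObject I J)⟩
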